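/- Let $k$ be a field, let $r\ge 1$ be an integer, and let $B=k\langle x,y\rangle/(y^{r+1})$, graded by $\deg x=\deg y=1$. Let $\mathsf{gr}\,B$ be the category of finitely presented $\mathbb Z$-graded left $B$-modules with degree-preserving maps, $\mathsf{fdim}\,B$ its full subcategory of finite-dimensional modules, and $\mathsf{qgr}\,B=\mathsf{gr}\,B/\mathsf{fdim}\,B$ the quotient category. For $n\in\mathbb Z$ let $B(n)$ be $B$ with the grading $B(n)_i=B_{n+i}$, let $\mathcal O(n)$ be the image of $B(n)$ in $\mathsf{qgr}\,B$, and put $\mathcal O=\mathcal O(0)$. Then the polynomial $x^{r+1}-x^r-\cdots-x-1$ has a unique positive real root $\alpha$, and: 1. There is a unique group homomorphism $K_0(\mathsf{qgr}\,B)\to\mathbb R$ with $[\mathcal O(n)]\mapsto\alpha^n$ for all $n\in\mathbb Z$ (in particular $[\mathcal O]\mapsto 1$). It is injective and maps $K_0(\mathsf{qgr}\,B)$ isomorphically onto $\mathbb Z[\alpha]$. 2. Under this homomorphism the image of the positive cone $\{[\mathcal F] : \mathcal F\in\mathsf{qgr}\,B\}$ of $K_0(\mathsf{qgr}\,B)$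 is $\mathbb Z[\alpha]\cap\mathbb R_{\ge 0}=\mathbb Z[\alpha^{-1}]\cap\mathbb R_{\ge 0}$. -/

import Mathlib

open CategoryTheory CategoryTheory.Limits

universe u

/-! ## Graded left modules over a `ℤ`-graded algebra -/

/-- A `ℤ`-graded left module over the `k`-algebra `A` with homogeneous components `𝒜 i`:
a left `A`-module `M` which is the direct sum of `k`-subspaces `M_i`, `i ∈ ℤ`, such that
`A_i M_j ⊆ M_{i+j}`. -/
structure GrMod (k : Type u) [Field k] (A : Type u) [Ring A] [Algebra k A]
    (𝒜 : ℤ → Submodule k A) : Type (u + 1) where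
  /-- the underlying left module -/
  carrier : Type u
  [addCommGroup : AddCommGroup carrier]
  [moduleA : Module A carrier]
  [modulek : Module k carrier]
  [tower : IsScalarTower k A carrier]
  /-- the homogeneous components -/
  deg : ℤ → Submodule k carrier
  isInternal : DirectSum.IsInternal deg
  smul_mem : ∀ (i j : ℤ) (a : A) (m : carrier), a ∈ 𝒜 i → m ∈ deg j → a • m ∈ deg (i + j)

namespace GrMod

variable {k : Type u} [Field k] {A : Type u} [Ring A] [Algebra k A] {𝒜 : ℤ → Submodule k A}

attribute [instance] addCommGroup moduleA modulek tower

/-- Morphisms of graded modules: `A`-linear maps that preserve degree. -/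
@[ext]
structure Hom (M N : GrMod k A 𝒜) : Type u where
  /-- the underlying linear map -/
  toLin : M.carrier →ₗ[A] N.carrier
  map_deg : ∀ (i : ℤ) (m : M.carrier), m ∈ M.deg i → toLin m ∈ N.deg i

/-- The category `Gr A` of graded left `A`-modules. -/
instance : Category (GrMod k A 𝒜) where
  Hom M N := Hom M N
  id M := ⟨LinearMap.id, fun _ _ h => h⟩
  comp f g := ⟨g.toLin.comp f.toLin, fun i m h => g.map_deg i _ (f.map_deg i m h)⟩

/-- The degree shift `M(n)`: the same module with the grading `M(n)_i = M_{n+i}`. -/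
def shift (M : GrMod k A 𝒜) (n : ℤ) : GrMod k A 𝒜 where
  carrier := M.carrier
  deg i := M.deg (n + i)
  isInternal := by
    have h := (DirectSum.isInternal_submodule_iff_iSupIndep_and_iSup_eq_top _).1 M.isInternal
    refine (DirectSum.isInternal_submodule_iff_iSupIndep_and_iSup_eq_top _).2 ⟨?_, ?_⟩
    · exact h.1.comp (add_right_injective n)
    · exact ((Equiv.addLeft n).iSup_comp (g := M.deg)).trans h.2
  smul_mem i j a m ha hm := by
    have := M.smul_mem i (n + j) a m ha hm
    rwa [show i + (n + j) = n + (i + j) by ring] at this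

variable (𝒜) in
/-- The zero module. -/
def zero : GrMod k A 𝒜 where
  carrier := PUnit
  deg _ := ⊤
  isInternal := by
    refine (DirectSum.isInternal_submodule_iff_iSupIndep_and_iSup_eq_top _).2
      ⟨fun i => ?_, Subsingleton.elim _ _⟩
    rw [disjoint_iff]
    exact Subsingleton.elim _ _
  smul_mem _ _ _ _ _ _ := trivial

variable (𝒜) in
/-- `A` as a graded left module over itself. -/
def self [GradedAlgebra 𝒜] : GrMod k A 𝒜 where
  carrier := A
  deg := 𝒜
  isInternal := DirectSum.Decomposition.isInternal 𝒜
  smul_mem _ _ _ _ ha hm := SetLike.mul_mem_graded ha hm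

end GrMod

section Quotient

variable {k : Type u} [Field k] {A : Type u} [Ring A] [Algebra k A] (𝒜 : ℤ → Submodule k A)

/-- The property of a graded module of being finitely presented. -/
def GrMod.isFinPres : ObjectProperty (GrMod k A 𝒜) :=
  fun M => Module.FinitePresentation A M.carrier

/-- The category `gr A`: the full subcategory of `Gr A` consisting of the finitely presented
modules. -/
abbrev FpGrMod : Type (u + 1) := (GrMod.isFinPres 𝒜).FullSubcategory

/-- The morphisms of `gr A` that become invertible in the quotient by the subcategory `fdim A` of
finite dimensional modules: those with finite dimensional kernel and cokernel. -/
def finDimIso : MorphismProperty (FpGrMod 𝒜) := fun _ N f =>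
  FiniteDimensional k (LinearMap.ker f.hom.toLin) ∧
    FiniteDimensional k (N.obj.carrier ⧸ LinearMap.range f.hom.toLin)

/-- The category `qgr A = gr A / fdim A`: the localization of `gr A` at the morphisms whose
kernel and cokernel are finite dimensional. -/
abbrev Qgr : Type (u + 1) := (finDimIso 𝒜).Localization

/-- The quotient functor `gr A ⥤ qgr A`. -/
abbrev quotientFunctor : FpGrMod 𝒜 ⥤ Qgr 𝒜 := (finDimIso 𝒜).Q

/-- The zero module as an object of `gr A`. -/
def FpGrMod.zero : FpGrMod 𝒜 where
  obj := GrMod.zero 𝒜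
  property :=
    Module.finitePresentation_of_projective A PUnit.{u + 1}

theorem FpGrMod.isZero_zero : IsZero (FpGrMod.zero 𝒜) where
  unique_to M := ⟨⟨⟨⟨⟨0, fun i _ _ => (M.obj.deg i).zero_mem⟩⟩⟩, fun f => by
    apply ObjectProperty.hom_ext
    apply GrMod.Hom.ext
    apply LinearMap.ext
    intro m
    exact (congrArg f.hom.toLin (Subsingleton.elim (α := PUnit) m 0)).trans
      (map_zero f.hom.toLin)⟩⟩
  unique_from M := ⟨⟨⟨⟨⟨0, fun _ _ _ => trivial⟩⟩⟩, fun f => by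
    apply ObjectProperty.hom_ext
    apply GrMod.Hom.ext
    apply LinearMap.ext
    intro m
    exact Subsingleton.elim (α := PUnit) _ _⟩⟩

/-- A localization functor sends a zero object to a zero object. -/
theorem isZero_Q_obj {C : Type*} [Category C] (W : MorphismProperty C) {Z : C} (hZ : IsZero Z) :
    IsZero (W.Q.obj Z) := by
  constructor
  · let τ : W.Q ⋙ (Functor.const W.Localization).obj (W.Q.obj Z) ⟶ W.Q ⋙ 𝟭 W.Localization :=
      { app := fun X => W.Q.map (hZ.to_ X)
        naturality := fun X Y f => by
          simp only [Functor.comp_map, Functor.const_obj_map, Functor.id_map, ← W.Q.map_comp]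
          erw [Category.id_comp]
          exact congrArg W.Q.map (hZ.eq_of_src _ _) }
    let θ := ((Localization.whiskeringLeftFunctor' W.Q W W.Localization).preimage τ :
      (Functor.const W.Localization).obj (W.Q.obj Z) ⟶ 𝟭 W.Localization)
    have hθ : ∀ X, θ.app (W.Q.obj X) = W.Q.map (hZ.to_ X) := fun X =>
      congrArg (fun t => NatTrans.app t X)
        ((Localization.whiskeringLeftFunctor' W.Q W W.Localization).map_preimage τ)
    intro Y
    refine ⟨⟨⟨θ.app Y⟩, fun f => ?_⟩⟩
    have h := θ.naturality f
    rw [hθ, hZ.eq_of_src (hZ.to_ Z) (𝟙 Z), W.Q.map_id] at h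
    simpa using h.symm
  · let τ : W.Q ⋙ 𝟭 W.Localization ⟶ W.Q ⋙ (Functor.const W.Localization).obj (W.Q.obj Z) :=
      { app := fun X => W.Q.map (hZ.from_ X)
        naturality := fun X Y f => by
          simp only [Functor.comp_map, Functor.const_obj_map, Functor.id_map, ← W.Q.map_comp]
          erw [Category.comp_id]
          exact congrArg W.Q.map (hZ.eq_of_tgt _ _) }
    let θ := ((Localization.whiskeringLeftFunctor' W.Q W W.Localization).preimage τ :
      𝟭 W.Localization ⟶ (Functor.const W.Localization).obj (W.Q.obj Z))
    have hθ : ∀ X, θ.app (W.Q.obj X) = W.Q.map (hZ.from_ X) := fun X =>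
      congrArg (fun t => NatTrans.app t X)
        ((Localization.whiskeringLeftFunctor' W.Q W W.Localization).map_preimage τ)
    intro Y
    refine ⟨⟨⟨θ.app Y⟩, fun f => ?_⟩⟩
    have h := θ.naturality f
    rw [hθ, hZ.eq_of_tgt (hZ.from_ Z) (𝟙 Z), W.Q.map_id] at h
    simpa using h

/-- The zero morphisms of `qgr A`: those that factor through the zero object. -/
noncomputable instance : HasZeroMorphisms (Qgr 𝒜) :=
  (isZero_Q_obj (finDimIso 𝒜) (FpGrMod.isZero_zero 𝒜)).hasZeroMorphisms

end Quotient

/-! ## Grothendieck groups -/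

/-- The subgroup of the free abelian group on the objects of `C` generated by the elements
`[Y] - [X] - [Z]` for all short exact sequences `0 ⟶ X ⟶ Y ⟶ Z ⟶ 0`. -/
def K0.relations (C : Type*) [Category C] [HasZeroMorphisms C] :
    AddSubgroup (FreeAbelianGroup C) :=
  AddSubgroup.closure {a | ∃ S : ShortComplex C, S.ShortExact ∧
    a = FreeAbelianGroup.of S.X₂ - FreeAbelianGroup.of S.X₁ - FreeAbelianGroup.of S.X₃}

/-- The Grothendieck group of an (abelian) category. -/
abbrev K0 (C : Type*) [Category C] [HasZeroMorphisms C] : Type _ :=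
  FreeAbelianGroup C ⧸ K0.relations C

/-- The class `[X]` of an object in the Grothendieck group. -/
def K0.of {C : Type*} [Category C] [HasZeroMorphisms C] (X : C) : K0 C :=
  QuotientAddGroup.mk (FreeAbelianGroup.of X)

/-- The positive cone of the Grothendieck group: the set of classes of objects. -/
def K0.positiveCone (C : Type*) [Category C] [HasZeroMorphisms C] : Set (K0 C) :=
  Set.range (K0.of : C → K0 C)

/-! ## The algebra `B = k⟨x, y⟩ / (y ^ (r + 1))` -/

section Algebra

variable (k : Type u) [Field k] (r : ℕ)

/-- The relation `y ^ (r + 1) = 0` on the free algebra on `x = ι 0` and `y = ι 1`. -/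
inductive PenroseRel : FreeAlgebra k (Fin 2) → FreeAlgebra k (Fin 2) → Prop
  | y_pow : PenroseRel (FreeAlgebra.ι k 1 ^ (r + 1)) 0

/-- The algebra `k⟨x, y⟩ / (y ^ (r + 1))`. -/
abbrev PenroseAlg : Type u := RingQuot (PenroseRel k r)

namespace PenroseAlg

/-- The generators: `gen 0` is `x` and `gen 1` is `y`. -/
noncomputable def gen (i : Fin 2) : PenroseAlg k r :=
  RingQuot.mkAlgHom k (PenroseRel k r) (FreeAlgebra.ι k i)

/-- The grading with `deg x = deg y = 1`: the component of degree `n` is spanned by the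
words of length `n` in `x` and `y` (so it is zero for `n < 0`). -/
def grading (n : ℤ) : Submodule k (PenroseAlg k r) :=
  Submodule.span k {b | ∃ w : List (Fin 2), (w.length : ℤ) = n ∧ b = (w.map (gen k r)).prod}

instance : SetLike.GradedMonoid (grading k r) where
  one_mem := Submodule.subset_span ⟨[], rfl, rfl⟩
  mul_mem i j a b ha hb := by
    have h := Submodule.mul_mem_mul ha hb
    rw [grading, grading, Submodule.span_mul_span] at h
    refine Submodule.span_mono ?_ h
    rintro _ ⟨_, ⟨v, hv, rfl⟩, _, ⟨w, hw, rfl⟩, rfl⟩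
    exact ⟨v ++ w, by simp [hv, hw], by simp⟩

theorem gen_mem (i : Fin 2) : gen k r i ∈ grading k r 1 :=
  Submodule.subset_span ⟨[i], by simp, by simp⟩

theorem gen_one_pow : gen k r 1 ^ (r + 1) = 0 := by
  rw [gen, ← map_pow, RingQuot.mkAlgHom_rel k PenroseRel.y_pow, map_zero]

/-- A generator as an element of degree one of `⨁ B_i`. -/
noncomputable def genDeg (i : Fin 2) : DirectSum ℤ fun n => grading k r n :=
  DirectSum.of (fun n => grading k r n) 1 ⟨gen k r i, gen_mem k r i⟩

theorem genDeg_one_pow : genDeg k r 1 ^ (r + 1) = 0 := by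
  rw [genDeg, DirectSum.ofPow]
  exact (congrArg _ (Subtype.ext (gen_one_pow k r))).trans
    (map_zero (DirectSum.of (fun n => grading k r n) ((r + 1) • 1)))

/-- The decomposition of an element of `B` into its homogeneous components. -/
noncomputable def decomp : PenroseAlg k r →ₐ[k] DirectSum ℤ fun n => grading k r n :=
  RingQuot.liftAlgHom k ⟨FreeAlgebra.lift k (genDeg k r), by
    rintro _ _ ⟨⟩
    rw [map_pow, FreeAlgebra.lift_ι_apply, genDeg_one_pow, map_zero]⟩

theorem decomp_gen (i : Fin 2) : decomp k r (gen k r i) = genDeg k r i := by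
  rw [decomp, gen, RingQuot.liftAlgHom_mkAlgHom_apply, FreeAlgebra.lift_ι_apply]

theorem decomp_word (w : List (Fin 2)) (h : (w.map (gen k r)).prod ∈ grading k r w.length) :
    decomp k r (w.map (gen k r)).prod =
      DirectSum.of (fun n => grading k r n) (w.length : ℤ) ⟨(w.map (gen k r)).prod, h⟩ := by
  induction w with
  | nil =>
    exact map_one (decomp k r)
  | cons i w ih =>
    have hw : (w.map (gen k r)).prod ∈ grading k r w.length :=
      Submodule.subset_span ⟨w, rfl, rfl⟩
    simp only [List.map_cons, List.prod_cons]
    rw [map_mul, ih hw, decomp_gen, genDeg, DirectSum.of_mul_of]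
    exact DirectSum.of_eq_of_gradedMonoid_eq
      (Sigma.subtype_ext (add_comm (1 : ℤ) (w.length : ℤ)) rfl)

noncomputable instance : GradedAlgebra (grading k r) :=
  GradedAlgebra.ofAlgHom _ (decomp k r)
    (by
      apply RingQuot.ringQuot_ext'
      apply FreeAlgebra.hom_ext
      funext i
      change DirectSum.coeAlgHom (grading k r) (decomp k r (gen k r i)) = gen k r i
      rw [decomp_gen, genDeg, DirectSum.coeAlgHom_of])
    (fun n x => by
      obtain ⟨x, hx⟩ := x
      dsimp only
      induction hx using Submodule.span_induction with
      | mem b hb =>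
        obtain ⟨w, rfl, rfl⟩ := hb
        exact decomp_word k r w _
      | zero => rw [map_zero]; exact (map_zero _).symm
      | add a b ha hb iha ihb =>
        rw [map_add, iha, ihb, ← map_add]
        rfl
      | smul c a ha iha =>
        rw [map_smul, iha]
        exact (map_smul (DirectSum.lof k ℤ (fun n => grading k r n) n) c ⟨a, ha⟩).symm)

/-- The structure sheaf twisted by `n`: the image `𝒪(n)` of `B(n)` in `qgr B`. -/
noncomputable def twistedO (n : ℤ) : Qgr (grading k r) :=
  (quotientFunctor (grading k r)).obj
    { obj := (GrMod.self (grading k r)).shift n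
      property := inferInstanceAs (Module.FinitePresentation (PenroseAlg k r) (PenroseAlg k r)) }

end PenroseAlg

end Algebra

/-! ## Sequences with positive averaging recurrences -/

section Numerics

open Filter Topology

/-! Splitting a word after its first `x` gives `B = span(1, …, yʳ) ⊕ ⨁_{i ≤ r} yⁱ x B`. So the
`k`-linear map `theta`, `(m₀, …, mᵣ) ↦ ∑ yⁱ x mᵢ`, is injective with finite-dimensional cokernel on
a free module of finite rank, and through a presentation it has finite-dimensional kernel and
cokernel on every finitely presented `M`. In large degrees it therefore identifies `Mₙ` with `⨁
M_{n-1-i}` (`exists_isRecursive`). Kernels of maps between such modules inherit this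
(`exists_isRecursive_ker`).

Generators. A family of spaces with this property agrees in large degrees with a graded free module
whose generators have degrees `N+1, …, N+1+r`, for any large `N` (`IsRecursive.exists_cover`). Hence
every class of an object is a sum of classes of `𝒪(-(N+1+l))`, `0 ≤ l ≤ r`, and these twists
generate `K₀`.

The homomorphism. The dimensions `dₙ = dim Mₙ` eventually satisfy `d_{n+r+1} = dₙ + ⋯ + d_{n+r}`.
The functional `s ↦ ∑ (α⁻¹ + ⋯ + α⁻ʲ⁻¹) sⱼ` on solutions of this recurrence is multiplied by `α`
under a shift, so rescaling it by `α⁻ⁿ` on the window at `n` gives an eventually constant `rank`. A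
short exact sequence in `qgr B` is exact on modules in large degrees (`dim_add_of_shortExact`), so
`rank` is additive; normalized by the rank of `B`, it sends `𝒪(n)` to `αⁿ`.

Arithmetic. Injectivity amounts to the independence of `α⁻¹, …, α⁻ʳ⁻¹` over `ℤ`: an integral
solution killed by the functional converges to `0`, hence vanishes. For the positive cone, a
solution on which the functional is positive is eventually positive, and evaluating the functional
on a late window writes a positive `β ∈ ℤ[α]` as a sum of powers of `α`. The irreducibility of the
polynomial is not needed. -/

theorem averaging_step {r : ℕ} {w : ℕ → ℝ} {δ : ℝ} {t : ℕ → ℝ}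
    (hδ : ∀ i ∈ Finset.range (r + 1), δ ≤ w i) (hδ0 : 0 < δ)
    (hw : ∑ i ∈ Finset.range (r + 1), w i = 1)
    (ht : ∀ n, t (n + (r + 1)) = ∑ i ∈ Finset.range (r + 1), w i * t (n + i))
    {n : ℕ} {a b : ℝ} (h : ∀ m, n ≤ m → a ≤ t m ∧ t m ≤ b) :
    ∀ m, n + (r + 1) ≤ m → a + δ * (t (n + r) - a) ≤ t m ∧ t m ≤ b - δ * (b - t (n + r)) := by
  have w0 : ∀ i ∈ Finset.range (r + 1), 0 ≤ w i := fun i hi => hδ0.le.trans (hδ i hi)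
  -- Each of the next `r + 1` terms averages a window containing the index `n + r`, with weight at
  -- least `δ` there, which pulls it away from both ends of `[a, b]`.
  have main : ∀ q, q ≤ r → a + δ * (t (n + r) - a) ≤ t (n + (r + 1) + q) ∧
      t (n + (r + 1) + q) ≤ b - δ * (b - t (n + r)) := by
    intro q hq
    have hmem : r - q ∈ Finset.range (r + 1) := Finset.mem_range.2 (by omega)
    have e : n + q + (r - q) = n + r := by omega
    have h1 := h (n + r) (by omega)
    have hd := hδ _ hmem
    rw [show n + (r + 1) + q = (n + q) + (r + 1) by ring, ht]
    constructor
    · have : w (r - q) * (t (n + q + (r - q)) - a) ≤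
          ∑ i ∈ Finset.range (r + 1), w i * (t (n + q + i) - a) :=
        Finset.single_le_sum (f := fun i => w i * (t (n + q + i) - a))
          (fun i hi => mul_nonneg (w0 i hi) (sub_nonneg.2 (h _ (by omega)).1)) hmem
      simp only [mul_sub, Finset.sum_sub_distrib, ← Finset.sum_mul, hw] at this
      rw [e] at this
      nlinarith
    · have : w (r - q) * (b - t (n + q + (r - q))) ≤
          ∑ i ∈ Finset.range (r + 1), w i * (b - t (n + q + i)) :=
        Finset.single_le_sum (f := fun i => w i * (b - t (n + q + i)))
          (fun i hi => mul_nonneg (w0 i hi) (sub_nonneg.2 (h _ (by omega)).2)) hmem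
      simp only [mul_sub, Finset.sum_sub_distrib, ← Finset.sum_mul, hw] at this
      rw [e] at this
      nlinarith
  intro m
  induction m using Nat.strong_induction_on with
  | _ m ih =>
    intro hm
    by_cases hq : m ≤ n + (r + 1) + r
    · have := main (m - (n + (r + 1))) (by omega)
      rwa [show n + (r + 1) + (m - (n + (r + 1))) = m by omega] at this
    · obtain ⟨p, rfl⟩ : ∃ p, m = p + (r + 1) := ⟨m - (r + 1), by omega⟩
      have hb : ∀ i ∈ Finset.range (r + 1), a + δ * (t (n + r) - a) ≤ t (p + i) ∧
          t (p + i) ≤ b - δ * (b - t (n + r)) := fun i hi =>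
        ih (p + i) (by have := Finset.mem_range.1 hi; omega) (by omega)
      rw [ht]
      constructor
      · calc a + δ * (t (n + r) - a)
            = ∑ i ∈ Finset.range (r + 1), w i * (a + δ * (t (n + r) - a)) := by
              rw [← Finset.sum_mul, hw, one_mul]
          _ ≤ _ := Finset.sum_le_sum fun i hi => mul_le_mul_of_nonneg_left (hb i hi).1 (w0 i hi)
      · calc _ ≤ ∑ i ∈ Finset.range (r + 1), w i * (b - δ * (b - t (n + r))) :=
              Finset.sum_le_sum fun i hi => mul_le_mul_of_nonneg_left (hb i hi).2 (w0 i hi)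
          _ = _ := by rw [← Finset.sum_mul, hw, one_mul]

/-- A real sequence each term of which is a fixed positive weighted average of the preceding
`r + 1` terms converges. -/
theorem exists_tendsto_of_averaging {r : ℕ} {w : ℕ → ℝ} {t : ℕ → ℝ}
    (hpos : ∀ i ∈ Finset.range (r + 1), 0 < w i)
    (hw : ∑ i ∈ Finset.range (r + 1), w i = 1)
    (ht : ∀ n, t (n + (r + 1)) = ∑ i ∈ Finset.range (r + 1), w i * t (n + i)) :
    ∃ l, Tendsto t atTop (𝓝 l) := by
  obtain ⟨i₀, hi₀, hmin⟩ := Finset.exists_min_image (Finset.range (r + 1)) w ⟨0, by simp⟩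
  set δ := w i₀
  have hδ0 : 0 < δ := hpos i₀ hi₀
  have w0 : ∀ i ∈ Finset.range (r + 1), 0 ≤ w i := fun i hi => (hpos i hi).le
  have hδ1 : δ ≤ 1 := by
    rw [← hw]
    exact Finset.single_le_sum (f := w) w0 hi₀
  set C := ∑ i ∈ Finset.range (r + 1), |t i|
  have hC : ∀ m, -C ≤ t m ∧ t m ≤ C := by
    intro m
    induction m using Nat.strong_induction_on with
    | _ m ih =>
      by_cases hm : m < r + 1
      · exact abs_le.1 (Finset.single_le_sum (f := fun i => |t i|) (fun i _ => abs_nonneg _)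
          (Finset.mem_range.2 hm))
      · obtain ⟨p, rfl⟩ : ∃ p, m = p + (r + 1) := ⟨m - (r + 1), by omega⟩
        have hb : ∀ i ∈ Finset.range (r + 1), -C ≤ t (p + i) ∧ t (p + i) ≤ C := fun i hi =>
          ih (p + i) (by have := Finset.mem_range.1 hi; omega)
        rw [ht]
        constructor
        · calc -C = ∑ i ∈ Finset.range (r + 1), w i * (-C) := by
                rw [← Finset.sum_mul, hw, one_mul]
            _ ≤ _ := Finset.sum_le_sum fun i hi =>
              mul_le_mul_of_nonneg_left (hb i hi).1 (w0 i hi)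
        · calc _ ≤ ∑ i ∈ Finset.range (r + 1), w i * C :=
                Finset.sum_le_sum fun i hi => mul_le_mul_of_nonneg_left (hb i hi).2 (w0 i hi)
            _ = _ := by rw [← Finset.sum_mul, hw, one_mul]
  -- The new ends `a + δ(t - a)` and `b - δ(b - t)` are at distance `(1 - δ)(b - a)` whatever `t`
  -- is, so each block of `r + 1` terms contracts the interval by `1 - δ`.
  have key : ∀ j : ℕ, ∃ a b : ℝ, b - a = (1 - δ) ^ j * (2 * C) ∧
      ∀ m, j * (r + 1) ≤ m → a ≤ t m ∧ t m ≤ b := by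
    intro j
    induction j with
    | zero => exact ⟨-C, C, by ring, fun m _ => hC m⟩
    | succ j ih =>
      obtain ⟨a, b, hab, h⟩ := ih
      refine ⟨_, _, ?_, fun m hm => averaging_step hmin hδ0 hw ht h m ?_⟩
      · rw [pow_succ, mul_right_comm, ← hab]
        ring
      · linarith [Nat.succ_mul j (r + 1)]
  refine cauchySeq_tendsto_of_complete (Metric.cauchySeq_iff'.2 fun ε hε => ?_)
  have hlim : Tendsto (fun j : ℕ => (1 - δ) ^ j * (2 * C)) atTop (𝓝 0) := by
    simpa using (tendsto_pow_atTop_nhds_zero_of_lt_one (sub_nonneg.2 hδ1)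
      (by linarith : 1 - δ < 1)).mul_const (2 * C)
  obtain ⟨j, hj⟩ := (hlim.eventually_lt_const hε).exists
  obtain ⟨a, b, hab, h⟩ := key j
  refine ⟨j * (r + 1), fun n hn => ?_⟩
  have h1 := h n hn
  have h2 := h _ le_rfl
  rw [Real.dist_eq, abs_lt]
  constructor <;> linarith

/-! ### The root `α` and the weights of the functional. -/

/-- The partial sums `α⁻¹ + ⋯ + α⁻ʲ`. -/
noncomputable def invSum (α : ℝ) (j : ℕ) : ℝ := ∑ i ∈ Finset.range j, α⁻¹ ^ (i + 1)

theorem invSum_succ (α : ℝ) (j : ℕ) : invSum α (j + 1) = invSum α j + α⁻¹ ^ (j + 1) :=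
  Finset.sum_range_succ _ _

theorem mul_invSum_succ {α : ℝ} (hα : 0 < α) (j : ℕ) :
    α * invSum α (j + 1) = 1 + invSum α j := by
  induction j with
  | zero => simp [invSum, hα.ne']
  | succ j ih =>
    rw [invSum_succ, mul_add, ih, invSum_succ α j, pow_succ' _ (j + 1), ← mul_assoc,
      mul_inv_cancel₀ hα.ne']
    ring

theorem invSum_pos {α : ℝ} (hα : 0 < α) (j : ℕ) : 0 < invSum α (j + 1) :=
  Finset.sum_pos (fun _ _ => by positivity) ⟨0, by simp⟩

/-- Summation by parts: it converts coefficients of powers of `α⁻¹` into coefficients of their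
partial sums. -/
theorem sum_invSum_mul_sub (α : ℝ) (a : ℕ → ℝ) (m : ℕ) :
    ∑ j ∈ Finset.range m, invSum α (j + 1) * (a j - a (j + 1)) =
      ∑ j ∈ Finset.range m, a j * α⁻¹ ^ (j + 1) - invSum α m * a m := by
  induction m with
  | zero => simp [invSum]
  | succ m ih =>
    rw [Finset.sum_range_succ, ih, Finset.sum_range_succ, invSum_succ]
    ring

/-- The defining equation of the positive root `α`, as an equation for `α⁻¹`. -/
def IsBonacciRoot (r : ℕ) (α : ℝ) : Prop := 0 < α ∧ invSum α (r + 1) = 1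

theorem isBonacciRoot_iff {r : ℕ} {α : ℝ} (hα : 0 < α) :
    IsBonacciRoot r α ↔ α ^ (r + 1) - ∑ i ∈ Finset.range (r + 1), α ^ i = 0 := by
  have h : ∑ i ∈ Finset.range (r + 1), α ^ i = α ^ (r + 1) * invSum α (r + 1) := by
    rw [invSum, Finset.mul_sum, ← Finset.sum_range_reflect]
    refine Finset.sum_congr rfl fun i hi => ?_
    have := Finset.mem_range.1 hi
    rw [inv_pow, ← div_eq_mul_inv, eq_div_iff (by positivity), ← pow_add]
    congr 1
    omega
  rw [h, IsBonacciRoot]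
  constructor
  · rintro ⟨-, h⟩
    rw [h, mul_one, sub_self]
  · intro h
    refine ⟨hα, ?_⟩
    have h2 : α ^ (r + 1) * (invSum α (r + 1) - 1) = 0 := by linear_combination -h
    rcases mul_eq_zero.1 h2 with h3 | h3
    · exact absurd h3 (by positivity)
    · linarith

/-- The polynomial takes the value `-r` at `1` and `1` at `2`. Uniqueness holds because, after
division by `α ^ (r + 1)`, the equation sets equal to `1` a strictly decreasing function of `α`. -/
theorem existsUnique_bonacciRoot (r : ℕ) :
    ∃! α : ℝ, 0 < α ∧ α ^ (r + 1) - ∑ i ∈ Finset.range (r + 1), α ^ i = 0 := by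
  have hex : ∃ α : ℝ, α ∈ Set.Icc (1 : ℝ) 2 ∧
      α ^ (r + 1) - ∑ i ∈ Finset.range (r + 1), α ^ i = 0 := by
    have hc : ContinuousOn (fun α : ℝ => α ^ (r + 1) - ∑ i ∈ Finset.range (r + 1), α ^ i)
        (Set.Icc 1 2) := by fun_prop
    have := intermediate_value_Icc (by norm_num : (1 : ℝ) ≤ 2) hc
    have hg : ∑ i ∈ Finset.range (r + 1), (2 : ℝ) ^ i = 2 ^ (r + 1) - 1 := by
      rw [geom_sum_eq (by norm_num)]
      norm_num
    exact this ⟨by simp, by simp only [hg]; norm_num⟩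
  obtain ⟨α, hI, hα⟩ := hex
  have hα0 : 0 < α := by linarith [hI.1]
  refine ⟨α, ⟨hα0, hα⟩, ?_⟩
  rintro β ⟨hβ0, hβ⟩
  have hanti : ∀ a b : ℝ, 0 < a → a < b → invSum b (r + 1) < invSum a (r + 1) := by
    intro a b ha hab
    refine Finset.sum_lt_sum_of_nonempty ⟨0, by simp⟩ fun i _ => ?_
    exact pow_lt_pow_left₀ (inv_strictAnti₀ ha hab) (by have := ha.trans hab; positivity)
      (by omega)
  have h1 := ((isBonacciRoot_iff hα0).2 hα).2
  have h2 := ((isBonacciRoot_iff hβ0).2 hβ).2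
  rcases lt_trichotomy β α with h | h | h
  · have := hanti β α hβ0 h
    linarith
  · exact h
  · have := hanti α β hα0 h
    linarith

variable {r : ℕ} {α : ℝ}

/-- The eigenvalue equation for the functional `s ↦ ∑ j, (α⁻¹ + ⋯ + α⁻ʲ⁻¹) s j` on sequences with
`s (n + r + 1) = s n + ⋯ + s (n + r)`. -/
theorem sum_invSum_shift (hα : IsBonacciRoot r α) (s : ℕ → ℝ)
    (hs : s (r + 1) = ∑ i ∈ Finset.range (r + 1), s i) :
    ∑ j ∈ Finset.range (r + 1), invSum α (j + 1) * s (j + 1) =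
      α * ∑ j ∈ Finset.range (r + 1), invSum α (j + 1) * s j := by
  rw [Finset.sum_range_succ, hα.2, hs, one_mul, Finset.mul_sum]
  have h : ∀ j, α * (invSum α (j + 1) * s j) = invSum α j * s j + s j := fun j => by
    rw [← mul_assoc, mul_invSum_succ hα.1]
    ring
  simp only [h, Finset.sum_add_distrib]
  rw [Finset.sum_range_succ' (fun j => invSum α j * s j)]
  simp [invSum]

theorem sum_invSum_shift_iterate (hα : IsBonacciRoot r α) (s : ℕ → ℝ)
    (hs : ∀ n, s (n + (r + 1)) = ∑ i ∈ Finset.range (r + 1), s (n + i)) (n : ℕ) :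
    ∑ j ∈ Finset.range (r + 1), invSum α (j + 1) * s (n + j) =
      α ^ n * ∑ j ∈ Finset.range (r + 1), invSum α (j + 1) * s j := by
  induction n with
  | zero => simp
  | succ n ih =>
    have := sum_invSum_shift hα (fun j => s (n + j)) (hs n)
    rw [pow_succ', mul_assoc, ← ih, ← this]
    exact Finset.sum_congr rfl fun j _ => by rw [show n + 1 + j = n + (j + 1) by ring]

theorem tendsto_sum_invSum {t : ℕ → ℝ} {l : ℝ} (c : ℕ → ℝ) (r : ℕ)
    (h : Tendsto t atTop (𝓝 l)) :
    Tendsto (fun n => ∑ j ∈ Finset.range (r + 1), c j * t (n + j)) atTop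
      (𝓝 (∑ j ∈ Finset.range (r + 1), c j * l)) :=
  tendsto_finsetSum _ fun j _ => ((tendsto_add_atTop_iff_nat j).2 h).const_mul _

/-- Division by `αⁿ` turns the recurrence into a weighted average, so `s n * α⁻¹ ^ n` has a limit
`l`. The rescaled functional is constant along windows, so its initial value is `l` times a positive
constant and `l > 0`. -/
theorem eventually_pos_of_sum_invSum_pos (hα : IsBonacciRoot r α) (s : ℕ → ℝ)
    (hs : ∀ n, s (n + (r + 1)) = ∑ i ∈ Finset.range (r + 1), s (n + i))
    (h0 : 0 < ∑ j ∈ Finset.range (r + 1), invSum α (j + 1) * s j) :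
    ∀ᶠ n in atTop, 0 < s n := by
  have hα0 := hα.1
  obtain ⟨l, hl⟩ := exists_tendsto_of_averaging (r := r) (w := fun i => α⁻¹ ^ (r - i + 1))
    (t := fun n => s n * α⁻¹ ^ n) (fun i _ => by positivity)
    (by
      rw [← hα.2, invSum, ← Finset.sum_range_reflect]
      refine Finset.sum_congr rfl fun i hi => ?_
      congr 1
      have := Finset.mem_range.1 hi
      omega)
    (fun n => by
      rw [hs, Finset.sum_mul]
      refine Finset.sum_congr rfl fun i hi => ?_
      have := Finset.mem_range.1 hi
      rw [show n + (r + 1) = (r - i + 1) + (n + i) by omega, pow_add]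
      ring)
  have hlim := tendsto_sum_invSum (fun j => invSum α (j + 1) * α ^ j) r hl
  have hconst : (fun n => ∑ j ∈ Finset.range (r + 1),
      invSum α (j + 1) * α ^ j * (s (n + j) * α⁻¹ ^ (n + j))) =
      fun _ => ∑ j ∈ Finset.range (r + 1), invSum α (j + 1) * s j := by
    funext n
    have h1 := sum_invSum_shift_iterate hα s hs n
    have h2 : (α⁻¹ ^ n) * α ^ n = 1 := by rw [← mul_pow, inv_mul_cancel₀ hα0.ne', one_pow]
    rw [← one_mul (∑ j ∈ Finset.range (r + 1), invSum α (j + 1) * s j), ← h2, mul_assoc, ← h1,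
      Finset.mul_sum]
    refine Finset.sum_congr rfl fun j _ => ?_
    have h3 : (α⁻¹ ^ j) * α ^ j = 1 := by rw [← mul_pow, inv_mul_cancel₀ hα0.ne', one_pow]
    rw [pow_add]
    linear_combination (invSum α (j + 1) * s (n + j) * α⁻¹ ^ n) * h3
  rw [hconst, ← Finset.sum_mul] at hlim
  have heq := tendsto_nhds_unique hlim tendsto_const_nhds
  have hpos : 0 < l := by
    rw [← heq] at h0
    refine pos_of_mul_pos_right h0 (Finset.sum_nonneg fun j _ => ?_)
    have := invSum_pos hα0 j
    positivity
  filter_upwards [hl.eventually_const_lt hpos] with n hn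
  exact pos_of_mul_pos_left hn (by positivity)

/-- The functional vanishes on every window. Comparing the windows at `n` and `n + 1` gives `s
(n+r+1) = ∑ α⁻ⁱ⁻¹ s (n+i)`, an averaging recurrence for `s` itself, so `s` converges; its limit is
killed by a positive combination, hence is `0`. An integral sequence tending to `0` is eventually
`0`, and the original recurrence can be run backwards. -/
theorem int_seq_eq_zero_of_sum_invSum_eq_zero (hα : IsBonacciRoot r α) (s : ℕ → ℤ)
    (hs : ∀ n, s (n + (r + 1)) = ∑ i ∈ Finset.range (r + 1), s (n + i))
    (h0 : ∑ j ∈ Finset.range (r + 1), invSum α (j + 1) * s j = 0) : ∀ n, s n = 0 := by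
  have hα0 := hα.1
  have hs' : ∀ n, (s (n + (r + 1)) : ℝ) = ∑ i ∈ Finset.range (r + 1), (s (n + i) : ℝ) := fun n => by
    rw [hs]
    push_cast
    rfl
  have hL : ∀ n, ∑ j ∈ Finset.range (r + 1), invSum α (j + 1) * (s (n + j) : ℝ) = 0 := fun n => by
    rw [sum_invSum_shift_iterate hα (fun n => (s n : ℝ)) hs' n, h0, mul_zero]
  obtain ⟨l, hl⟩ := exists_tendsto_of_averaging (r := r) (w := fun i => α⁻¹ ^ (i + 1))
    (t := fun n => (s n : ℝ)) (fun i _ => by positivity) hα.2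
    (fun n => by
      have h1 := hL (n + 1)
      rw [Finset.sum_range_succ, hα.2, show n + 1 + r = n + (r + 1) by ring] at h1
      have h2 := hL n
      have h3 : ∑ j ∈ Finset.range (r + 1), invSum α j * (s (n + j) : ℝ) =
          ∑ j ∈ Finset.range r, invSum α (j + 1) * (s (n + 1 + j) : ℝ) := by
        rw [Finset.sum_range_succ']
        simp only [invSum, Finset.sum_range_zero, zero_mul, add_zero]
        exact Finset.sum_congr rfl fun j _ => by rw [show n + 1 + j = n + (j + 1) by ring]
      simp only [invSum_succ _ _, add_mul, Finset.sum_add_distrib] at h2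
      rw [h3] at h2
      linarith)
  have hlim := tendsto_sum_invSum (fun j => invSum α (j + 1)) r hl
  simp only [hL, ← Finset.sum_mul] at hlim
  have heq := tendsto_nhds_unique hlim tendsto_const_nhds
  have hl0 : l = 0 := by
    rcases mul_eq_zero.1 heq with h | h
    · exact absurd h (Finset.sum_pos (fun j _ => invSum_pos hα0 j) ⟨0, by simp⟩).ne'
    · exact h
  subst hl0
  have hev : ∀ᶠ n in atTop, s n = 0 := by
    filter_upwards [(tendsto_order.1 hl).1 (-1) (by norm_num),
      (tendsto_order.1 hl).2 1 (by norm_num)] with n h1 h2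
    have h1' : -1 < s n := by exact_mod_cast h1
    have h2' : s n < 1 := by exact_mod_cast h2
    omega
  obtain ⟨N, hN⟩ := eventually_atTop.1 hev
  have back : ∀ d n, N ≤ n + d → s n = 0 := by
    intro d
    induction d with
    | zero => exact fun n hn => hN n hn
    | succ d ih =>
      intro n hn
      have h := hs n
      rw [Finset.sum_range_succ', ih (n + (r + 1)) (by omega), Finset.sum_eq_zero] at h
      · simpa using h.symm
      · exact fun i _ => ih _ (by omega)
  exact fun n => back N n (by omega)

theorem exists_int_seq (r : ℕ) (a : ℕ → ℤ) : ∃ s : ℕ → ℤ, (∀ j, j ≤ r → s j = a j) ∧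
    ∀ n, s (n + (r + 1)) = ∑ i ∈ Finset.range (r + 1), s (n + i) := by
  let E : LinearRecurrence ℤ := ⟨r + 1, fun _ => 1⟩
  refine ⟨E.mkSol fun i => a i, fun j hj => ?_, fun n => ?_⟩
  · exact E.mkSol_eq_init (fun i => a i) ⟨j, Nat.lt_succ_of_le hj⟩
  · have := E.is_sol_mkSol (fun i => a i) n
    rw [Finset.sum_range]
    simpa [E] using this

/-- Represents an integral combination of `α⁻¹, …, α⁻ʳ⁻¹` as the value of the functional at a
solution whose initial values are the differences of the coefficients. -/
theorem sum_mul_pow_eq_sum_invSum (r : ℕ) (α : ℝ) (a : ℕ → ℤ) (s : ℕ → ℤ) (ha : a (r + 1) = 0)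
    (hs : ∀ j, j ≤ r → s j = a j - a (j + 1)) :
    ∑ j ∈ Finset.range (r + 1), invSum α (j + 1) * (s j : ℝ) =
      ∑ j ∈ Finset.range (r + 1), (a j : ℝ) * α⁻¹ ^ (j + 1) := by
  have h := sum_invSum_mul_sub α (fun j => (a j : ℝ)) (r + 1)
  simp only [ha, Int.cast_zero, mul_zero, sub_zero] at h
  rw [← h]
  refine Finset.sum_congr rfl fun j hj => ?_
  rw [hs j (Nat.lt_succ_iff.1 (Finset.mem_range.1 hj))]
  push_cast
  rfl

/-- The powers `α⁻¹, …, α⁻ʳ⁻¹` are linearly independent over `ℤ`. -/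
theorem eq_zero_of_sum_mul_pow_eq_zero (hα : IsBonacciRoot r α) (a : ℕ → ℤ)
    (h : ∑ j ∈ Finset.range (r + 1), (a j : ℝ) * α⁻¹ ^ (j + 1) = 0) : ∀ j, j ≤ r → a j = 0 := by
  -- The truncation makes the boundary term `a' (r + 1)` of the summation by parts vanish.
  let a' : ℕ → ℤ := fun j => if j ≤ r then a j else 0
  have ha' : a' (r + 1) = 0 := by simp [a']
  obtain ⟨s, hs, hrec⟩ := exists_int_seq r fun j => a' j - a' (j + 1)
  have h1 := sum_mul_pow_eq_sum_invSum r α a' s ha' hs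
  have h2 : ∑ j ∈ Finset.range (r + 1), (a' j : ℝ) * α⁻¹ ^ (j + 1) = 0 := by
    rw [← h]
    refine Finset.sum_congr rfl fun j hj => ?_
    simp [a', Nat.lt_succ_iff.1 (Finset.mem_range.1 hj)]
  have h3 := int_seq_eq_zero_of_sum_invSum_eq_zero hα s hrec (h1.trans h2)
  have h4 : ∀ d j, j + d = r + 1 → a' j = 0 := by
    intro d
    induction d with
    | zero =>
      rintro j rfl
      exact ha'
    | succ d ih =>
      intro j hj
      have h5 := hs j (by omega)
      rw [h3, ih (j + 1) (by omega)] at h5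
      omega
  intro j hj
  have := h4 (r + 1 - j) j (by omega)
  simpa [a', hj] using this

/-! ### The group `ℤ[α]` and its positive elements. -/

/-- The additive group generated by the integral powers of `α`. -/
def powGroup (α : ℝ) : AddSubgroup ℝ := AddSubgroup.closure (Set.range fun n : ℤ => α ^ n)

/-- By the equation of `α`, the `ℤ`-span of `α⁻¹, …, α⁻ʳ⁻¹` contains `1` and is stable under
multiplication by `α` and by `α⁻¹`, so it contains every integral power. -/
theorem exists_sum_of_mem_powGroup (hα : IsBonacciRoot r α) {β : ℝ} (hβ : β ∈ powGroup α) :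
    ∃ a : ℕ → ℤ, ∑ j ∈ Finset.range (r + 1), (a j : ℝ) * α⁻¹ ^ (j + 1) = β := by
  have hα0 := hα.1
  let S : Submodule ℤ ℝ := Submodule.span ℤ ((fun j : ℕ => α⁻¹ ^ (j + 1)) '' Finset.range (r + 1))
  have hmem : ∀ j, j < r + 1 → α⁻¹ ^ (j + 1) ∈ S := fun j hj =>
    Submodule.subset_span ⟨j, by simpa using hj, rfl⟩
  have hone : (1 : ℝ) ∈ S := by
    rw [← hα.2]
    exact Submodule.sum_mem _ fun j hj => hmem j (Finset.mem_range.1 hj)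
  have hup : ∀ z ∈ S, α * z ∈ S := by
    intro z hz
    induction hz using Submodule.span_induction with
    | mem z hz =>
      obtain ⟨j, hj, rfl⟩ := hz
      have hj : j < r + 1 := by simpa using hj
      dsimp only
      rw [pow_succ', ← mul_assoc, mul_inv_cancel₀ hα0.ne', one_mul]
      cases j with
      | zero => simpa using hone
      | succ j => exact hmem j (by omega)
    | zero => simp
    | add x y _ _ hx hy => rw [mul_add]; exact S.add_mem hx hy
    | smul c x _ hx => rw [mul_smul_comm]; exact S.smul_mem c hx
  have hdown : ∀ z ∈ S, α⁻¹ * z ∈ S := by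
    intro z hz
    induction hz using Submodule.span_induction with
    | mem z hz =>
      obtain ⟨j, hj, rfl⟩ := hz
      have hj : j < r + 1 := by simpa using hj
      dsimp only
      rw [← pow_succ']
      by_cases h : j + 1 < r + 1
      · exact hmem _ h
      · obtain rfl : j = r := by omega
        have h1 := hα.2
        rw [invSum, Finset.sum_range_succ] at h1
        have h2 : α⁻¹ ^ (j + 1 + 1) =
            α⁻¹ ^ (0 + 1) - ∑ i ∈ Finset.range j, α⁻¹ ^ (i + 1 + 1) := by
          simp only [pow_succ' α⁻¹ (_ + 1), ← Finset.mul_sum]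
          linear_combination α⁻¹ * h1
        rw [h2]
        exact S.sub_mem (hmem 0 (by omega)) (Submodule.sum_mem _ fun i hi =>
          hmem (i + 1) (by have := Finset.mem_range.1 hi; omega))
    | zero => simp
    | add x y _ _ hx hy => rw [mul_add]; exact S.add_mem hx hy
    | smul c x _ hx => rw [mul_smul_comm]; exact S.smul_mem c hx
  have hall : ∀ n : ℤ, α ^ n ∈ S := by
    intro n
    induction n using Int.induction_on with
    | zero => simpa using hone
    | succ n ih => rw [zpow_add_one₀ hα0.ne', mul_comm]; exact hup _ ih
    | pred n ih => rw [zpow_sub_one₀ hα0.ne', mul_comm]; exact hdown _ ih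
  have hβS : β ∈ S := by
    have : powGroup α ≤ S.toAddSubgroup := (AddSubgroup.closure_le _).2 (by
      rintro _ ⟨n, rfl⟩
      exact hall n)
    exact this hβ
  obtain ⟨c, hc⟩ := (Submodule.mem_span_image_finset_iff_exists_fun ℤ).1 hβS
  refine ⟨fun j => if h : j ∈ Finset.range (r + 1) then c ⟨j, h⟩ else 0, ?_⟩
  rw [← hc, ← Finset.sum_coe_sort (Finset.range (r + 1))]
  refine Finset.sum_congr rfl fun j _ => ?_
  simp only [dif_pos j.2, zsmul_eq_mul]

/-- The positive elements of the group generated by the powers of `α` are sums of powers of `α`. -/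
theorem mem_closure_of_mem_powGroup (hα : IsBonacciRoot r α) {β : ℝ} (hβ : β ∈ powGroup α)
    (hpos : 0 ≤ β) : β ∈ AddSubmonoid.closure (Set.range fun n : ℤ => α ^ n) := by
  rcases hpos.eq_or_lt with rfl | hpos
  · exact zero_mem _
  have hα0 := hα.1
  obtain ⟨a, ha⟩ := exists_sum_of_mem_powGroup hα hβ
  let a' : ℕ → ℤ := fun j => if j ≤ r then a j else 0
  have ha' : a' (r + 1) = 0 := by simp [a']
  obtain ⟨s, hs, hrec⟩ := exists_int_seq r fun j => a' j - a' (j + 1)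
  have h1 := sum_mul_pow_eq_sum_invSum r α a' s ha' hs
  have h2 : ∑ j ∈ Finset.range (r + 1), (a' j : ℝ) * α⁻¹ ^ (j + 1) = β := by
    rw [← ha]
    refine Finset.sum_congr rfl fun j hj => ?_
    simp [a', Nat.lt_succ_iff.1 (Finset.mem_range.1 hj)]
  rw [h2] at h1
  have hrec' : ∀ n, (s (n + (r + 1)) : ℝ) = ∑ i ∈ Finset.range (r + 1), (s (n + i) : ℝ) :=
    fun n => by
      rw [hrec]
      push_cast
      rfl
  obtain ⟨N, hN⟩ := eventually_atTop.1 (eventually_pos_of_sum_invSum_pos hα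
    (fun n => (s n : ℝ)) hrec' (by rw [h1]; exact hpos))
  have h3 := sum_invSum_shift_iterate hα (fun n => (s n : ℝ)) hrec' N
  rw [h1] at h3
  -- `β` is `α⁻ᴺ` times the functional on the window at `N`, where all values of `s` are positive
  -- integers; expanding the weights leaves only powers of `α` with coefficients in `ℕ`.
  have h4 : β = ∑ j ∈ Finset.range (r + 1), ∑ i ∈ Finset.range (j + 1),
      (s (N + j)).toNat • α ^ (-(N : ℤ) - (i + 1)) := by
    have h5 : α⁻¹ ^ N * α ^ N = 1 := by rw [← mul_pow, inv_mul_cancel₀ hα0.ne', one_pow]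
    rw [← one_mul β, ← h5, mul_assoc, ← h3, Finset.mul_sum]
    refine Finset.sum_congr rfl fun j _ => ?_
    have h6 : (0 : ℝ) < s (N + j) := hN (N + j) (by omega)
    have h7 : ((s (N + j)).toNat : ℝ) = s (N + j) := by
      have : (0 : ℤ) < s (N + j) := by exact_mod_cast h6
      exact_mod_cast Int.toNat_of_nonneg this.le
    rw [invSum, Finset.sum_mul, Finset.mul_sum]
    refine Finset.sum_congr rfl fun i _ => ?_
    rw [nsmul_eq_mul, h7, zpow_sub₀ hα0.ne', zpow_neg, zpow_natCast,
      show ((i : ℤ) + 1) = ((i + 1 : ℕ) : ℤ) by push_cast; rfl, zpow_natCast, inv_pow, inv_pow]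
    field_simp
  rw [h4]
  exact sum_mem fun j _ => sum_mem fun i _ => nsmul_mem
    (AddSubmonoid.subset_closure (Set.mem_range_self (f := fun n : ℤ => α ^ n) _)) _

theorem powGroup_inv (α : ℝ) : powGroup α⁻¹ = powGroup α := by
  rw [powGroup, powGroup]
  congr 1
  ext z
  constructor
  · rintro ⟨n, rfl⟩
    exact ⟨-n, by simp⟩
  · rintro ⟨n, rfl⟩
    exact ⟨-n, by simp⟩

theorem mul_mem_powGroup {α : ℝ} (hα : α ≠ 0) {x y : ℝ} (hx : x ∈ powGroup α)
    (hy : y ∈ powGroup α) : x * y ∈ powGroup α := by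
  have hx' := hx
  have hy' := hy
  rw [powGroup] at hx' hy'
  clear hx hy
  induction hx', hy' using AddSubgroup.closure_induction₂ with
  | mem x y hx hy =>
    obtain ⟨m, rfl⟩ := hx
    obtain ⟨n, rfl⟩ := hy
    exact AddSubgroup.subset_closure ⟨m + n, zpow_add₀ hα m n⟩
  | zero_left x _ => simp
  | zero_right x _ => simp
  | add_left x y z _ _ _ h1 h2 => rw [add_mul]; exact (powGroup α).add_mem h1 h2
  | add_right x y z _ _ _ h1 h2 => rw [mul_add]; exact (powGroup α).add_mem h1 h2
  | neg_left x y _ _ h => rw [neg_mul]; exact (powGroup α).neg_mem h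
  | neg_right x y _ _ h => rw [mul_neg]; exact (powGroup α).neg_mem h

theorem adjoin_subset_powGroup (α : ℝ) (hα : α ≠ 0) :
    (Algebra.adjoin ℤ {α} : Set ℝ) ⊆ powGroup α := by
  intro z hz
  induction hz using Algebra.adjoin_induction with
  | mem x hx =>
    rw [Set.mem_singleton_iff] at hx
    exact AddSubgroup.subset_closure ⟨1, by simp [hx]⟩
  | algebraMap n =>
    have : (1 : ℝ) ∈ powGroup α := AddSubgroup.subset_closure ⟨0, by simp⟩
    simpa using (powGroup α).zsmul_mem this n
  | add x y _ _ hx hy => exact (powGroup α).add_mem hx hy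
  | mul x y _ _ hx hy => exact mul_mem_powGroup hα hx hy

theorem adjoin_eq_powGroup_of_inv_mem (α : ℝ) (hα : α ≠ 0) (h : α⁻¹ ∈ Algebra.adjoin ℤ {α}) :
    (Algebra.adjoin ℤ {α} : Set ℝ) = powGroup α := by
  refine (adjoin_subset_powGroup α hα).antisymm fun z hz => ?_
  have hle : powGroup α ≤ (Algebra.adjoin ℤ {α}).toSubring.toAddSubgroup := by
    refine (AddSubgroup.closure_le _).2 ?_
    rintro _ ⟨n, rfl⟩
    rcases n with n | n
    · exact pow_mem (Algebra.subset_adjoin (Set.mem_singleton α)) n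
    · have : α ^ (Int.negSucc n) = α⁻¹ ^ (n + 1) := by rw [zpow_negSucc, inv_pow]
      dsimp only
      rw [this]
      exact pow_mem h (n + 1)
  exact hle hz

/-- The constant coefficient `-1` makes `α` a unit of `ℤ[α]`: `α⁻¹ = αʳ - αʳ⁻¹ - ⋯ - 1`. -/
theorem adjoin_eq_powGroup (hα : IsBonacciRoot r α) :
    (Algebra.adjoin ℤ {α} : Set ℝ) = powGroup α := by
  have hα0 := hα.1
  refine adjoin_eq_powGroup_of_inv_mem α hα0.ne' ?_
  have h := (isBonacciRoot_iff hα0).1 hα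
  rw [Finset.sum_range_succ'] at h
  have h2 : α⁻¹ = α ^ r - ∑ i ∈ Finset.range r, α ^ i := by
    refine inv_eq_of_mul_eq_one_right ?_
    rw [mul_sub, Finset.mul_sum]
    simp only [← pow_succ']
    linarith
  rw [h2]
  have hmem : α ∈ Algebra.adjoin ℤ {α} := Algebra.subset_adjoin (Set.mem_singleton α)
  exact sub_mem (pow_mem hmem r) (sum_mem fun i _ => pow_mem hmem i)

/-- Here the equation is read as `α = 1 + α⁻¹ + ⋯ + α⁻ʳ`. -/
theorem adjoin_inv_eq_powGroup (hα : IsBonacciRoot r α) :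
    (Algebra.adjoin ℤ {α⁻¹} : Set ℝ) = powGroup α := by
  have hα0 := hα.1
  rw [← powGroup_inv]
  refine adjoin_eq_powGroup_of_inv_mem α⁻¹ (inv_ne_zero hα0.ne') ?_
  rw [inv_inv]
  have h := mul_invSum_succ hα0 r
  rw [hα.2, mul_one] at h
  have hmem : α⁻¹ ∈ Algebra.adjoin ℤ {α⁻¹} := Algebra.subset_adjoin (Set.mem_singleton _)
  have h2 : 1 + invSum α r ∈ Algebra.adjoin ℤ {α⁻¹} :=
    add_mem (one_mem _) (sum_mem fun i _ => pow_mem hmem _)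
  rwa [← h] at h2

end Numerics

/-! ## The structure of the algebra `k⟨x, y⟩ / (y ^ (r + 1))` -/

namespace PenroseAlg

section Words

variable (k : Type u) [Field k] (r : ℕ)

theorem grading_finite (n : ℤ) : Module.Finite k (grading k r n) := by
  refine Module.Finite.iff_fg.2 (Submodule.fg_span ?_)
  refine ((List.finite_length_eq (Fin 2) n.toNat).image
    fun w : List (Fin 2) => (w.map (gen k r)).prod).subset ?_
  rintro _ ⟨w, hw, rfl⟩
  exact ⟨w, by simp only [Set.mem_ofPred_eq]; omega, rfl⟩

theorem grading_eq_bot {n : ℤ} (hn : n < 0) : grading k r n = ⊥ := by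
  rw [grading, Submodule.span_eq_bot]
  rintro _ ⟨w, hw, rfl⟩
  omega

theorem span_words : Submodule.span k {b : PenroseAlg k r |
    ∃ w : List (Fin 2), b = (w.map (gen k r)).prod} = ⊤ := by
  rw [eq_top_iff, ← (DirectSum.Decomposition.isInternal (grading k r)).submodule_iSup_eq_top]
  refine iSup_le fun n => Submodule.span_mono ?_
  rintro _ ⟨w, -, rfl⟩
  exact ⟨w, rfl⟩

theorem gen_one_pow_eq_zero {n : ℕ} (hn : r + 1 ≤ n) : gen k r 1 ^ n = 0 :=
  pow_eq_zero_of_le hn (gen_one_pow k r)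

end Words

/-! ### Formal properties of `theta`. -/

section Theta

variable {k : Type u} [Field k] {r : ℕ} {M N : Type*} [AddCommGroup M] [Module (PenroseAlg k r) M]
  [AddCommGroup N] [Module (PenroseAlg k r) N]

variable (k r) in
/-- The map `(m₀, …, mᵣ) ↦ ∑ yⁱ x mᵢ`. -/
noncomputable def theta (m : ℕ → M) : M :=
  ∑ i ∈ Finset.range (r + 1), gen k r 1 ^ i • gen k r 0 • m i

theorem map_theta (f : M →ₗ[PenroseAlg k r] N) (m : ℕ → M) :
    f (theta k r m) = theta k r fun i => f (m i) := by
  simp [theta, map_sum, map_smul]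

theorem theta_add (m m' : ℕ → M) :
    theta k r (fun i => m i + m' i) = theta k r m + theta k r m' := by
  simp [theta, smul_add, Finset.sum_add_distrib]

theorem theta_smul [Module k M] [IsScalarTower k (PenroseAlg k r) M] (c : k) (m : ℕ → M) :
    theta k r (fun i => c • m i) = c • theta k r m := by
  simp only [theta, Finset.smul_sum, smul_comm _ c]

theorem theta_congr {m m' : ℕ → M} (h : ∀ i, i ≤ r → m i = m' i) :
    theta k r m = theta k r m' :=
  Finset.sum_congr rfl fun i hi => by rw [h i (Nat.lt_succ_iff.1 (Finset.mem_range.1 hi))]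

theorem theta_eq_zero {m : ℕ → M} (h : ∀ i, i ≤ r → m i = 0) : theta k r m = 0 :=
  Finset.sum_eq_zero fun i hi => by
    rw [h i (Nat.lt_succ_iff.1 (Finset.mem_range.1 hi)), smul_zero, smul_zero]

theorem theta_single (m : M) {j : ℕ} (hj : j ≤ r) :
    theta k r (fun i => if i = j then m else 0) = gen k r 1 ^ j • gen k r 0 • m := by
  rw [theta, Finset.sum_eq_single j]
  · simp
  · intro i _ hij
    simp [hij]
  · intro h
    exact absurd (Finset.mem_range.2 (by omega)) h

/-- Left multiplication by `yᵗ` shifts the index; the terms pushed beyond `r` vanish since `y ^ (r +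
1) = 0`. -/
theorem smul_theta (t : ℕ) (m : ℕ → M) : gen k r 1 ^ t • theta k r m =
    theta k r fun i => if i < t then 0 else m (i - t) := by
  have h : theta k r (fun i => if i < t then 0 else m (i - t)) =
      ∑ i ∈ Finset.range (t + (r + 1)), gen k r 1 ^ i • gen k r 0 •
        (if i < t then 0 else m (i - t)) := by
    refine Finset.sum_subset (Finset.range_subset_range.2 (by omega)) fun i _ hi => ?_
    rw [gen_one_pow_eq_zero k r (by simpa using hi), zero_smul]
  rw [h, Finset.sum_range_add, Finset.sum_eq_zero, zero_add, theta, Finset.smul_sum]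
  · refine Finset.sum_congr rfl fun i _ => ?_
    rw [smul_smul, ← pow_add, if_neg (by omega), Nat.add_sub_cancel_left]
  · intro i hi
    rw [if_pos (Finset.mem_range.1 hi), smul_zero, smul_zero]

end Theta

/-! ### Existence of the decomposition of `B` by the first `x`. -/

section Decomposition

variable {k : Type u} [Field k] {r : ℕ}

/-- A leading `x` puts the rest of the word at index `0`; a leading `y` shifts the indices of the
expression already found by one. -/
theorem exists_word_eq_theta (w : List (Fin 2)) : ∃ (c : k) (b : ℕ → PenroseAlg k r),
    (∀ i : ℕ, b i ∈ grading k r (w.length - 1 - i)) ∧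
      (w.map (gen k r)).prod = theta k r b + c • gen k r 1 ^ w.length := by
  induction w with
  | nil => exact ⟨1, 0, fun i => zero_mem _, by simp [theta_eq_zero]⟩
  | cons a w ih =>
    fin_cases a
    · refine ⟨0, fun i => if i = 0 then (w.map (gen k r)).prod else 0, fun i => ?_, ?_⟩
      · dsimp only
        split_ifs with h
        · subst h
          exact Submodule.subset_span ⟨w, by simp, rfl⟩
        · exact zero_mem _
      · rw [theta_single _ (Nat.zero_le r)]
        simp
    · obtain ⟨c, b, hb, h⟩ := ih
      refine ⟨c, fun i => if i < 1 then 0 else b (i - 1), fun i => ?_, ?_⟩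
      · dsimp only
        split_ifs with h
        · exact zero_mem _
        · have := hb (i - 1)
          rw [Nat.cast_sub (by omega)] at this
          convert this using 2
          simp only [List.length_cons]
          push_cast
          ring
      · rw [← smul_theta, pow_one, List.map_cons, List.prod_cons, h, List.length_cons, pow_succ',
          mul_add, mul_smul_comm]
        rfl

theorem exists_eq_theta_add {p : ℤ} {b : PenroseAlg k r} (hb : b ∈ grading k r p) :
    ∃ (c : k) (b' : ℕ → PenroseAlg k r), (∀ i : ℕ, b' i ∈ grading k r (p - 1 - i)) ∧
      b = theta k r b' + c • gen k r 1 ^ p.toNat := by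
  induction hb using Submodule.span_induction with
  | mem b hb =>
    obtain ⟨w, rfl, rfl⟩ := hb
    simpa using exists_word_eq_theta w
  | zero => exact ⟨0, 0, fun i => zero_mem _, by simp [theta_eq_zero]⟩
  | add b₁ b₂ _ _ h₁ h₂ =>
    obtain ⟨c₁, a₁, ha₁, h₁⟩ := h₁
    obtain ⟨c₂, a₂, ha₂, h₂⟩ := h₂
    refine ⟨c₁ + c₂, fun i => a₁ i + a₂ i, fun i => add_mem (ha₁ i) (ha₂ i), ?_⟩
    conv_lhs => rw [h₁, h₂]
    rw [theta_add, add_smul]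
    abel
  | smul d b _ h =>
    obtain ⟨c, a, ha, h⟩ := h
    refine ⟨d * c, fun i => d • a i, fun i => Submodule.smul_mem _ _ (ha i), ?_⟩
    conv_lhs => rw [h]
    rw [theta_smul, smul_add, mul_smul]

theorem exists_eq_theta_add_mem_span (b : PenroseAlg k r) :
    ∃ (b' : ℕ → PenroseAlg k r) (z : PenroseAlg k r),
      z ∈ Submodule.span k (Set.range fun i : Fin (r + 1) => gen k r 1 ^ (i : ℕ)) ∧
      b = theta k r b' + z := by
  have hb : b ∈ Submodule.span k {b : PenroseAlg k r |
    ∃ w : List (Fin 2), b = (w.map (gen k r)).prod} := by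
    rw [span_words]
    trivial
  induction hb using Submodule.span_induction with
  | mem b hb =>
    obtain ⟨w, rfl⟩ := hb
    obtain ⟨c, b', -, h⟩ := exists_word_eq_theta (k := k) (r := r) w
    refine ⟨b', _, ?_, h⟩
    by_cases hw : r + 1 ≤ w.length
    · rw [gen_one_pow_eq_zero k r hw, smul_zero]
      exact zero_mem _
    · exact Submodule.smul_mem _ _ (Submodule.subset_span ⟨⟨w.length, by omega⟩, rfl⟩)
  | zero => exact ⟨0, 0, zero_mem _, by simp [theta_eq_zero]⟩
  | add b₁ b₂ _ _ h₁ h₂ =>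
    obtain ⟨a₁, c₁, ha₁, h₁⟩ := h₁
    obtain ⟨a₂, c₂, ha₂, h₂⟩ := h₂
    refine ⟨fun i => a₁ i + a₂ i, c₁ + c₂, add_mem ha₁ ha₂, ?_⟩
    conv_lhs => rw [h₁, h₂]
    rw [theta_add]
    abel
  | smul d b _ h =>
    obtain ⟨a, c, ha, h⟩ := h
    refine ⟨fun i => d • a i, d • c, Submodule.smul_mem _ _ ha, ?_⟩
    conv_lhs => rw [h]
    rw [theta_smul, smul_add]

end Decomposition

/-! ### Uniqueness of the decomposition, from a representation on coefficients. -/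

section Representation

variable (k : Type u) [Field k] (r : ℕ)

/-- The space of coefficients `(cᵢ, bᵢ)` of the expressions `∑ yⁱ (cᵢ + x bᵢ)`. -/
abbrev Coeffs : Type u := Fin (r + 1) → k × PenroseAlg k r

/-- The value `∑ yⁱ (cᵢ + x bᵢ)`. -/
noncomputable def Coeffs.eval : Coeffs k r →ₗ[k] PenroseAlg k r where
  toFun v := ∑ i : Fin (r + 1), gen k r 1 ^ (i : ℕ) *
    ((v i).1 • (1 : PenroseAlg k r) + gen k r 0 * (v i).2)
  map_add' v w := by
    rw [← Finset.sum_add_distrib]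
    refine Finset.sum_congr rfl fun i _ => ?_
    simp only [Pi.add_apply, Prod.fst_add, Prod.snd_add, add_smul, mul_add]
    abel
  map_smul' c v := by
    rw [RingHom.id_apply, Finset.smul_sum]
    refine Finset.sum_congr rfl fun i _ => ?_
    rw [Pi.smul_apply, Prod.smul_fst, Prod.smul_snd, smul_eq_mul, mul_smul, mul_smul_comm,
      ← smul_add, mul_smul_comm]

/-- The operator of left multiplication by `x` in terms of coefficients. -/
noncomputable def Coeffs.opX : Coeffs k r →ₗ[k] Coeffs k r :=
  LinearMap.single k (fun _ => k × PenroseAlg k r) 0 ∘ₗ LinearMap.inr k k (PenroseAlg k r) ∘ₗ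
    Coeffs.eval k r

/-- The operator of left multiplication by `y` in terms of coefficients. -/
noncomputable def Coeffs.opY : Coeffs k r →ₗ[k] Coeffs k r where
  toFun v i := if h : (i : ℕ) = 0 then 0 else v ⟨i - 1, by omega⟩
  map_add' v w := by
    funext i
    by_cases h : (i : ℕ) = 0
    · simp only [Pi.add_apply, dif_pos h, add_zero]
    · simp only [Pi.add_apply, dif_neg h]
  map_smul' c v := by
    funext i
    by_cases h : (i : ℕ) = 0
    · simp only [Pi.smul_apply, dif_pos h, smul_zero]
    · simp only [Pi.smul_apply, dif_neg h, RingHom.id_apply]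

theorem Coeffs.opY_pow_apply (n : ℕ) (v : Coeffs k r) (i : Fin (r + 1)) :
    (Coeffs.opY k r ^ n) v i = if n ≤ i then v ⟨i - n, by omega⟩ else 0 := by
  induction n generalizing i with
  | zero => simp
  | succ n ih =>
    rw [pow_succ', Module.End.mul_apply]
    change (if h : (i : ℕ) = 0 then 0 else (Coeffs.opY k r ^ n) v ⟨i - 1, _⟩) = _
    by_cases h : (i : ℕ) = 0
    · simp [h]
    · rw [dif_neg h, ih]
      by_cases h2 : n + 1 ≤ i
      · rw [if_pos h2, if_pos (by simp only; omega)]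
        congr 2
        simp only
        omega
      · rw [if_neg h2, if_neg (by simp only; omega)]

theorem Coeffs.opY_pow : Coeffs.opY k r ^ (r + 1) = 0 := by
  refine LinearMap.ext fun v => funext fun i => ?_
  rw [Coeffs.opY_pow_apply, if_neg (by omega)]
  rfl

theorem Coeffs.eval_opX (v : Coeffs k r) :
    Coeffs.eval k r (Coeffs.opX k r v) = gen k r 0 * Coeffs.eval k r v := by
  change ∑ i : Fin (r + 1), _ = _
  rw [Fin.sum_univ_succ, Finset.sum_eq_zero]
  · simp [Coeffs.opX]
  · intro i _
    simp [Coeffs.opX]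

theorem Coeffs.eval_opY (v : Coeffs k r) :
    Coeffs.eval k r (Coeffs.opY k r v) = gen k r 1 * Coeffs.eval k r v := by
  change ∑ i : Fin (r + 1), _ = _ * ∑ i : Fin (r + 1), _
  rw [Fin.sum_univ_succ, Fin.sum_univ_castSucc, mul_add (gen k r 1), Finset.mul_sum]
  simp only [← mul_assoc, ← pow_succ', Fin.val_last, gen_one_pow, zero_mul, add_zero]
  simp [Coeffs.opY]
  rfl

/-- The action of the algebra on coefficients. -/
noncomputable def Coeffs.rep : PenroseAlg k r →ₐ[k] Module.End k (Coeffs k r) :=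
  RingQuot.liftAlgHom k
    ⟨FreeAlgebra.lift k fun i => if i = 0 then Coeffs.opX k r else Coeffs.opY k r, by
      rintro _ _ ⟨⟩
      rw [map_pow, FreeAlgebra.lift_ι_apply, map_zero]
      exact Coeffs.opY_pow k r⟩

theorem Coeffs.rep_gen (i : Fin 2) : Coeffs.rep k r (gen k r i) =
    if i = 0 then Coeffs.opX k r else Coeffs.opY k r := by
  rw [rep, gen, RingQuot.liftAlgHom_mkAlgHom_apply, FreeAlgebra.lift_ι_apply]

theorem Coeffs.eval_rep (b : PenroseAlg k r) (v : Coeffs k r) :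
    Coeffs.eval k r (Coeffs.rep k r b v) = b * Coeffs.eval k r v := by
  have hb : b ∈ Submodule.span k {b : PenroseAlg k r |
    ∃ w : List (Fin 2), b = (w.map (gen k r)).prod} := by
    rw [span_words]
    trivial
  induction hb using Submodule.span_induction with
  | mem b hb =>
    obtain ⟨w, rfl⟩ := hb
    induction w with
    | nil => simp
    | cons i w ih =>
      rw [List.map_cons, List.prod_cons, map_mul, Module.End.mul_apply, mul_assoc, ← ih,
        Coeffs.rep_gen]
      fin_cases i
      · exact Coeffs.eval_opX k r _
      · exact Coeffs.eval_opY k r _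
  | zero => simp
  | add a b _ _ ha hb => rw [map_add, LinearMap.add_apply, map_add, ha, hb, add_mul]
  | smul c b _ h => rw [map_smul, LinearMap.smul_apply, map_smul, h, smul_mul_assoc]

/-- The coefficients of an element of the algebra. -/
noncomputable def coeffs (b : PenroseAlg k r) : Coeffs k r :=
  Coeffs.rep k r b (Pi.single 0 (1, 0))

theorem Coeffs.eval_coeffs (b : PenroseAlg k r) : Coeffs.eval k r (coeffs k r b) = b := by
  have h : Coeffs.eval k r (Pi.single 0 (1, 0)) = 1 := by
    change ∑ i : Fin (r + 1), _ = _
    rw [Fin.sum_univ_succ, Finset.sum_eq_zero]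
    · simp
    · intro i _
      simp
  rw [coeffs, Coeffs.eval_rep, h, mul_one]

/-- Acting on the coefficient vector of `1` recovers the `bᵢ` from `∑ yⁱ x bᵢ`: `yʲ` moves the index
from `0` to `j`, and `opX` evaluates the vector `coeffs (b j)` back to `b j`. -/
theorem coeffs_theta (b : ℕ → PenroseAlg k r) (i : Fin (r + 1)) :
    coeffs k r (theta k r b) i = (0, b i) := by
  have h : ∀ j, coeffs k r (gen k r 1 ^ j • gen k r 0 • b j) i =
      if i = j then (0, b j) else 0 := by
    intro j
    rw [coeffs, smul_eq_mul, smul_eq_mul, map_mul, map_mul, map_pow, Coeffs.rep_gen,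
      Coeffs.rep_gen, if_neg one_ne_zero, if_pos rfl, Module.End.mul_apply, Module.End.mul_apply,
      Coeffs.opY_pow_apply]
    change (if j ≤ ↑i then Coeffs.opX k r (coeffs k r (b j)) _ else 0) = _
    rw [Coeffs.opX, LinearMap.comp_apply, LinearMap.comp_apply, Coeffs.eval_coeffs]
    by_cases hij : (i : ℕ) = j
    · rw [if_pos hij, if_pos hij.ge]
      have : (⟨i - j, by omega⟩ : Fin (r + 1)) = 0 := Fin.ext (by simp [hij])
      rw [this]
      simp
    · rw [if_neg hij]
      by_cases h2 : j ≤ i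
      · rw [if_pos h2]
        have : (⟨i - j, by omega⟩ : Fin (r + 1)) ≠ 0 := fun h => by
          have := congrArg Fin.val h
          simp only [Fin.val_zero] at this
          omega
        simp [this]
      · rw [if_neg h2]
  have h2 : coeffs k r (theta k r b) = ∑ j ∈ Finset.range (r + 1),
      coeffs k r (gen k r 1 ^ j • gen k r 0 • b j) := by
    simp only [coeffs, theta, map_sum, LinearMap.sum_apply]
  rw [h2, Finset.sum_apply, Finset.sum_congr rfl fun j _ => h j, Finset.sum_eq_single (i : ℕ)]
  · simp
  · intro j _ hj
    rw [if_neg (Ne.symm hj)]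
  · intro h
    exact absurd (Finset.mem_range.2 i.2) h

variable {k r} in
theorem theta_injective {b : ℕ → PenroseAlg k r} (h : theta k r b = 0) : ∀ i, i ≤ r → b i = 0 := by
  intro i hi
  have := coeffs_theta k r b ⟨i, by omega⟩
  rw [h, coeffs, map_zero] at this
  exact (congrArg Prod.snd this).symm

instance : Nontrivial (PenroseAlg k r) := by
  refine ⟨⟨1, 0, fun h => ?_⟩⟩
  have h2 := congrArg (fun b => Coeffs.rep k r b (Pi.single 0 (1, 0)) 0) h
  simp at h2

/-- Injectivity of `theta` lets a left factor `x` be cancelled. This provides a nonzero element of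
`B` in each degree `n ≥ 0`, hence a positive rank of `B`. -/
theorem gen_zero_pow_ne_zero (n : ℕ) : gen k r 0 ^ n ≠ 0 := by
  induction n with
  | zero => simp
  | succ n ih =>
    intro h
    refine ih ?_
    have := theta_injective (k := k) (r := r)
      (b := fun i => if i = 0 then gen k r 0 ^ n else 0) ?_ 0 (Nat.zero_le r)
    · simpa using this
    · rw [theta_single _ (Nat.zero_le r), pow_zero, one_smul, smul_eq_mul, ← pow_succ', h]

end Representation

end PenroseAlg

/-! ## Graded modules -/

section LinearAlgebra

variable {k V V' : Type*} [Field k] [AddCommGroup V] [Module k V] [AddCommGroup V'] [Module k V']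

/-- A finite-dimensional `U` that fills up the quotient is easier to push through maps and
compositions than the quotient itself. -/
theorem finite_quotient_iff (R : Submodule k V) :
    Module.Finite k (V ⧸ R) ↔ ∃ U : Submodule k V, U.FG ∧ R ⊔ U = ⊤ := by
  constructor
  · intro h
    obtain ⟨U, hU⟩ := R.exists_isCompl
    refine ⟨U, Module.Finite.iff_fg.1 ?_, hU.sup_eq_top⟩
    exact Module.Finite.equiv (R.quotientEquivOfIsCompl U hU)
  · rintro ⟨U, hU, h⟩
    have hR : R.map R.mkQ = ⊥ := by
      rw [Submodule.eq_bot_iff]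
      rintro _ ⟨v, hv, rfl⟩
      exact (Submodule.Quotient.mk_eq_zero R).2 hv
    rw [Module.finite_def, ← R.range_mkQ, LinearMap.range_eq_map, ← h, Submodule.map_sup, hR,
      bot_sup_eq]
    exact hU.map _

theorem fg_ker_comp {V'' : Type*} [AddCommGroup V''] [Module k V''] (f : V →ₗ[k] V')
    (g : V' →ₗ[k] V'') (hf : (LinearMap.ker f).FG) (hg : (LinearMap.ker g).FG) :
    (LinearMap.ker (g ∘ₗ f)).FG := by
  refine Submodule.fg_of_fg_map_of_fg_inf_ker f ?_ ?_
  · refine Submodule.FG.of_le hg ?_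
    rintro _ ⟨v, hv, rfl⟩
    exact hv
  · exact Submodule.FG.of_le hf inf_le_right

/-- The map induced on a quotient by a linear map over a smaller ring. -/
def quotientMap {A W : Type*} [Ring A] [Algebra k A] [AddCommGroup W] [Module A W] [Module k W]
    [IsScalarTower k A W] (R : Submodule A W) (g : W →ₗ[k] W) (h : ∀ v ∈ R, g v ∈ R) :
    (W ⧸ R) →ₗ[k] (W ⧸ R) where
  toFun := QuotientAddGroup.map R.toAddSubgroup R.toAddSubgroup g.toAddMonoidHom h
  map_add' := map_add _
  map_smul' c := by
    rintro ⟨v⟩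
    exact congrArg (Submodule.Quotient.mk (p := R)) (map_smul g c v)

theorem finite_quotient_restrictScalars_iff {A W : Type*} [Ring A] [Algebra k A] [AddCommGroup W]
    [Module A W] [Module k W] [IsScalarTower k A W] (R : Submodule A W) :
    Module.Finite k (W ⧸ R) ↔ ∃ U : Submodule k W, U.FG ∧ R.restrictScalars k ⊔ U = ⊤ := by
  rw [← finite_quotient_iff]
  exact ⟨fun h => Module.Finite.equiv (Submodule.Quotient.restrictScalarsEquiv k R).symm,
    fun h => Module.Finite.equiv (Submodule.Quotient.restrictScalarsEquiv k R)⟩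

end LinearAlgebra

namespace GrMod

variable {k : Type u} [Field k] {A : Type u} [Ring A] [Algebra k A] {𝒜 : ℤ → Submodule k A}

section Projections

variable (M : GrMod k A 𝒜)

/-- The projection of a graded module to a homogeneous component. -/
noncomputable def proj (i : ℤ) : M.carrier →ₗ[k] M.carrier :=
  (M.deg i).subtype ∘ₗ DirectSum.component k ℤ (fun i => M.deg i) i ∘ₗ
    (LinearEquiv.ofBijective (DirectSum.coeLinearMap M.deg) M.isInternal).symm.toLinearMap

theorem proj_mem (i : ℤ) (m : M.carrier) : M.proj i m ∈ M.deg i := Subtype.property _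

theorem symm_of_mem {i : ℤ} {m : M.carrier} (hm : m ∈ M.deg i) :
    (LinearEquiv.ofBijective (DirectSum.coeLinearMap M.deg) M.isInternal).symm m =
      DirectSum.lof k ℤ (fun i => M.deg i) i ⟨m, hm⟩ := by
  rw [LinearEquiv.symm_apply_eq]
  exact (DirectSum.coeLinearMap_lof M.deg i ⟨m, hm⟩).symm

theorem proj_of_mem {i : ℤ} {m : M.carrier} (hm : m ∈ M.deg i) : M.proj i m = m := by
  rw [proj, LinearMap.comp_apply, LinearMap.comp_apply, LinearEquiv.coe_coe, symm_of_mem M hm,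
    DirectSum.component.lof_self]
  rfl

theorem proj_of_mem_of_ne {i j : ℤ} {m : M.carrier} (hm : m ∈ M.deg i) (hij : i ≠ j) :
    M.proj j m = 0 := by
  rw [proj, LinearMap.comp_apply, LinearMap.comp_apply, LinearEquiv.coe_coe, symm_of_mem M hm,
    DirectSum.component.of, dif_neg hij]
  rfl

variable {M} in
theorem induction_hom {p : M.carrier → Prop} (m : M.carrier) (hom : ∀ i, ∀ m ∈ M.deg i, p m)
    (zero : p 0) (add : ∀ m m', p m → p m' → p (m + m')) : p m :=
  Submodule.iSup_induction M.deg (motive := p)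
    ((DirectSum.IsInternal.submodule_iSup_eq_top M.isInternal).symm ▸ Submodule.mem_top)
    hom zero add

theorem exists_finset (m : M.carrier) :
    ∃ S : Finset ℤ, m = ∑ i ∈ S, M.proj i m ∧ ∀ i ∉ S, M.proj i m = 0 := by
  classical
  induction m using induction_hom with
  | hom i m hm =>
    refine ⟨{i}, by rw [Finset.sum_singleton, proj_of_mem M hm], fun j hj => ?_⟩
    exact proj_of_mem_of_ne M hm fun h => hj (by simp [h])
  | zero => exact ⟨∅, by simp, by simp⟩
  | add m m' h h' =>
    obtain ⟨S, h1, h2⟩ := h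
    obtain ⟨S', h1', h2'⟩ := h'
    refine ⟨S ∪ S', ?_, fun i hi => ?_⟩
    · have e1 := Finset.sum_subset (Finset.subset_union_left (s₁ := S) (s₂ := S'))
        fun i _ hi => h2 i hi
      have e2 := Finset.sum_subset (Finset.subset_union_right (s₁ := S) (s₂ := S'))
        fun i _ hi => h2' i hi
      simp only [map_add, Finset.sum_add_distrib]
      rw [← e1, ← e2, ← h1, ← h1']
    · rw [Finset.mem_union, not_or] at hi
      rw [map_add, h2 i hi.1, h2' i hi.2, add_zero]

theorem exists_bound (m : M.carrier) : ∃ D : ℤ, ∀ n, D ≤ n → M.proj n m = 0 := by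
  obtain ⟨S, -, h⟩ := M.exists_finset m
  obtain ⟨D, hD⟩ := S.bddAbove
  refine ⟨D + 1, fun n hn => h n fun hmem => ?_⟩
  have := hD (Finset.mem_coe.2 hmem)
  omega

/-- The bridge from finite dimension to large degrees: a finite-dimensional subspace has components
in only finitely many degrees. -/
theorem exists_bound_of_fg {U : Submodule k M.carrier} (hU : U.FG) :
    ∃ D : ℤ, ∀ n, D ≤ n → ∀ u ∈ U, M.proj n u = 0 := by
  classical
  obtain ⟨S, rfl⟩ := hU
  choose D hD using M.exists_bound
  obtain ⟨D', hD'⟩ := (S.image D).bddAbove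
  refine ⟨D', fun n hn u hu => ?_⟩
  have hle : Submodule.span k (S : Set M.carrier) ≤ LinearMap.ker (M.proj n) :=
    Submodule.span_le.2 fun s hs => hD s n
      ((hD' (Finset.mem_coe.2 (Finset.mem_image_of_mem D hs))).trans hn)
  exact hle hu

end Projections

theorem isInternal_of_proj {V : Type*} [AddCommGroup V] [Module k V] (d : ℤ → Submodule k V)
    (p : ℤ → V →ₗ[k] V) (h1 : ∀ i, ∀ v ∈ d i, p i v = v)
    (h2 : ∀ i j, i ≠ j → ∀ v ∈ d i, p j v = 0) (htop : ⨆ i, d i = ⊤) :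
    DirectSum.IsInternal d := by
  refine (DirectSum.isInternal_submodule_iff_iSupIndep_and_iSup_eq_top _).2 ⟨fun i => ?_, htop⟩
  rw [Submodule.disjoint_def]
  intro v hv hv'
  have hle : ⨆ j, ⨆ (_ : j ≠ i), d j ≤ LinearMap.ker (p i) :=
    iSup₂_le fun j hj v hv => h2 j i hj v hv
  rw [← h1 i v hv]
  exact hle hv'

section Hom

variable {M N P : GrMod k A 𝒜}

/-- The `k`-linear map underlying a morphism of graded modules. -/
def kLin (f : M ⟶ N) : M.carrier →ₗ[k] N.carrier := f.toLin.restrictScalars k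

@[simp] theorem comp_toLin (f : M ⟶ N) (g : N ⟶ P) : (f ≫ g).toLin = g.toLin.comp f.toLin := rfl

@[simp] theorem id_toLin : Hom.toLin (𝟙 M) = LinearMap.id := rfl

@[ext] theorem hom_ext {f g : M ⟶ N} (h : ∀ m, f.toLin m = g.toLin m) : f = g :=
  Hom.ext (LinearMap.ext h)

theorem proj_map (f : M ⟶ N) (i : ℤ) (m : M.carrier) :
    N.proj i (f.toLin m) = f.toLin (M.proj i m) := by
  induction m using induction_hom with
  | hom j m hm =>
    by_cases h : j = i
    · subst h
      rw [proj_of_mem M hm, proj_of_mem N (f.map_deg _ _ hm)]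
    · rw [proj_of_mem_of_ne M hm h, proj_of_mem_of_ne N (f.map_deg _ _ hm) h, map_zero]
  | zero => simp
  | add m m' h h' => rw [map_add, map_add, h, h', map_add, map_add]

instance : Zero (M ⟶ N) := ⟨⟨0, fun i _ _ => (N.deg i).zero_mem⟩⟩
instance : Add (M ⟶ N) :=
  ⟨fun f g => ⟨f.toLin + g.toLin, fun i m h => add_mem (f.map_deg i m h) (g.map_deg i m h)⟩⟩
instance : Neg (M ⟶ N) := ⟨fun f => ⟨-f.toLin, fun i m h => neg_mem (f.map_deg i m h)⟩⟩

@[simp] theorem zero_toLin : (0 : M ⟶ N).toLin = 0 := rfl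
@[simp] theorem add_toLin (f g : M ⟶ N) : (f + g).toLin = f.toLin + g.toLin := rfl
@[simp] theorem neg_toLin (f : M ⟶ N) : (-f).toLin = -f.toLin := rfl

instance : AddCommGroup (M ⟶ N) where
  add_assoc f g h := by ext; simp [add_assoc]
  zero_add f := by ext; simp
  add_zero f := by ext; simp
  add_comm f g := by ext; simp [add_comm]
  neg_add_cancel f := by ext; simp
  nsmul := nsmulRec
  zsmul := zsmulRec

@[simp] theorem sub_toLin (f g : M ⟶ N) : (f - g).toLin = f.toLin - g.toLin := by
  rw [sub_eq_add_neg, sub_eq_add_neg]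
  rfl

instance : Preadditive (GrMod k A 𝒜) where
  add_comp _ _ _ f g h := by ext; simp
  comp_add _ _ _ f g h := by ext; simp

end Hom

section Constructions

/-- The cokernel of a morphism of graded modules. -/
noncomputable def coker {M N : GrMod k A 𝒜} (f : M ⟶ N) : GrMod k A 𝒜 where
  carrier := N.carrier ⧸ LinearMap.range f.toLin
  deg i := (N.deg i).map ((LinearMap.range f.toLin).mkQ.restrictScalars k)
  isInternal := by
    have hle : ∀ i, ∀ n ∈ LinearMap.range f.toLin, N.proj i n ∈ LinearMap.range f.toLin := by
      rintro i _ ⟨m, rfl⟩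
      exact ⟨M.proj i m, (proj_map f i m).symm⟩
    refine isInternal_of_proj _ (fun i => quotientMap (LinearMap.range f.toLin) (N.proj i) (hle i))
      ?_ ?_ ?_
    · rintro i _ ⟨n, hn, rfl⟩
      exact congrArg (LinearMap.range f.toLin).mkQ (N.proj_of_mem hn)
    · rintro i j hij _ ⟨n, hn, rfl⟩
      exact (congrArg (LinearMap.range f.toLin).mkQ (N.proj_of_mem_of_ne hn hij)).trans
        (map_zero _)
    · rw [eq_top_iff]
      rintro ⟨n⟩ -
      induction n using induction_hom with
      | hom i m hm => exact Submodule.mem_iSup_of_mem i ⟨m, hm, rfl⟩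
      | zero => exact zero_mem _
      | add m m' h h' => exact add_mem h h'
  smul_mem := by
    rintro i j a _ ha ⟨m, hm, rfl⟩
    exact ⟨a • m, N.smul_mem i j a m ha hm, rfl⟩

/-- The projection to the cokernel. -/
noncomputable def cokerπ {M N : GrMod k A 𝒜} (f : M ⟶ N) : N ⟶ coker f where
  toLin := (LinearMap.range f.toLin).mkQ
  map_deg _ m hm := ⟨m, hm, rfl⟩

theorem comp_cokerπ {M N : GrMod k A 𝒜} (f : M ⟶ N) : f ≫ cokerπ f = 0 := by
  ext m
  exact (Submodule.Quotient.mk_eq_zero _).2 ⟨m, rfl⟩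

theorem cokerπ_surjective {M N : GrMod k A 𝒜} (f : M ⟶ N) :
    Function.Surjective (cokerπ f).toLin := Submodule.mkQ_surjective _

theorem cokerπ_eq_zero_iff {M N : GrMod k A 𝒜} (f : M ⟶ N) (n : N.carrier) :
    (cokerπ f).toLin n = 0 ↔ ∃ m, f.toLin m = n := Submodule.Quotient.mk_eq_zero _

/-- The direct sum of two graded modules. -/
def prod (M N : GrMod k A 𝒜) : GrMod k A 𝒜 where
  carrier := M.carrier × N.carrier
  deg i := (M.deg i).prod (N.deg i)
  isInternal := by
    refine isInternal_of_proj _ (fun i => (M.proj i).prodMap (N.proj i)) ?_ ?_ ?_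
    · rintro i ⟨m, n⟩ ⟨hm, hn⟩
      exact Prod.ext (M.proj_of_mem hm) (N.proj_of_mem hn)
    · rintro i j hij ⟨m, n⟩ ⟨hm, hn⟩
      exact Prod.ext (M.proj_of_mem_of_ne hm hij) (N.proj_of_mem_of_ne hn hij)
    · have h1 : ∀ m : M.carrier, (m, (0 : N.carrier)) ∈ ⨆ i, (M.deg i).prod (N.deg i) := by
        intro m
        induction m using induction_hom with
        | hom i m hm => exact Submodule.mem_iSup_of_mem i ⟨hm, zero_mem _⟩
        | zero => exact zero_mem _
        | add m m' h h' => simpa using add_mem h h'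
      have h2 : ∀ n : N.carrier, ((0 : M.carrier), n) ∈ ⨆ i, (M.deg i).prod (N.deg i) := by
        intro n
        induction n using induction_hom with
        | hom i m hm => exact Submodule.mem_iSup_of_mem i ⟨zero_mem _, hm⟩
        | zero => exact zero_mem _
        | add m m' h h' => simpa using add_mem h h'
      rw [eq_top_iff]
      rintro ⟨m, n⟩ -
      simpa using add_mem (h1 m) (h2 n)
  smul_mem i j a m ha hm := ⟨M.smul_mem i j a _ ha hm.1, N.smul_mem i j a _ ha hm.2⟩

variable (𝒜) in
/-- The graded free module on finitely many generators of degrees `-n j`. -/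
def free [GradedAlgebra 𝒜] {ι : Type} [Finite ι] (n : ι → ℤ) : GrMod k A 𝒜 where
  carrier := ι → A
  deg i := Submodule.pi Set.univ fun j => 𝒜 (n j + i)
  isInternal := by
    classical
    let S : ι → GrMod k A 𝒜 := fun j => (self 𝒜).shift (n j)
    let p : ℤ → (ι → A) →ₗ[k] (ι → A) := fun i =>
      LinearMap.pi fun j => ((S j).proj i : A →ₗ[k] A) ∘ₗ LinearMap.proj j
    refine isInternal_of_proj _ p ?_ ?_ ?_
    · intro i v hv
      funext j
      exact (S j).proj_of_mem (hv j trivial)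
    · intro i j hij v hv
      funext l
      exact (S l).proj_of_mem_of_ne (hv l trivial) hij
    · rw [eq_top_iff]
      have := Fintype.ofFinite ι
      rintro v -
      rw [← Finset.univ_sum_single v]
      refine sum_mem fun j _ => ?_
      have hom : ∀ i, ∀ a ∈ 𝒜 (n j + i), (Pi.single j a : ι → A) ∈
          ⨆ i, (Submodule.pi Set.univ fun j => 𝒜 (n j + i) : Submodule k (ι → A)) := by
        refine fun i a ha => Submodule.mem_iSup_of_mem i fun l _ => ?_
        change (Pi.single j a : ι → A) l ∈ 𝒜 (n l + i)
        by_cases h : l = j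
        · subst h
          rw [Pi.single_eq_same]
          exact ha
        · rw [Pi.single_eq_of_ne h]
          exact zero_mem _
      have key : ∀ a : (S j).carrier, (Pi.single j (a : A) : ι → A) ∈
          ⨆ i, (Submodule.pi Set.univ fun j => 𝒜 (n j + i) : Submodule k (ι → A)) := by
        intro a
        induction a using induction_hom with
        | hom i a ha => exact hom i a ha
        | zero =>
          exact Set.mem_of_eq_of_mem (s := ((⨆ i, (Submodule.pi Set.univ fun j => 𝒜 (n j + i) :
            Submodule k (ι → A)) : Submodule k (ι → A)) : Set (ι → A)))
            (Pi.single_zero (M := fun _ => A) j) (zero_mem _)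
        | add m m' h h' =>
          exact Set.mem_of_eq_of_mem (s := ((⨆ i, (Submodule.pi Set.univ fun j => 𝒜 (n j + i) :
            Submodule k (ι → A)) : Submodule k (ι → A)) : Set (ι → A)))
            (Pi.single_add (f := fun _ => A) j m m') (add_mem h h')
      exact key (v j)
  smul_mem i j a v ha hv l _ := by
    have := SetLike.mul_mem_graded ha (hv l trivial)
    rwa [show i + (n l + j) = n l + (i + j) by ring] at this

variable [GradedAlgebra 𝒜] {ι : Type} [Fintype ι]

/-- The morphism from a graded free module given by homogeneous elements. -/
def freeLift (n : ι → ℤ) (M : GrMod k A 𝒜) (e : ι → M.carrier) (he : ∀ j, e j ∈ M.deg (-n j)) :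
    free 𝒜 n ⟶ M where
  toLin := Fintype.linearCombination A e
  map_deg i v hv := by
    refine Set.mem_of_eq_of_mem (s := (M.deg i : Set M.carrier))
      (Fintype.linearCombination_apply A e v) (sum_mem fun j _ => ?_)
    have := M.smul_mem _ _ _ _ (hv j trivial) (he j)
    rwa [show n j + i + -n j = i by ring] at this

end Constructions

end GrMod

namespace FpGrMod

variable {k : Type u} [Field k] {A : Type u} [Ring A] [Algebra k A] {𝒜 : ℤ → Submodule k A}

open GrMod

/-- The cokernel of a morphism of finitely presented graded modules. -/
noncomputable def coker {M N : FpGrMod 𝒜} (f : M ⟶ N) : FpGrMod 𝒜 where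
  obj := GrMod.coker f.hom
  property := by
    have : Module.FinitePresentation A N.obj.carrier := N.property
    have : Module.FinitePresentation A M.obj.carrier := M.property
    have key : Module.FinitePresentation A (N.obj.carrier ⧸ LinearMap.range f.hom.toLin) := by
      refine Module.finitePresentation_of_surjective (LinearMap.range f.hom.toLin).mkQ
        (Submodule.mkQ_surjective _) ?_
      rw [Submodule.ker_mkQ, LinearMap.range_eq_map]
      exact Module.Finite.fg_top.map _
    exact key

/-- The projection to the cokernel. -/
noncomputable def cokerπ {M N : FpGrMod 𝒜} (f : M ⟶ N) : N ⟶ coker f :=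
  ObjectProperty.homMk (GrMod.cokerπ f.hom)

/-- The direct sum of two finitely presented graded modules. -/
def prod (M N : FpGrMod 𝒜) : FpGrMod 𝒜 where
  obj := M.obj.prod N.obj
  property := by
    have : Module.FinitePresentation A N.obj.carrier := N.property
    have : Module.FinitePresentation A M.obj.carrier := M.property
    exact inferInstanceAs (Module.FinitePresentation A (M.obj.carrier × N.obj.carrier))

variable (𝒜) in
/-- A graded free module as a finitely presented graded module. -/
def free [GradedAlgebra 𝒜] {ι : Type} [Finite ι] (n : ι → ℤ) : FpGrMod 𝒜 where
  obj := GrMod.free 𝒜 n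
  property := inferInstanceAs (Module.FinitePresentation A (ι → A))

@[ext] theorem hom_ext {M N : FpGrMod 𝒜} {f g : M ⟶ N}
    (h : ∀ m, f.hom.toLin m = g.hom.toLin m) : f = g :=
  ObjectProperty.hom_ext _ (GrMod.hom_ext h)

end FpGrMod

/-! ### Fractions for morphisms with finite-dimensional kernel and cokernel. -/

section CalculusOfFractions

variable {k : Type u} [Field k] {A : Type u} [Ring A] [Algebra k A] {𝒜 : ℤ → Submodule k A}

open GrMod

theorem finDimIso_iff {M N : FpGrMod 𝒜} (f : M ⟶ N) : finDimIso 𝒜 f ↔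
    (LinearMap.ker (kLin f.hom)).FG ∧
      ∃ U : Submodule k N.obj.carrier, U.FG ∧ LinearMap.range (kLin f.hom) ⊔ U = ⊤ := by
  rw [← Module.Finite.iff_fg]
  exact and_congr Iff.rfl (finite_quotient_restrictScalars_iff (LinearMap.range f.hom.toLin))

theorem finDimIso_isMultiplicative : (finDimIso 𝒜).IsMultiplicative where
  id_mem M := (finDimIso_iff _).2 ⟨by
    have : LinearMap.ker (kLin (InducedCategory.Hom.hom (𝟙 M))) = ⊥ := LinearMap.ker_id
    rw [this]
    exact Submodule.fg_bot, ⊥, Submodule.fg_bot, by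
    have : LinearMap.range (kLin (InducedCategory.Hom.hom (𝟙 M))) = ⊤ := LinearMap.range_id
    rw [this, top_sup_eq]⟩
  comp_mem f g hf hg := by
    rw [finDimIso_iff] at hf hg ⊢
    obtain ⟨hf1, U, hU, hfU⟩ := hf
    obtain ⟨hg1, U', hU', hgU⟩ := hg
    refine ⟨fg_ker_comp (kLin f.hom) (kLin g.hom) hf1 hg1, U.map (kLin g.hom) ⊔ U',
      (hU.map _).sup hU', ?_⟩
    have h : LinearMap.range (kLin (f ≫ g).hom) =
        (LinearMap.range (kLin f.hom)).map (kLin g.hom) :=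
      LinearMap.range_comp (kLin f.hom) (kLin g.hom)
    rw [h, ← sup_assoc, ← Submodule.map_sup, hfU, Submodule.map_top, hgU]

/-- The morphisms with finite dimensional kernel and cokernel admit a left calculus of
fractions. -/
theorem finDimIso_hasLeftCalculusOfFractions : (finDimIso 𝒜).HasLeftCalculusOfFractions where
  toIsMultiplicative := finDimIso_isMultiplicative
  exists_leftFraction X Y φ := by
    -- The square is completed by the pushout, the cokernel of `(f, -s)`.
    let j : φ.X' ⟶ FpGrMod.prod Y X := ObjectProperty.homMk
      { toLin := LinearMap.prod φ.f.hom.toLin (-φ.s.hom.toLin)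
        map_deg := fun i m hm => ⟨φ.f.hom.map_deg i m hm, neg_mem (φ.s.hom.map_deg i m hm)⟩ }
    let inl : Y ⟶ FpGrMod.prod Y X := ObjectProperty.homMk
      { toLin := LinearMap.inl A _ _
        map_deg := fun i m hm => ⟨hm, zero_mem _⟩ }
    let inr : X ⟶ FpGrMod.prod Y X := ObjectProperty.homMk
      { toLin := LinearMap.inr A _ _
        map_deg := fun i m hm => ⟨zero_mem _, hm⟩ }
    have hπ : ∀ z, (FpGrMod.cokerπ j).hom.toLin z = 0 ↔
        ∃ m, j.hom.toLin m = z := cokerπ_eq_zero_iff _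
    have hs := φ.hs
    rw [finDimIso_iff] at hs
    obtain ⟨h1, U, hU, hsU⟩ := hs
    refine ⟨⟨inr ≫ FpGrMod.cokerπ j, inl ≫ FpGrMod.cokerπ j, ?_⟩, ?_⟩
    · rw [finDimIso_iff]
      constructor
      -- An element of `Y` dying in the pushout is the image under `f` of an element of `ker s`.
      · refine Submodule.FG.of_le (h1.map (kLin φ.f.hom)) ?_
        intro y hy
        obtain ⟨m, hm⟩ := (hπ _).1 hy
        have hm1 : φ.f.hom.toLin m = y := congrArg Prod.fst hm
        have hm2 : -φ.s.hom.toLin m = 0 := congrArg Prod.snd hm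
        exact ⟨m, neg_eq_zero.1 hm2, hm1⟩
      · refine ⟨U.map (kLin (inr ≫ FpGrMod.cokerπ j).hom), hU.map _, ?_⟩
        rw [eq_top_iff]
        intro z _
        obtain ⟨⟨y, x⟩, rfl⟩ := cokerπ_surjective j.hom z
        have hx : x ∈ LinearMap.range (kLin φ.s.hom) ⊔ U := hsU ▸ Submodule.mem_top
        obtain ⟨_, ⟨m, rfl⟩, u, hu, rfl⟩ := Submodule.mem_sup.1 hx
        refine Submodule.mem_sup.2 ⟨_, ⟨y + φ.f.hom.toLin m, rfl⟩, _, ⟨u, hu, rfl⟩, ?_⟩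
        refine sub_eq_zero.1 ?_
        have : (GrMod.cokerπ j.hom).toLin (j.hom.toLin m) = 0 := (hπ _).2 ⟨m, rfl⟩
        refine Eq.trans ?_ this
        change (FpGrMod.cokerπ j).hom.toLin (y + φ.f.hom.toLin m, 0) +
          (FpGrMod.cokerπ j).hom.toLin (0, u) -
            (FpGrMod.cokerπ j).hom.toLin (y, φ.s.hom.toLin m + u) = _
        refine (congrArg (· - _) (map_add (FpGrMod.cokerπ j).hom.toLin _ _).symm).trans ?_
        refine (map_sub (FpGrMod.cokerπ j).hom.toLin _ _).symm.trans ?_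
        refine congrArg (FpGrMod.cokerπ j).hom.toLin ?_
        change _ = (φ.f.hom.toLin m, -φ.s.hom.toLin m)
        refine Prod.ext ?_ ?_
        · change y + φ.f.hom.toLin m + 0 - y = φ.f.hom.toLin m
          abel
        · change 0 + u - (φ.s.hom.toLin m + u) = -φ.s.hom.toLin m
          abel
    · ext m
      change (FpGrMod.cokerπ j).hom.toLin (φ.f.hom.toLin m, 0) =
        (FpGrMod.cokerπ j).hom.toLin (0, φ.s.hom.toLin m)
      refine sub_eq_zero.1 ((map_sub (FpGrMod.cokerπ j).hom.toLin _ _).symm.trans ((hπ _).2 ?_))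
      refine ⟨m, Prod.ext ?_ ?_⟩
      · exact (sub_zero _).symm
      · exact (zero_sub _).symm
  ext X' X Y f₁ f₂ s hs h := by
    rw [finDimIso_iff] at hs
    obtain ⟨-, U, hU, hsU⟩ := hs
    -- The kernel of this projection is the image of `f₁ - f₂`, which vanishes on the range of `s`;
    -- so it is already the image of the finite-dimensional `U`.
    refine ⟨_, FpGrMod.cokerπ (f₁ - f₂), ?_, ?_⟩
    · rw [finDimIso_iff]
      refine ⟨?_, ⊥, Submodule.fg_bot, ?_⟩
      · refine Submodule.FG.of_le (hU.map (kLin (f₁ - f₂).hom)) ?_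
        intro y hy
        obtain ⟨x, rfl⟩ := (cokerπ_eq_zero_iff (f₁ - f₂).hom y).1 hy
        have hx : x ∈ LinearMap.range (kLin s.hom) ⊔ U := hsU ▸ Submodule.mem_top
        obtain ⟨_, ⟨m, rfl⟩, u, hu, rfl⟩ := Submodule.mem_sup.1 hx
        refine ⟨u, hu, ?_⟩
        have h0 : s ≫ (f₁ - f₂) = 0 := by rw [Preadditive.comp_sub, h, sub_self]
        have h1 : (f₁ - f₂).hom.toLin (s.hom.toLin m) = 0 :=
          congrArg (fun g : X' ⟶ Y => g.hom.toLin m) h0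
        refine Eq.symm ((map_add (f₁ - f₂).hom.toLin _ _).trans ?_)
        exact (congrArg (· + _) h1).trans (zero_add _)
      · rw [sup_bot_eq, LinearMap.range_eq_top]
        exact cokerπ_surjective _
    · rw [← sub_eq_zero, ← Preadditive.sub_comp]
      exact ObjectProperty.hom_ext _ (comp_cokerπ _)

end CalculusOfFractions

/-! ## Graded modules over `k⟨x, y⟩ / (y ^ (r + 1))` in large degrees -/

namespace PenroseAlg

variable {k : Type u} [Field k] {r : ℕ}

section ThetaLin

variable {M N : Type*} [AddCommGroup M] [Module (PenroseAlg k r) M] [Module k M]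
  [IsScalarTower k (PenroseAlg k r) M] [AddCommGroup N] [Module (PenroseAlg k r) N] [Module k N]
  [IsScalarTower k (PenroseAlg k r) N]

variable (k r M) in
/-- The map `(m₀, …, mᵣ) ↦ ∑ yⁱ x mᵢ` as a linear map. -/
noncomputable def thetaLin : (Fin (r + 1) → M) →ₗ[k] M where
  toFun m := theta k r fun i => if h : i < r + 1 then m ⟨i, h⟩ else 0
  map_add' m m' := by
    rw [← theta_add]
    refine theta_congr fun i hi => ?_
    simp only [dif_pos (Nat.lt_succ_of_le hi), Pi.add_apply]
  map_smul' c m := by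
    rw [RingHom.id_apply, ← theta_smul]
    refine theta_congr fun i hi => ?_
    simp only [dif_pos (Nat.lt_succ_of_le hi), Pi.smul_apply]

theorem thetaLin_apply (m : ℕ → M) : thetaLin k r M (fun i => m i) = theta k r m :=
  theta_congr fun i hi => by simp only [dif_pos (Nat.lt_succ_of_le hi)]

theorem map_thetaLin (f : M →ₗ[PenroseAlg k r] N) (m : Fin (r + 1) → M) :
    f (thetaLin k r M m) = thetaLin k r N fun i => f (m i) := by
  refine (map_theta f _).trans (theta_congr fun i hi => ?_)
  simp only [dif_pos (Nat.lt_succ_of_le hi)]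

theorem thetaLin_injective_of_free (ι : Type*) :
    Function.Injective (thetaLin k r (ι → PenroseAlg k r)) := by
  rw [injective_iff_map_eq_zero]
  intro m hm
  funext i j
  have h := map_thetaLin (k := k) (r := r) (M := ι → PenroseAlg k r)
    (N := PenroseAlg k r) (LinearMap.proj j) m
  rw [hm, map_zero] at h
  have := theta_injective h.symm i (Nat.lt_succ_iff.1 i.2)
  rwa [dif_pos i.2] at this

theorem exists_fg_sup_range_thetaLin_of_free (ι : Type*) [Finite ι] :
    ∃ U : Submodule k (ι → PenroseAlg k r), U.FG ∧
      LinearMap.range (thetaLin k r (ι → PenroseAlg k r)) ⊔ U = ⊤ := by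
  refine ⟨Submodule.pi Set.univ fun _ =>
    Submodule.span k (Set.range fun i : Fin (r + 1) => gen k r 1 ^ (i : ℕ)), ?_, ?_⟩
  · exact Submodule.fg_pi fun _ => Submodule.fg_span (Set.finite_range _)
  · rw [eq_top_iff]
    intro v _
    choose b z hz h using fun j => exists_eq_theta_add_mem_span (v j)
    refine Submodule.mem_sup.2 ⟨_, ⟨fun i j => b j i, rfl⟩, z, fun j _ => hz j, ?_⟩
    funext j
    have := map_thetaLin (k := k) (r := r) (M := ι → PenroseAlg k r)
      (N := PenroseAlg k r) (LinearMap.proj j) fun i j => b j i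
    rw [Pi.add_apply, h j]
    refine congrArg (· + z j) (this.trans ?_)
    exact thetaLin_apply (b j)

theorem exists_fg_sup_range_thetaLin [Module.Finite (PenroseAlg k r) M] :
    ∃ U : Submodule k M, U.FG ∧ LinearMap.range (thetaLin k r M) ⊔ U = ⊤ := by
  obtain ⟨n, f, hf⟩ := Module.Finite.exists_fin' (PenroseAlg k r) M
  obtain ⟨U, hU, h⟩ := exists_fg_sup_range_thetaLin_of_free (k := k) (r := r) (Fin n)
  refine ⟨U.map (f.restrictScalars k), hU.map _, ?_⟩
  rw [eq_top_iff]
  intro m _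
  obtain ⟨v, rfl⟩ := hf m
  have hv : v ∈ LinearMap.range (thetaLin k r (Fin n → PenroseAlg k r)) ⊔ U :=
    h ▸ Submodule.mem_top
  obtain ⟨_, ⟨w, rfl⟩, u, hu, rfl⟩ := Submodule.mem_sup.1 hv
  rw [map_add, map_thetaLin]
  exact Submodule.add_mem_sup ⟨_, rfl⟩ ⟨u, hu, rfl⟩

/-- A snake argument on a presentation `Bᵐ → Bⁿ → M`: since `theta` is injective on `Bⁿ`, its kernel
on `M` is controlled by its cokernel on `Bᵐ`, which is finite-dimensional. -/
theorem fg_ker_thetaLin [Module.FinitePresentation (PenroseAlg k r) M] :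
    (LinearMap.ker (thetaLin k r M)).FG := by
  obtain ⟨n, m, f, g, hf, hfg⟩ := Module.FinitePresentation.exists_fin' (PenroseAlg k r) M
  obtain ⟨U, hU, h⟩ := exists_fg_sup_range_thetaLin_of_free (k := k) (r := r) (Fin m)
  -- The families in `Bⁿ` whose `theta` lies in the image of `U`; the lift `w` of an element of the
  -- kernel will be corrected by relations so as to land here.
  have hfin : ((U.map (g.restrictScalars k)).comap
      (thetaLin k r (Fin n → PenroseAlg k r))).FG := by
    refine Submodule.fg_of_fg_map_of_fg_inf_ker (thetaLin k r (Fin n → PenroseAlg k r)) ?_ ?_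
    · exact Submodule.FG.of_le (hU.map _) (Submodule.map_comap_le _ _)
    · rw [LinearMap.ker_eq_bot.2 (thetaLin_injective_of_free (Fin n)), inf_bot_eq]
      exact Submodule.fg_bot
  refine Submodule.FG.of_le (hfin.map (LinearMap.pi fun i : Fin (r + 1) =>
    f.restrictScalars k ∘ₗ LinearMap.proj i)) ?_
  intro v hv
  choose w hw using fun i => hf (v i)
  have h1 : f (thetaLin k r _ w) = 0 := by
    rw [map_thetaLin]
    simp only [hw]
    exact hv
  obtain ⟨b, hb⟩ := (hfg _).1 h1
  have hb' : b ∈ LinearMap.range (thetaLin k r (Fin m → PenroseAlg k r)) ⊔ U :=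
    h ▸ Submodule.mem_top
  obtain ⟨_, ⟨c, rfl⟩, u, hu, rfl⟩ := Submodule.mem_sup.1 hb'
  refine ⟨w - fun i => g (c i), ?_, ?_⟩
  · refine ⟨u, hu, ?_⟩
    rw [map_sub, ← hb, map_add, map_thetaLin]
    simp
  · funext i
    change f (w i - g (c i)) = v i
    rw [map_sub, hw, (hfg _).2 ⟨c i, rfl⟩, sub_zero]

end ThetaLin

open GrMod

section Degrees

variable {M N : GrMod k (PenroseAlg k r) (grading k r)}

variable (k r) in
/-- The projection of the algebra to a homogeneous component. -/
noncomputable def algProj (n : ℤ) : PenroseAlg k r →ₗ[k] PenroseAlg k r :=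
  (GrMod.self (grading k r)).proj n

theorem algProj_mem (n : ℤ) (a : PenroseAlg k r) : algProj k r n a ∈ grading k r n :=
  (GrMod.self (grading k r)).proj_mem n a

theorem proj_smul (a : PenroseAlg k r) {i : ℤ} {m : M.carrier} (hm : m ∈ M.deg i) (n : ℤ) :
    M.proj n (a • m) = algProj k r (n - i) a • m := by
  refine GrMod.induction_hom (M := GrMod.self (grading k r))
    (p := fun a : PenroseAlg k r => M.proj n (a • m) = algProj k r (n - i) a • m) a ?_ ?_ ?_
  · intro j (a : PenroseAlg k r) ha
    have ha' : a ∈ grading k r j := ha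
    have h1 := M.smul_mem _ _ _ _ ha' hm
    by_cases h : j = n - i
    · subst h
      rw [sub_add_cancel] at h1
      have h2 : algProj k r (n - i) a = a := (GrMod.self (grading k r)).proj_of_mem ha
      rw [M.proj_of_mem h1, h2]
    · have h2 : algProj k r (n - i) a = 0 := (GrMod.self (grading k r)).proj_of_mem_of_ne ha h
      rw [M.proj_of_mem_of_ne h1 (by omega), h2, zero_smul]
  · change M.proj n ((0 : PenroseAlg k r) • m) = algProj k r (n - i) 0 • m
    simp
  · intro (a : PenroseAlg k r) (b : PenroseAlg k r) ha hb
    change M.proj n ((a + b) • m) = algProj k r (n - i) (a + b) • m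
    rw [add_smul, map_add, ha, hb, map_add, add_smul]

theorem proj_smul_of_mem {a : PenroseAlg k r} {i : ℤ} (ha : a ∈ grading k r i) (m : M.carrier)
    (n : ℤ) : M.proj n (a • m) = a • M.proj (n - i) m := by
  induction m using GrMod.induction_hom with
  | hom j m hm =>
    have h1 := M.smul_mem _ _ _ _ ha hm
    by_cases h : j = n - i
    · subst h
      rw [add_sub_cancel] at h1
      rw [M.proj_of_mem h1, M.proj_of_mem hm]
    · rw [M.proj_of_mem_of_ne hm h, M.proj_of_mem_of_ne h1 (by omega), smul_zero]
  | zero => simp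
  | add m m' h h' => rw [smul_add, map_add, h, h', map_add, smul_add]

theorem gen_pow_mem (i : Fin 2) (n : ℕ) : gen k r i ^ n ∈ grading k r n := by
  simpa using SetLike.pow_mem_graded n (gen_mem k r i)

theorem proj_theta (m : ℕ → M.carrier) (n : ℤ) :
    M.proj n (theta k r m) = theta k r fun i => M.proj (n - 1 - i) (m i) := by
  rw [theta, map_sum]
  refine Finset.sum_congr rfl fun i _ => ?_
  rw [proj_smul_of_mem (gen_pow_mem 1 i), proj_smul_of_mem (gen_mem k r 0), sub_right_comm]

theorem exists_homogeneous_generators [Module.Finite (PenroseAlg k r) M.carrier] :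
    ∃ E : Finset (ℤ × M.carrier), (∀ p ∈ E, p.2 ∈ M.deg p.1) ∧
      ∀ m, ∃ c : ℤ × M.carrier → PenroseAlg k r, m = ∑ p ∈ E, c p • p.2 := by
  classical
  obtain ⟨S, hS⟩ := (Module.Finite.fg_top (R := PenroseAlg k r) (M := M.carrier))
  choose s hs1 hs2 using M.exists_finset
  let E : Finset (ℤ × M.carrier) := S.biUnion fun m => (s m).image fun i => (i, M.proj i m)
  have htop : Submodule.span (PenroseAlg k r) (Prod.snd '' (E : Set (ℤ × M.carrier))) = ⊤ := by
    rw [eq_top_iff, ← hS, Submodule.span_le]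
    intro m hm
    rw [hs1 m]
    refine sum_mem fun i hi => Submodule.subset_span ⟨(i, M.proj i m), ?_, rfl⟩
    exact Finset.mem_coe.2 (Finset.mem_biUnion.2 ⟨m, hm, Finset.mem_image_of_mem _ hi⟩)
  refine ⟨E, ?_, fun m => ?_⟩
  · intro p hp
    obtain ⟨m, -, hp⟩ := Finset.mem_biUnion.1 hp
    obtain ⟨i, -, rfl⟩ := Finset.mem_image.1 hp
    exact M.proj_mem i m
  · have hm : m ∈ Submodule.span (PenroseAlg k r) (Prod.snd '' (E : Set (ℤ × M.carrier))) :=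
      htop ▸ Submodule.mem_top
    obtain ⟨c, hc⟩ := (Submodule.mem_span_image_finset_iff_exists_fun (PenroseAlg k r)).1 hm
    refine ⟨fun p => if h : p ∈ E then c ⟨p, h⟩ else 0, ?_⟩
    rw [← hc, ← Finset.sum_coe_sort E]
    refine Finset.sum_congr rfl fun j _ => ?_
    simp only [dif_pos j.2]

theorem deg_le_of_generators {E : Finset (ℤ × M.carrier)} (hE : ∀ p ∈ E, p.2 ∈ M.deg p.1)
    (h : ∀ m, ∃ c : ℤ × M.carrier → PenroseAlg k r, m = ∑ p ∈ E, c p • p.2) (n : ℤ) :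
    M.deg n ≤ ⨆ p ∈ E, (grading k r (n - p.1)).map
      ((LinearMap.toSpanSingleton (PenroseAlg k r) M.carrier p.2).restrictScalars k) := by
  intro m hm
  obtain ⟨c, hc⟩ := h m
  rw [← M.proj_of_mem hm, hc, map_sum]
  refine sum_mem fun p hp => ?_
  rw [proj_smul (c p) (hE p hp)]
  refine Submodule.mem_iSup_of_mem p (Submodule.mem_iSup_of_mem hp ⟨_, ?_, rfl⟩)
  exact algProj_mem (n - p.1) (c p)

theorem deg_fg [Module.Finite (PenroseAlg k r) M.carrier] (n : ℤ) : (M.deg n).FG := by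
  obtain ⟨E, hE, h⟩ := exists_homogeneous_generators (M := M)
  refine Submodule.FG.of_le ?_ (deg_le_of_generators hE h n)
  exact Submodule.fg_biSup E _ fun p _ => (Module.Finite.iff_fg.1 (grading_finite k r _)).map _

theorem exists_deg_eq_bot [Module.Finite (PenroseAlg k r) M.carrier] :
    ∃ L : ℤ, ∀ n, n < L → M.deg n = ⊥ := by
  classical
  obtain ⟨E, hE, h⟩ := exists_homogeneous_generators (M := M)
  obtain ⟨L, hL⟩ := (E.image Prod.fst).bddBelow
  refine ⟨L, fun n hn => ?_⟩
  rw [eq_bot_iff]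
  refine (deg_le_of_generators hE h n).trans (iSup₂_le fun p hp => ?_)
  have := hL (Finset.mem_coe.2 (Finset.mem_image_of_mem Prod.fst hp))
  rw [grading_eq_bot k r (by omega), Submodule.map_bot]

/-- The components are finite-dimensional and vanish in very negative degrees, so the part below `D`
is finite-dimensional. -/
theorem exists_truncation [Module.Finite (PenroseAlg k r) M.carrier] (D : ℤ) :
    ∃ U : Submodule k M.carrier, U.FG ∧ (∀ n < D, M.deg n ≤ U) ∧
      ∀ m, (∀ n, D ≤ n → M.proj n m = 0) → m ∈ U := by
  obtain ⟨L, hL⟩ := exists_deg_eq_bot (M := M)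
  have hle : ∀ n < D, M.deg n ≤ ⨆ n ∈ Finset.Ico L D, M.deg n := by
    intro n hn
    by_cases h : n < L
    · rw [hL n h]
      exact bot_le
    · exact le_iSup₂_of_le n (Finset.mem_Ico.2 ⟨not_lt.1 h, hn⟩) le_rfl
  refine ⟨⨆ n ∈ Finset.Ico L D, M.deg n, Submodule.fg_biSup _ _ fun n _ => deg_fg n, hle, ?_⟩
  intro m hm
  obtain ⟨S, h1, -⟩ := M.exists_finset m
  rw [h1]
  refine sum_mem fun n _ => ?_
  by_cases h : n < D
  · exact hle n h (M.proj_mem n m)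
  · rw [hm n (not_lt.1 h)]
    exact zero_mem _

end Degrees

/-! ### Isomorphisms up to finite dimension as bijections in large degrees. -/

section EventuallyBijective

variable {M N : FpGrMod (grading k r)}

instance (M : FpGrMod (grading k r)) : Module.FinitePresentation (PenroseAlg k r) M.obj.carrier :=
  M.property

theorem exists_injective_of_finDimIso {f : M ⟶ N} (hf : finDimIso (grading k r) f) :
    ∃ D : ℤ, ∀ n, D ≤ n → ∀ m ∈ M.obj.deg n, f.hom.toLin m = 0 → m = 0 := by
  rw [finDimIso_iff] at hf
  obtain ⟨D, hD⟩ := M.obj.exists_bound_of_fg hf.1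
  refine ⟨D, fun n hn m hm h => ?_⟩
  rw [← M.obj.proj_of_mem hm]
  exact hD n hn m h

theorem exists_surjective_of_finDimIso {f : M ⟶ N} (hf : finDimIso (grading k r) f) :
    ∃ D : ℤ, ∀ n, D ≤ n → ∀ m' ∈ N.obj.deg n, ∃ m ∈ M.obj.deg n, f.hom.toLin m = m' := by
  rw [finDimIso_iff] at hf
  obtain ⟨-, U, hU, h⟩ := hf
  obtain ⟨D, hD⟩ := N.obj.exists_bound_of_fg hU
  refine ⟨D, fun n hn m' hm' => ?_⟩
  have hm : m' ∈ LinearMap.range (kLin f.hom) ⊔ U := h ▸ Submodule.mem_top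
  obtain ⟨_, ⟨m, rfl⟩, u, hu, rfl⟩ := Submodule.mem_sup.1 hm
  refine ⟨M.obj.proj n m, M.obj.proj_mem n m, ?_⟩
  rw [← proj_map, ← N.obj.proj_of_mem hm', map_add, hD n hn u hu, add_zero]
  rfl

theorem finDimIso_of_eventually {f : M ⟶ N} {D : ℤ}
    (h1 : ∀ n, D ≤ n → ∀ m ∈ M.obj.deg n, f.hom.toLin m = 0 → m = 0)
    (h2 : ∀ n, D ≤ n → ∀ m' ∈ N.obj.deg n, ∃ m ∈ M.obj.deg n, f.hom.toLin m = m') :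
    finDimIso (grading k r) f := by
  rw [finDimIso_iff]
  obtain ⟨U, hU, -, hU2⟩ := exists_truncation (M := M.obj) D
  obtain ⟨U', hU', hU1', -⟩ := exists_truncation (M := N.obj) D
  refine ⟨Submodule.FG.of_le hU fun m hm => hU2 m fun n hn => ?_, U', hU', ?_⟩
  · refine h1 n hn _ (M.obj.proj_mem n m) ?_
    rw [← proj_map]
    have hm : f.hom.toLin m = 0 := hm
    rw [hm, map_zero]
  · rw [eq_top_iff, ← N.obj.isInternal.submodule_iSup_eq_top]
    refine iSup_le fun n => ?_
    by_cases hn : n < D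
    · exact (hU1' n hn).trans le_sup_right
    · refine le_trans ?_ le_sup_left
      intro m' hm'
      obtain ⟨m, -, h⟩ := h2 n (not_lt.1 hn) m' hm'
      exact ⟨m, h⟩

end EventuallyBijective

/-! ### Recursive families: modules and kernels. -/

section Recursion

/-- A family of subspaces `K n ⊆ M n`, stable under `x` and `y`, such that every element of `K n`,
`n ≥ D`, has a unique expression `∑ yⁱ x mᵢ` with `mᵢ` in `K (n - 1 - i)`. -/
structure IsRecursive (M : GrMod k (PenroseAlg k r) (grading k r))
    (K : ℤ → Submodule k M.carrier) (D : ℤ) : Prop where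
  le : ∀ n, K n ≤ M.deg n
  gen_smul_mem : ∀ (i : Fin 2) (n : ℤ), ∀ m ∈ K n, gen k r i • m ∈ K (n + 1)
  fg : ∀ n, (K n).FG
  inj : ∀ n, D ≤ n → ∀ m : ℕ → M.carrier, (∀ i : ℕ, m i ∈ K (n - 1 - i)) →
    theta k r m = 0 → ∀ i, i ≤ r → m i = 0
  surj : ∀ n, D ≤ n → ∀ m ∈ K n, ∃ m' : ℕ → M.carrier, (∀ i : ℕ, m' i ∈ K (n - 1 - i)) ∧
    theta k r m' = m

theorem exists_isRecursive (M : FpGrMod (grading k r)) :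
    ∃ D, IsRecursive M.obj M.obj.deg D := by
  obtain ⟨D₁, hD₁⟩ : ∃ D : ℤ, ∀ n, D ≤ n → ∀ v ∈ LinearMap.ker (thetaLin k r M.obj.carrier),
      ∀ i, M.obj.proj n (v i) = 0 := by
    have h := fun i : Fin (r + 1) => M.obj.exists_bound_of_fg
      ((fg_ker_thetaLin (k := k) (r := r) (M := M.obj.carrier)).map (LinearMap.proj i))
    choose D hD using h
    obtain ⟨D', hD'⟩ := (Finset.univ.image D).bddAbove
    refine ⟨D', fun n hn v hv i => hD i n ?_ _ ⟨v, hv, rfl⟩⟩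
    exact (hD' (Finset.mem_coe.2 (Finset.mem_image_of_mem D (Finset.mem_univ i)))).trans hn
  obtain ⟨U, hU, hsup⟩ := exists_fg_sup_range_thetaLin (k := k) (r := r) (M := M.obj.carrier)
  obtain ⟨D₂, hD₂⟩ := M.obj.exists_bound_of_fg hU
  -- The entries `mᵢ` have degrees `n - 1 - i`, as low as `n - 1 - r`, and must still lie above
  -- `D₁`.
  refine ⟨max (D₁ + 1 + r) D₂, fun n => le_rfl, fun i n m hm => ?_, deg_fg, ?_, ?_⟩
  · rw [add_comm n 1]
    exact M.obj.smul_mem 1 n _ m (gen_mem k r i) hm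
  · intro n hn m hm h0 i hi
    rw [← M.obj.proj_of_mem (hm i)]
    rw [← thetaLin_apply] at h0
    have := hD₁ (n - 1 - i) (by omega) _ h0 ⟨i, by omega⟩
    exact this
  · intro n hn m hm
    have hm' : m ∈ LinearMap.range (thetaLin k r M.obj.carrier) ⊔ U := hsup ▸ Submodule.mem_top
    obtain ⟨_, ⟨v, rfl⟩, u, hu, rfl⟩ := Submodule.mem_sup.1 hm'
    refine ⟨fun i => M.obj.proj (n - 1 - i) (if h : i < r + 1 then v ⟨i, h⟩ else 0),
      fun i => M.obj.proj_mem _ _, ?_⟩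
    rw [← proj_theta, ← M.obj.proj_of_mem hm, map_add, hD₂ n (by omega) u hu, add_zero]
    rfl

theorem theta_mem {M : GrMod k (PenroseAlg k r) (grading k r)} {m : ℕ → M.carrier} {n : ℤ}
    (hm : ∀ i : ℕ, m i ∈ M.deg (n - 1 - i)) : theta k r m ∈ M.deg n := by
  refine sum_mem fun i _ => ?_
  have := M.smul_mem _ _ _ _ (gen_pow_mem 1 i) (M.smul_mem _ _ _ _ (gen_mem k r 0) (hm i))
  rwa [show (i : ℤ) + (1 + (n - 1 - i)) = n by ring] at this

/-- Takes the place of coherence of `B`. If `theta m'` is killed by `f`, then `theta` of the images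
`f (m' i)` is `0`, and injectivity of `theta` on `N` in large degrees puts every `m' i` in the
kernel. -/
theorem exists_isRecursive_ker {M N : FpGrMod (grading k r)} (f : M ⟶ N) :
    ∃ D, IsRecursive M.obj (fun n => M.obj.deg n ⊓ LinearMap.ker (kLin f.hom)) D := by
  obtain ⟨D₁, h₁⟩ := exists_isRecursive M
  obtain ⟨D₂, h₂⟩ := exists_isRecursive N
  refine ⟨max D₁ D₂, fun n => inf_le_left, ?_, ?_, ?_, ?_⟩
  · rintro i n m ⟨hm, hm'⟩
    refine ⟨h₁.gen_smul_mem i n m hm, ?_⟩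
    have hm' : f.hom.toLin m = 0 := hm'
    change f.hom.toLin (gen k r i • m) = 0
    rw [map_smul, hm', smul_zero]
  · exact fun n => Submodule.FG.of_le (h₁.fg n) inf_le_left
  · exact fun n hn m hm => h₁.inj n (by omega) m fun i => (hm i).1
  · rintro n hn m ⟨hm, hm'⟩
    obtain ⟨m', h, rfl⟩ := h₁.surj n (by omega) m hm
    have hm' : f.hom.toLin (theta k r m') = 0 := hm'
    rw [map_theta] at hm'
    have h3 := h₂.inj n (by omega) _ (fun i => f.hom.map_deg _ _ (h i)) hm'
    -- The entries with `i > r` are invisible to `theta` and need not lie in the kernel, so they are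
    -- replaced by `0`.
    refine ⟨fun i => if i ≤ r then m' i else 0, fun i => ?_, theta_congr fun i hi => if_pos hi⟩
    dsimp only
    split_ifs with hi
    · exact ⟨h i, h3 i hi⟩
    · exact zero_mem _

end Recursion

end PenroseAlg

/-! ## Free covers in large degrees -/

/-- Bases of `C 0, …, C r` concatenated into one list, `l` recording the space each vector comes
from; this list will index the generators of a free module. -/
theorem exists_graded_basis {k V : Type*} [Field k] [AddCommGroup V] [Module k V] (r : ℕ)
    (C : ℕ → Submodule k V) (hC : ∀ l, (C l).FG) (hr : ∀ l, r < l → C l = ⊥) :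
    ∃ (s : ℕ) (l : Fin s → ℕ) (e : Fin s → V), (∀ j, l j ≤ r) ∧ (∀ j, e j ∈ C (l j)) ∧
      (∀ q, ∀ v ∈ C q, ∃ c : Fin s → k, ∑ j, (if l j = q then c j • e j else 0) = v) ∧
      ∀ q (c : Fin s → k), ∑ j, (if l j = q then c j • e j else 0) = 0 →
        ∀ j, l j = q → c j = 0 := by
  have hfin : ∀ l, Module.Finite k (C l) := fun l => Module.Finite.iff_fg.2 (hC l)
  let b := fun l => Module.finBasis k (C l)
  let ι := Σ l : Fin (r + 1), Fin (Module.finrank k (C l))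
  let E : Fin (Fintype.card ι) ≃ ι := (Fintype.equivFin ι).symm
  have hsum : ∀ (q : ℕ) (hq : q < r + 1) (c : ι → k),
      ∑ j : Fin (Fintype.card ι), (if ((E j).1 : ℕ) = q then c (E j) • (b (E j).1 (E j).2 : V) else 0)
        = ((∑ a, c ⟨⟨q, hq⟩, a⟩ • b q a : C q) : V) := by
    intro q hq c
    rw [E.sum_comp fun i : ι => if (i.1 : ℕ) = q then c i • (b i.1 i.2 : V) else 0,
      Fintype.sum_sigma, Finset.sum_eq_single ⟨q, hq⟩]
    · simp
    · intro l _ hl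
      refine Finset.sum_eq_zero fun a _ => if_neg fun h => hl (Fin.ext h)
    · simp
  refine ⟨Fintype.card ι, fun j => (E j).1, fun j => b (E j).1 (E j).2,
    fun j => Nat.lt_succ_iff.1 (E j).1.2,
    fun j => Subtype.property _, fun q v hv => ?_, fun q c h j hj => ?_⟩
  · by_cases hq : q < r + 1
    · refine ⟨fun j => if h : ((E j).1 : ℕ) = q then
        (b (E j).1).repr ⟨v, h ▸ hv⟩ (E j).2 else 0, ?_⟩
      have := hsum q hq fun i => if h : (i.1 : ℕ) = q then (b i.1).repr ⟨v, h ▸ hv⟩ i.2 else 0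
      rw [this]
      simp only [dif_pos]
      exact congrArg Subtype.val ((b q).sum_repr ⟨v, hv⟩)
    · rw [hr q (by omega), Submodule.mem_bot] at hv
      subst hv
      exact ⟨0, by simp⟩
  · have hq : q < r + 1 := hj ▸ (E j).1.2
    have h2 := hsum q hq fun i => c (E.symm i)
    simp only [Equiv.symm_apply_apply] at h2
    rw [h] at h2
    have h3 := Fintype.linearIndependent_iff.1 (b q).linearIndependent
      (fun a => c (E.symm ⟨⟨q, hq⟩, a⟩)) (Subtype.ext h2.symm)
    have h4 : ∀ i : ι, (i.1 : ℕ) = q → c (E.symm i) = 0 := by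
      rintro ⟨⟨l, hl⟩, a⟩ hi
      have hi : l = q := hi
      subst hi
      exact h3 a
    have := h4 (E j) hj
    rwa [Equiv.symm_apply_apply] at this

namespace PenroseAlg

open GrMod

variable {k : Type u} [Field k] {r : ℕ} {M : GrMod k (PenroseAlg k r) (grading k r)}
  {K : ℤ → Submodule k M.carrier} {D : ℤ}

namespace IsRecursive

theorem smul_mem (hK : IsRecursive M K D) {a : PenroseAlg k r} {p n : ℤ}
    (ha : a ∈ grading k r p) {m : M.carrier} (hm : m ∈ K n) : a • m ∈ K (p + n) := by
  induction ha using Submodule.span_induction with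
  | mem a ha =>
    obtain ⟨w, rfl, rfl⟩ := ha
    induction w with
    | nil => simpa using hm
    | cons i w ih =>
      rw [List.map_cons, List.prod_cons, mul_smul, List.length_cons]
      have := hK.gen_smul_mem i _ _ ih
      convert this using 2
      push_cast
      ring
  | zero => simp
  | add a b _ _ ha hb => rw [add_smul]; exact add_mem ha hb
  | smul c a _ h => rw [smul_assoc]; exact Submodule.smul_mem _ c h

theorem theta_mem (hK : IsRecursive M K D) {m : ℕ → M.carrier} {n : ℤ}
    (hm : ∀ i : ℕ, m i ∈ K (n - 1 - i)) : theta k r m ∈ K n := by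
  refine sum_mem fun i _ => ?_
  have := hK.smul_mem (gen_pow_mem 1 i) (hK.smul_mem (gen_mem k r 0) (hm i))
  rwa [show (i : ℤ) + (1 + (n - 1 - i)) = n by ring] at this

end IsRecursive

variable (K) in
/-- The subspace `yˡ K N` of `K (N + l)`. -/
noncomputable def powSmul (N : ℤ) (l : ℕ) : Submodule k M.carrier :=
  (K N).map (Module.toModuleEnd k (S := PenroseAlg k r) M.carrier (gen k r 1 ^ l))

/-- The shifts of a graded free module on generators of degrees `N + 1 + l j`. -/
noncomputable abbrev coverDeg {s : ℕ} (N : ℤ) (l : Fin s → ℕ) : Fin s → ℤ :=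
  fun j => -(N + 1 + l j)

theorem sum_range_smul_theta {V : Type*} [AddCommGroup V] [Module (PenroseAlg k r) V]
    (v z : ℕ → V) : ∑ i ∈ Finset.range (r + 1), gen k r 1 ^ i • (gen k r 0 • v i + z i) =
      theta k r v + ∑ i ∈ Finset.range (r + 1), gen k r 1 ^ i • z i := by
  simp only [smul_add, Finset.sum_add_distrib, theta]

/-! ### Comparison of a recursive family with a free module. -/

section Cover

variable {s : ℕ} {l : Fin s → ℕ} {e : Fin s → M.carrier} {N : ℤ}

theorem gen_smul_mem_deg (hK : IsRecursive M K D) (he : ∀ j, e j ∈ K (N + l j)) (j : Fin s) :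
    gen k r 0 • e j ∈ M.deg (-coverDeg N l j) := by
  have := M.smul_mem _ _ _ _ (gen_mem k r 0) (hK.le _ (he j))
  rwa [show (1 : ℤ) + (N + l j) = -coverDeg N l j by simp only [coverDeg]; ring] at this

/-- The map `b ⊗ e ↦ b x e` from a graded free module. -/
noncomputable abbrev coverMap (hK : IsRecursive M K D) (he : ∀ j, e j ∈ K (N + l j)) :
    GrMod.free (grading k r) (coverDeg N l) ⟶ M :=
  freeLift (coverDeg N l) M (fun j => gen k r 0 • e j) (gen_smul_mem_deg hK he)

/-- The map underlying `coverMap`, on families of elements of the algebra. -/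
noncomputable def coverLin (k : Type u) [Field k] {r s : ℕ}
    {M : GrMod k (PenroseAlg k r) (grading k r)} (e : Fin s → M.carrier) :
    (Fin s → PenroseAlg k r) →ₗ[PenroseAlg k r] M.carrier :=
  Fintype.linearCombination (PenroseAlg k r) fun j => gen k r 0 • e j

theorem coverLin_apply (v : Fin s → PenroseAlg k r) :
    coverLin k e v = ∑ j, v j • gen k r 0 • e j := Fintype.linearCombination_apply _ _ _

theorem coverLin_mem (hK : IsRecursive M K D) (he : ∀ j, e j ∈ K (N + l j)) {n : ℤ}
    {v : Fin s → PenroseAlg k r} (hv : ∀ j, v j ∈ grading k r (n - (N + 1 + l j))) :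
    coverLin k e v ∈ K n := by
  rw [coverLin_apply]
  refine sum_mem fun j _ => ?_
  have := hK.smul_mem (hv j) (hK.smul_mem (gen_mem k r 0) (he j))
  rwa [show n - (N + 1 + l j) + (1 + (N + l j)) = n by ring] at this

theorem coverLin_ite (c : Fin s → k) (q i : ℤ) :
    coverLin k e (fun j => if l j + i = q then c j • 1 else 0) =
      gen k r 0 • ∑ j, (if l j + i = q then c j • e j else 0) := by
  rw [coverLin_apply, Finset.smul_sum]
  refine Finset.sum_congr rfl fun j _ => ?_
  split_ifs with h
  · rw [smul_assoc, one_smul, smul_comm]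
  · rw [zero_smul, smul_zero]

theorem coverLin_sum (v z : ℕ → Fin s → PenroseAlg k r) :
    coverLin k e (∑ i ∈ Finset.range (r + 1), gen k r 1 ^ i • (gen k r 0 • v i + z i)) =
      ∑ i ∈ Finset.range (r + 1),
        gen k r 1 ^ i • (gen k r 0 • coverLin k e (v i) + coverLin k e (z i)) := by
  simp only [map_sum, map_smul, map_add]

theorem mem_of_mem_powSmul (hK : IsRecursive M K D) {l : ℕ} {m : M.carrier}
    (hm : m ∈ powSmul K N l) : m ∈ K (N + l) := by
  obtain ⟨m', hm', rfl⟩ := hm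
  have := hK.smul_mem (gen_pow_mem 1 l) hm'
  rwa [add_comm] at this

/-- The induction shows that the free part and `yᵗ K N` together fill `K (N + t)`; the second piece
disappears once `t > r`. With `t = q + 1` and `m = ∑ yⁱ x mᵢ`, the terms `i > q` assemble to an
element of `y ^ (q+1) K N`. For `i ≤ q`, `mᵢ` is a free part plus an element of `y ^ (q-i) K N`,
which is a combination of the `eⱼ` with `l j = q - i`; multiplication by `x` turns these into
generators `x eⱼ`. -/
theorem exists_coverLin_add (hK : IsRecursive M K D) (hN : D ≤ N)
    (h1 : ∀ q, ∀ v ∈ powSmul K N q, ∃ c : Fin s → k,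
      ∑ j, (if l j = q then c j • e j else 0) = v) (t : ℕ) :
    ∀ m ∈ K (N + t), ∃ v : Fin s → PenroseAlg k r,
      (∀ j, v j ∈ grading k r (N + t - (N + 1 + l j))) ∧
        ∃ w ∈ powSmul K N t, coverLin k e v + w = m := by
  induction t using Nat.strong_induction_on with
  | _ t ih =>
    intro m hm
    cases t with
    | zero =>
      refine ⟨0, fun j => zero_mem _, m, ⟨m, by simpa using hm, ?_⟩, by simp⟩
      simp
    | succ q =>
      obtain ⟨m', hm', rfl⟩ := hK.surj _ (by omega) m hm
      have hv : ∀ i : ℕ, ∃ (v : Fin s → PenroseAlg k r) (c : Fin s → k), i ≤ q →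
          (∀ j, v j ∈ grading k r (N + q - i - (N + 1 + l j))) ∧
          coverLin k e v + ∑ j, (if (l j : ℤ) + i = q then c j • e j else 0) = m' i := by
        intro i
        by_cases hi : i ≤ q
        · have hmi := hm' i
          rw [show N + ((q + 1 : ℕ) : ℤ) - 1 - i = N + ((q - i : ℕ) : ℤ) by omega] at hmi
          obtain ⟨v, hv, w, hw, h⟩ := ih (q - i) (by omega) _ hmi
          obtain ⟨c, rfl⟩ := h1 _ w hw
          refine ⟨v, c, fun _ => ⟨fun j => ?_, ?_⟩⟩
          · have := hv j
            rwa [show N + ((q - i : ℕ) : ℤ) = N + q - i by omega] at this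
          · rw [← h]
            congr 1
            refine Finset.sum_congr rfl fun j _ => ?_
            congr 1
            exact propext (by omega)
        · exact ⟨0, 0, fun h => absurd h hi⟩
      choose v c hvc using hv
      have hmem : theta k r (fun i => m' (i + (q + 1))) ∈ K N := hK.theta_mem fun i => by
        have := hm' (i + (q + 1))
        rwa [show N + ((q + 1 : ℕ) : ℤ) - 1 - ((i + (q + 1) : ℕ) : ℤ) = N - 1 - i by omega] at this
      refine ⟨∑ i ∈ Finset.range (r + 1), gen k r 1 ^ i •
        (gen k r 0 • (if i ≤ q then v i else 0) +
          (if i ≤ q then fun j => if (l j : ℤ) + i = q then c i j • 1 else 0 else 0)), ?_,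
        _, ⟨_, hmem, rfl⟩, ?_⟩
      · intro j
        rw [Finset.sum_apply]
        refine sum_mem fun i _ => ?_
        have hz : (gen k r 0 • (if i ≤ q then v i else 0) +
            (if i ≤ q then fun j => if (l j : ℤ) + i = q then c i j • 1 else 0 else 0) :
              Fin s → PenroseAlg k r) j ∈ grading k r (q - i - l j) := by
          by_cases hi : i ≤ q
          · rw [if_pos hi, if_pos hi]
            refine add_mem ?_ ?_
            · have := SetLike.mul_mem_graded (gen_mem k r 0) ((hvc i hi).1 j)
              rwa [show 1 + (N + q - i - (N + 1 + l j)) = (q : ℤ) - i - l j by ring] at this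
            · change (if (l j : ℤ) + i = q then c i j • (1 : PenroseAlg k r) else 0) ∈ _
              split_ifs with h
              · rw [show (q : ℤ) - i - l j = 0 by omega]
                exact Submodule.smul_mem _ _ SetLike.GradedOne.one_mem
              · exact zero_mem _
          · simp [if_neg hi]
        have := SetLike.mul_mem_graded (gen_pow_mem (k := k) (r := r) 1 i) hz
        rwa [show (i : ℤ) + (q - i - l j) = N + ((q + 1 : ℕ) : ℤ) - (N + 1 + l j) by
          push_cast; ring] at this
      · rw [coverLin_sum]
        have hA : ∀ i, gen k r 0 • coverLin k e (if i ≤ q then v i else 0) +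
            coverLin k e (if i ≤ q then fun j => if (l j : ℤ) + i = q then c i j • 1 else 0 else 0)
              = gen k r 0 • (if i ≤ q then m' i else 0) := by
          intro i
          split_ifs with hi
          · rw [coverLin_ite, ← smul_add, (hvc i hi).2]
          · simp
        simp only [hA]
        change theta k r (fun i => if i ≤ q then m' i else 0) +
          gen k r 1 ^ (q + 1) • theta k r (fun i => m' (i + (q + 1))) = _
        rw [smul_theta, ← theta_add]
        refine theta_congr fun i _ => ?_
        by_cases hi : i ≤ q
        · rw [if_pos hi, if_pos (by omega), add_zero]
        · rw [if_neg hi, if_neg (by omega), zero_add, Nat.sub_add_cancel (by omega)]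

/-- The pure power `y ^ (q - l)` is spread over a sum whose only nonzero term is at `i = q - l`, so
that components belonging to generators with different `l` can be added. -/
theorem exists_eq_theta_add_sum {p : ℤ} {b : PenroseAlg k r} {l : ℕ} {q : ℕ}
    (hp : p = q - l) (hb : b ∈ grading k r p) :
    ∃ (c : k) (b' : ℕ → PenroseAlg k r), (∀ i : ℕ, b' i ∈ grading k r (p - 1 - i)) ∧
      b = theta k r b' + ∑ i ∈ Finset.range (r + 1),
        gen k r 1 ^ i • (if (l : ℤ) + i = q then c • (1 : PenroseAlg k r) else 0) := by
  by_cases hlq : l ≤ q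
  · obtain ⟨c, b', hb', h⟩ := exists_eq_theta_add hb
    refine ⟨c, b', hb', ?_⟩
    conv_lhs => rw [h]
    congr 1
    rw [show p.toNat = q - l by omega]
    by_cases hr : q - l < r + 1
    · rw [Finset.sum_eq_single (q - l)]
      · rw [if_pos (by omega), smul_eq_mul, mul_smul_comm, mul_one]
      · intro i _ hi
        rw [if_neg (by omega), smul_zero]
      · intro h
        exact absurd (Finset.mem_range.2 hr) h
    · rw [gen_one_pow_eq_zero k r (by omega), smul_zero, Finset.sum_eq_zero]
      intro i hi
      have := Finset.mem_range.1 hi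
      rw [if_neg (by omega), smul_zero]
  · rw [grading_eq_bot k r (by omega), Submodule.mem_bot] at hb
    refine ⟨0, 0, fun i => zero_mem _, ?_⟩
    simp [hb, theta_eq_zero]

/-- The sum of the free part and `yᵗ K N` is direct, by the same induction. Once both terms are
written as values of `theta`, injectivity separates the indices. For `i ≤ q` the induction
hypothesis at `q - i` kills `V i`, and independence of the `eⱼ` with `l j = q - i` then kills `Z i`;
for `i > q` both vanish for reasons of degree. -/
theorem eq_zero_of_coverLin_add (hK : IsRecursive M K D) (hN : D ≤ N)
    (he : ∀ j, e j ∈ K (N + l j))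
    (he' : ∀ j, e j ∈ powSmul K N (l j))
    (h2 : ∀ q (c : Fin s → k), ∑ j, (if l j = q then c j • e j else 0) = 0 →
        ∀ j, l j = q → c j = 0) (t : ℕ) :
    ∀ v : Fin s → PenroseAlg k r, (∀ j, v j ∈ grading k r (N + t - (N + 1 + l j))) →
      ∀ w ∈ powSmul K N t, coverLin k e v + w = 0 → v = 0 := by
  induction t using Nat.strong_induction_on with
  | _ t ih =>
    intro v hv w hw h0
    cases t with
    | zero =>
      funext j
      have := hv j
      rwa [grading_eq_bot k r (by push_cast; omega), Submodule.mem_bot] at this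
    | succ q =>
      choose c b hb hvb using fun j => exists_eq_theta_add_sum (l := l j) (q := q)
        (by push_cast; ring) (hv j)
      obtain ⟨w₀, hw₀, rfl⟩ := hw
      obtain ⟨w', hw', rfl⟩ := hK.surj N hN w₀ hw₀
      let V : ℕ → Fin s → PenroseAlg k r := fun i j => b j i
      let Z : ℕ → Fin s → PenroseAlg k r := fun i j => if (l j : ℤ) + i = q then c j • 1 else 0
      let W : ℕ → M.carrier := fun i => ∑ j, if (l j : ℤ) + i = q then c j • e j else 0
      have hvV : v = ∑ i ∈ Finset.range (r + 1), gen k r 1 ^ i • (gen k r 0 • V i + Z i) := by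
        funext j
        refine Eq.trans ?_ (congrFun (sum_range_smul_theta V Z).symm j)
        rw [Pi.add_apply, Finset.sum_apply, hvb j]
        congr 1
        rw [theta, theta, Finset.sum_apply]
        rfl
      have hVmem : ∀ (i : ℕ) j, V i j ∈ grading k r (N + q - i - (N + 1 + l j)) := by
        intro i j
        have := hb j i
        rwa [show N + ((q + 1 : ℕ) : ℤ) - (N + 1 + l j) - 1 - i = N + q - i - (N + 1 + l j) by
          push_cast; ring] at this
      have hfv : coverLin k e v = theta k r fun i => coverLin k e (V i) + W i := by
        rw [hvV, coverLin_sum]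
        refine Finset.sum_congr rfl fun i _ => ?_
        rw [coverLin_ite, smul_add (gen k r 0)]
      have hw2 : gen k r 1 ^ (q + 1) • theta k r w' =
          theta k r fun i => if i < q + 1 then 0 else w' (i - (q + 1)) := smul_theta _ _
      change coverLin k e v + gen k r 1 ^ (q + 1) • theta k r w' = 0 at h0
      rw [hfv, hw2, ← theta_add] at h0
      have hall := hK.inj (N + ((q + 1 : ℕ) : ℤ)) (by omega) _ (fun i => ?_) h0
      · have hi0 : ∀ i, i ≤ r → V i = 0 ∧ Z i = 0 := by
          intro i hi
          by_cases hiq : i ≤ q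
          · have h3 := hall i hi
            rw [if_pos (by omega), add_zero] at h3
            have hW : W i = ∑ j, if l j = q - i then c j • e j else 0 := by
              refine Finset.sum_congr rfl fun j _ => ?_
              congr 1
              exact propext (by omega)
            have hWmem : W i ∈ powSmul K N (q - i) := by
              rw [hW]
              refine sum_mem fun j _ => ?_
              split_ifs with h
              · rw [← h]
                exact Submodule.smul_mem _ _ (he' j)
              · exact zero_mem _
            have hV0 : V i = 0 := by
              refine ih (q - i) (by omega) (V i) (fun j => ?_) _ hWmem h3
              rw [show N + ((q - i : ℕ) : ℤ) = N + q - i by omega]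
              exact hVmem i j
            rw [hV0, map_zero, zero_add, hW] at h3
            refine ⟨hV0, funext fun j => ?_⟩
            change (if (l j : ℤ) + i = q then c j • (1 : PenroseAlg k r) else 0) = 0
            split_ifs with h
            · rw [h2 _ c h3 j (by omega), zero_smul]
            · rfl
          · refine ⟨funext fun j => ?_, funext fun j => if_neg (by omega)⟩
            have := hVmem i j
            rwa [grading_eq_bot k r (by omega), Submodule.mem_bot] at this
        rw [hvV]
        refine Finset.sum_eq_zero fun i hi => ?_
        obtain ⟨h4, h5⟩ := hi0 i (Nat.lt_succ_iff.1 (Finset.mem_range.1 hi))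
        rw [h4, h5, smul_zero, add_zero, smul_zero]
      · rw [show N + ((q + 1 : ℕ) : ℤ) - 1 - i = N + q - i by push_cast; ring]
        refine add_mem (add_mem (coverLin_mem hK he (hVmem i)) (sum_mem fun j _ => ?_)) ?_
        · split_ifs with h
          · rw [show N + q - i = N + l j by omega]
            exact Submodule.smul_mem _ _ (he j)
          · exact zero_mem _
        · split_ifs with h
          · exact zero_mem _
          · have := hw' (i - (q + 1))
            rwa [show N - 1 - ((i - (q + 1) : ℕ) : ℤ) = N + q - i by omega] at this

end Cover

/-- A recursive family is covered, in large degrees, by a graded free module whose generators have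
degrees `N + 1, …, N + 1 + r`, for each large `N`. -/
theorem IsRecursive.exists_cover (hK : IsRecursive M K D) {N : ℤ} (hN : D ≤ N) :
    ∃ (s : ℕ) (l : Fin s → ℕ) (f : GrMod.free (grading k r) (coverDeg N l) ⟶ M),
      (∀ j, l j ≤ r) ∧
      (∀ n, ∀ v ∈ (GrMod.free (grading k r) (coverDeg N l)).deg n, f.toLin v ∈ K n) ∧
      ∀ n, N + r + 1 ≤ n →
        (∀ v ∈ (GrMod.free (grading k r) (coverDeg N l)).deg n, f.toLin v = 0 → v = 0) ∧
        ∀ m ∈ K n, ∃ v ∈ (GrMod.free (grading k r) (coverDeg N l)).deg n, f.toLin v = m := by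
  have hbot : ∀ q, r < q → powSmul K N q = ⊥ := by
    intro q hq
    rw [eq_bot_iff]
    rintro _ ⟨m, -, rfl⟩
    change gen k r 1 ^ q • m = 0
    rw [gen_one_pow_eq_zero k r hq, zero_smul]
  obtain ⟨s, l, e, hl, he, h1, h2⟩ := exists_graded_basis r (powSmul K N)
    (fun q => (hK.fg N).map _) hbot
  have he' : ∀ j, e j ∈ K (N + l j) := fun j => mem_of_mem_powSmul hK (he j)
  have hdeg : ∀ (n : ℤ) (v : Fin s → PenroseAlg k r),
      v ∈ (GrMod.free (grading k r) (coverDeg N l)).deg n ↔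
        ∀ j, v j ∈ grading k r (n - (N + 1 + l j)) := by
    intro n v
    refine ⟨fun h j => ?_, fun h j _ => ?_⟩
    · have := h j trivial
      rwa [show n - (N + 1 + l j) = coverDeg N l j + n by simp only [coverDeg]; ring]
    · have := h j
      rwa [show n - (N + 1 + l j) = coverDeg N l j + n by simp only [coverDeg]; ring] at this
  refine ⟨s, l, coverMap hK he', hl, fun n v hv => ?_, fun n hn => ⟨fun v hv h0 => ?_,
    fun m hm => ?_⟩⟩
  · exact coverLin_mem hK he' ((hdeg n v).1 hv)
  · obtain ⟨t, rfl⟩ : ∃ t : ℕ, n = N + t := ⟨(n - N).toNat, by omega⟩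
    exact eq_zero_of_coverLin_add hK hN he' he h2 t v ((hdeg _ v).1 hv) 0 (zero_mem _)
      ((add_zero _).trans h0)
  · obtain ⟨t, rfl⟩ : ∃ t : ℕ, n = N + t := ⟨(n - N).toNat, by omega⟩
    obtain ⟨v, hv, w, hw, h⟩ := exists_coverLin_add (e := e) hK hN h1 t m hm
    rw [hbot t (by omega), Submodule.mem_bot] at hw
    rw [hw, add_zero] at h
    exact ⟨v, (hdeg _ v).2 hv, h⟩

end PenroseAlg

/-! ## Exactness in the quotient category -/

section Splitting

variable {C : Type*} [Category C] (hz : HasZeroMorphisms C) [Preadditive C] [HasZeroObject C]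

/-- `hz` is kept apart from the preadditive structure because on `qgr` the zero morphisms come from
the zero object and the addition from the calculus of fractions; the two notions of zero agree by
uniqueness. -/
theorem K0.of_eq_add_of_splitting {X Y Z : C} (f : X ⟶ Y) (g : Y ⟶ Z) (ρ : Y ⟶ X) (σ : Z ⟶ Y)
    (hf : f ≫ ρ = 𝟙 X) (hg : σ ≫ g = 𝟙 Z) (hid : ρ ≫ f + g ≫ σ = 𝟙 Y) :
    K0.of Y = K0.of X + K0.of Z := by
  obtain rfl : hz = Preadditive.preadditiveHasZeroMorphisms := Subsingleton.elim _ _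
  have h1 : f ≫ g ≫ σ = 0 := by
    have h := congrArg (f ≫ ·) hid
    simpa [Preadditive.comp_add, reassoc_of% hf] using h
  have hfg : f ≫ g = 0 := by
    have h := congrArg (· ≫ g) h1
    simpa [hg] using h
  let S := ShortComplex.mk f g hfg
  let s : S.Splitting := ⟨ρ, σ, hf, hg, hid⟩
  have h : FreeAbelianGroup.of Y - FreeAbelianGroup.of X - FreeAbelianGroup.of Z ∈
      K0.relations C := AddSubgroup.subset_closure ⟨S, s.shortExact, rfl⟩
  have h2 := (QuotientAddGroup.eq_zero_iff _).2 h
  rw [QuotientAddGroup.mk_sub, QuotientAddGroup.mk_sub, sub_sub, sub_eq_zero] at h2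
  exact h2

theorem K0.of_eq_of_iso {X Y : C} (e : X ≅ Y) : K0.of X = K0.of Y := by
  obtain rfl : hz = Preadditive.preadditiveHasZeroMorphisms := Subsingleton.elim _ _
  obtain ⟨Z, hZ⟩ := HasZeroObject.zero (C := C)
  have h0 := K0.of_eq_add_of_splitting Preadditive.preadditiveHasZeroMorphisms
    (0 : Z ⟶ Z) (0 : Z ⟶ Z) 0 0 (hZ.eq_of_src _ _) (hZ.eq_of_src _ _) (hZ.eq_of_src _ _)
  have h1 := K0.of_eq_add_of_splitting Preadditive.preadditiveHasZeroMorphisms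
    e.hom (0 : Y ⟶ Z) e.inv 0 e.hom_inv_id (hZ.eq_of_src _ _) (by simp)
  have h0' : K0.of Z = 0 := by simpa using h0
  rw [h1, h0', add_zero]

end Splitting

/-! ### The quotient functor and classes of direct sums. -/

section Localization

variable {k : Type u} [Field k] {A : Type u} [Ring A] [Algebra k A] {𝒜 : ℤ → Submodule k A}

theorem quotientFunctor_map_zero (X Y : FpGrMod 𝒜) : (quotientFunctor 𝒜).map (0 : X ⟶ Y) = 0 := by
  have hZ := FpGrMod.isZero_zero 𝒜
  have h : (0 : X ⟶ Y) = (0 : X ⟶ FpGrMod.zero 𝒜) ≫ (0 : FpGrMod.zero 𝒜 ⟶ Y) := by simp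
  rw [h, Functor.map_comp, (isZero_Q_obj (finDimIso 𝒜) hZ).eq_zero_of_tgt
    ((finDimIso 𝒜).Q.map (0 : X ⟶ FpGrMod.zero 𝒜)), zero_comp]

theorem exists_quotientFunctor_obj (X : Qgr 𝒜) : ∃ X' : FpGrMod 𝒜, (quotientFunctor 𝒜).obj X' = X :=
  (Localization.Construction.objEquiv (finDimIso 𝒜)).surjective X

theorem isIso_quotientFunctor_map {X Y : FpGrMod 𝒜} (f : X ⟶ Y) (hf : finDimIso 𝒜 f) :
    IsIso ((quotientFunctor 𝒜).map f) :=
  Localization.inverts (quotientFunctor 𝒜) (finDimIso 𝒜) f hf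

/-- A left fraction: up to an isomorphism of the target, every morphism of `qgr` is the image of a
morphism of modules. -/
theorem exists_comp_eq_map {X Y : FpGrMod 𝒜}
    (φ : (quotientFunctor 𝒜).obj X ⟶ (quotientFunctor 𝒜).obj Y) :
    ∃ (Y' : FpGrMod 𝒜) (f : X ⟶ Y') (s : Y ⟶ Y'), finDimIso 𝒜 s ∧
      φ ≫ (quotientFunctor 𝒜).map s = (quotientFunctor 𝒜).map f := by
  have := finDimIso_hasLeftCalculusOfFractions (𝒜 := 𝒜)
  obtain ⟨z, rfl⟩ := Localization.exists_leftFraction (quotientFunctor 𝒜) (finDimIso 𝒜) φ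
  exact ⟨_, z.f, z.s, z.hs, z.map_comp_map_s _ _⟩

theorem hasZeroObject_fpGrMod : HasZeroObject (FpGrMod 𝒜) := ⟨_, FpGrMod.isZero_zero 𝒜⟩

theorem K0.of_eq_add_of_splitting_fp {X Y Z : FpGrMod 𝒜} (f : X ⟶ Y) (g : Y ⟶ Z) (ρ : Y ⟶ X)
    (σ : Z ⟶ Y) (hf : f ≫ ρ = 𝟙 X) (hg : σ ≫ g = 𝟙 Z) (hid : ρ ≫ f + g ≫ σ = 𝟙 Y) :
    K0.of ((quotientFunctor 𝒜).obj Y) =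
      K0.of ((quotientFunctor 𝒜).obj X) + K0.of ((quotientFunctor 𝒜).obj Z) := by
  have := finDimIso_hasLeftCalculusOfFractions (𝒜 := 𝒜)
  have := hasZeroObject_fpGrMod (𝒜 := 𝒜)
  let : Preadditive (Qgr 𝒜) := Localization.instPreadditiveLocalization (finDimIso 𝒜)
  refine K0.of_eq_add_of_splitting _ ((quotientFunctor 𝒜).map f) ((quotientFunctor 𝒜).map g)
    ((quotientFunctor 𝒜).map ρ) ((quotientFunctor 𝒜).map σ) ?_ ?_ ?_
  · rw [← Functor.map_comp, hf, CategoryTheory.Functor.map_id]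
  · rw [← Functor.map_comp, hg, CategoryTheory.Functor.map_id]
  · rw [← Functor.map_comp, ← Functor.map_comp, ← Functor.map_add, hid, CategoryTheory.Functor.map_id]

theorem K0.of_eq_of_iso_fp {X Y : FpGrMod 𝒜}
    (e : (quotientFunctor 𝒜).obj X ≅ (quotientFunctor 𝒜).obj Y) :
    K0.of ((quotientFunctor 𝒜).obj X) = K0.of ((quotientFunctor 𝒜).obj Y) := by
  have := finDimIso_hasLeftCalculusOfFractions (𝒜 := 𝒜)
  have := hasZeroObject_fpGrMod (𝒜 := 𝒜)
  let : Preadditive (Qgr 𝒜) := Localization.instPreadditiveLocalization (finDimIso 𝒜)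
  exact K0.of_eq_of_iso _ e

theorem K0.of_zero_fp : K0.of ((quotientFunctor 𝒜).obj (FpGrMod.zero 𝒜)) = 0 := by
  have hZ := FpGrMod.isZero_zero 𝒜
  have h := K0.of_eq_add_of_splitting_fp (0 : FpGrMod.zero 𝒜 ⟶ FpGrMod.zero 𝒜)
    (0 : FpGrMod.zero 𝒜 ⟶ FpGrMod.zero 𝒜) 0 0 (hZ.eq_of_src _ _) (hZ.eq_of_src _ _)
    (hZ.eq_of_src _ _)
  simpa using h

theorem K0.of_prod (X Y : FpGrMod 𝒜) : K0.of ((quotientFunctor 𝒜).obj (FpGrMod.prod X Y)) =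
    K0.of ((quotientFunctor 𝒜).obj X) + K0.of ((quotientFunctor 𝒜).obj Y) :=
  K0.of_eq_add_of_splitting_fp
    (ObjectProperty.homMk ⟨LinearMap.inl A _ _, fun i m hm => ⟨hm, zero_mem _⟩⟩ :
      X ⟶ FpGrMod.prod X Y)
    (ObjectProperty.homMk ⟨LinearMap.snd A _ _, fun i m hm => hm.2⟩ : FpGrMod.prod X Y ⟶ Y)
    (ObjectProperty.homMk ⟨LinearMap.fst A _ _, fun i m hm => hm.1⟩)
    (ObjectProperty.homMk ⟨LinearMap.inr A _ _, fun i m hm => ⟨zero_mem _, hm⟩⟩)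
    (by ext m; rfl) (by ext m; rfl)
    (by
      ext m
      exact Prod.ext (add_zero _) (zero_add _))

variable [GradedAlgebra 𝒜]

variable (𝒜) in
/-- The shifted module `A(n)` as a finitely presented graded module. -/
def FpGrMod.shiftSelf (n : ℤ) : FpGrMod 𝒜 where
  obj := (GrMod.self 𝒜).shift n
  property := inferInstanceAs (Module.FinitePresentation A A)

section Free

variable {s : ℕ} (n : Fin (s + 1) → ℤ)

/-- The inclusion of the first summand of a graded free module. -/
def GrMod.freeSingle : (GrMod.self 𝒜).shift (n 0) ⟶ GrMod.free 𝒜 n where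
  toLin := LinearMap.single A (fun _ => A) 0
  map_deg i := by
    intro (m : A) hm j _
    have hm' : m ∈ 𝒜 (n 0 + i) := hm
    change (Pi.single 0 m : Fin (s + 1) → A) j ∈ 𝒜 (n j + i)
    by_cases h : j = 0
    · subst h
      rwa [Pi.single_eq_same]
    · rw [Pi.single_eq_of_ne h]
      exact zero_mem _

/-- The projection from a graded free module to the summands other than the first one. -/
def GrMod.freeTail : GrMod.free 𝒜 n ⟶ GrMod.free 𝒜 (fun j : Fin s => n j.succ) where
  toLin := LinearMap.funLeft A A Fin.succ
  map_deg _ _ hm j _ := hm j.succ trivial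

/-- The projection from a graded free module to the first summand. -/
def GrMod.freeHead : GrMod.free 𝒜 n ⟶ (GrMod.self 𝒜).shift (n 0) where
  toLin := LinearMap.proj (R := A) (φ := fun _ : Fin (s + 1) => A) 0
  map_deg _ _ hm := hm 0 trivial

/-- The inclusion of the summands of a graded free module other than the first one. -/
def GrMod.freeCons : GrMod.free 𝒜 (fun j : Fin s => n j.succ) ⟶ GrMod.free 𝒜 n where
  toLin :=
    { toFun := fun v : Fin s → A => (Fin.cons 0 v : Fin (s + 1) → A)
      map_add' := fun v w => funext fun j => Fin.cases (add_zero (0 : A)).symm (fun _ => rfl) j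
      map_smul' := fun c v => funext fun j => Fin.cases (mul_zero c).symm (fun _ => rfl) j }
  map_deg i v hv j _ := by
    have hv' : ∀ j : Fin s, (v : Fin s → A) j ∈ 𝒜 (n j.succ + i) := fun j => hv j trivial
    change (Fin.cons 0 v : Fin (s + 1) → A) j ∈ 𝒜 (n j + i)
    induction j using Fin.cases with
    | zero => exact zero_mem _
    | succ j => exact hv' j

theorem K0.of_free_succ : K0.of ((quotientFunctor 𝒜).obj (FpGrMod.free 𝒜 n)) =
    K0.of ((quotientFunctor 𝒜).obj (FpGrMod.shiftSelf 𝒜 (n 0))) +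
      K0.of ((quotientFunctor 𝒜).obj (FpGrMod.free 𝒜 fun j : Fin s => n j.succ)) := by
  refine K0.of_eq_add_of_splitting_fp
    (ObjectProperty.homMk (GrMod.freeSingle n) : FpGrMod.shiftSelf 𝒜 (n 0) ⟶ FpGrMod.free 𝒜 n)
    (ObjectProperty.homMk (GrMod.freeTail n) :
      FpGrMod.free 𝒜 n ⟶ FpGrMod.free 𝒜 fun j : Fin s => n j.succ)
    (ObjectProperty.homMk (GrMod.freeHead n)) (ObjectProperty.homMk (GrMod.freeCons n)) ?_ ?_ ?_
  · apply FpGrMod.hom_ext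
    intro (m : A)
    exact Pi.single_eq_same (M := fun _ : Fin (s + 1) => A) 0 m
  · apply FpGrMod.hom_ext
    intro m
    rfl
  · apply FpGrMod.hom_ext
    intro (m : Fin (s + 1) → A)
    change (Pi.single 0 (m 0) : Fin (s + 1) → A) + (Fin.cons 0 fun j => m j.succ) = m
    funext j
    rw [Pi.add_apply]
    induction j using Fin.cases with
    | zero => simp
    | succ j => simp

end Free

theorem K0.of_free {s : ℕ} (n : Fin s → ℤ) :
    K0.of ((quotientFunctor 𝒜).obj (FpGrMod.free 𝒜 n)) =
      ∑ j, K0.of ((quotientFunctor 𝒜).obj (FpGrMod.shiftSelf 𝒜 (n j))) := by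
  induction s with
  | zero =>
    rw [Finset.univ_eq_empty, Finset.sum_empty, ← K0.of_zero_fp (𝒜 := 𝒜)]
    refine K0.of_eq_of_iso_fp ((quotientFunctor 𝒜).mapIso ?_)
    refine IsZero.iso ?_ (FpGrMod.isZero_zero 𝒜)
    rw [IsZero.iff_id_eq_zero]
    apply FpGrMod.hom_ext
    intro m
    exact Subsingleton.elim (α := Fin 0 → A) _ _
  | succ s ih => rw [Fin.sum_univ_succ, ← ih fun j : Fin s => n j.succ, K0.of_free_succ]

end Localization

namespace PenroseAlg

variable {k : Type u} [Field k] {r : ℕ}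

/-! ### Monomorphisms, epimorphisms and exactness in large degrees. -/

section Eventual

variable {X Y Z : FpGrMod (grading k r)}

theorem eventually_eq_of_quotientFunctor_map_eq {f g : X ⟶ Y}
    (h : (quotientFunctor (grading k r)).map f = (quotientFunctor (grading k r)).map g) :
    ∃ D : ℤ, ∀ n, D ≤ n → ∀ m ∈ X.obj.deg n, f.hom.toLin m = g.hom.toLin m := by
  have := finDimIso_hasLeftCalculusOfFractions (𝒜 := grading k r)
  obtain ⟨T, s, hs, h⟩ :=
    (MorphismProperty.map_eq_iff_postcomp (quotientFunctor _) (finDimIso (grading k r)) f g).1 h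
  obtain ⟨D, hD⟩ := exists_injective_of_finDimIso hs
  refine ⟨D, fun n hn m hm => ?_⟩
  have h1 : s.hom.toLin (f.hom.toLin m) = s.hom.toLin (g.hom.toLin m) :=
    congrArg (fun a : X ⟶ T => a.hom.toLin m) h
  rw [← sub_eq_zero]
  refine hD n hn _ (sub_mem (f.hom.map_deg _ _ hm) (g.hom.map_deg _ _ hm)) ?_
  rw [map_sub, h1, sub_self]

theorem eventually_eq_zero_of_quotientFunctor_map_eq_zero {f : X ⟶ Y}
    (h : (quotientFunctor (grading k r)).map f = 0) :
    ∃ D : ℤ, ∀ n, D ≤ n → ∀ m ∈ X.obj.deg n, f.hom.toLin m = 0 :=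
  eventually_eq_of_quotientFunctor_map_eq (h.trans (quotientFunctor_map_zero X Y).symm)

/-- A morphism that has trivial cokernel in the quotient category is surjective in large
degrees. -/
theorem eventually_surjective {f : X ⟶ Y}
    (h : ∀ (T : FpGrMod (grading k r))
      (z : (quotientFunctor (grading k r)).obj Y ⟶ (quotientFunctor (grading k r)).obj T),
      (quotientFunctor (grading k r)).map f ≫ z = 0 → z = 0) :
    ∃ D : ℤ, ∀ n, D ≤ n → ∀ m ∈ Y.obj.deg n, ∃ x ∈ X.obj.deg n, f.hom.toLin x = m := by
  obtain ⟨D, hD⟩ := eventually_eq_zero_of_quotientFunctor_map_eq_zero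
    (h _ ((quotientFunctor (grading k r)).map (FpGrMod.cokerπ f)) (by
      have h0 : f ≫ FpGrMod.cokerπ f = 0 := ObjectProperty.hom_ext _ (GrMod.comp_cokerπ f.hom)
      rw [← Functor.map_comp, h0, quotientFunctor_map_zero]))
  refine ⟨D, fun n hn m hm => ?_⟩
  obtain ⟨x, hx⟩ := (GrMod.cokerπ_eq_zero_iff f.hom m).1 (hD n hn m hm)
  refine ⟨X.obj.proj n x, X.obj.proj_mem n x, ?_⟩
  rw [← GrMod.proj_map, hx, Y.obj.proj_of_mem hm]

/-- A finitely presented substitute for the kernel, correct in large degrees, so that kernels can be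
tested by morphisms of `gr B`. -/
theorem exists_kernel_cover (f : X ⟶ Y) : ∃ (P : FpGrMod (grading k r)) (h : P ⟶ X),
    h ≫ f = 0 ∧ ∃ D : ℤ, ∀ n, D ≤ n → ∀ m ∈ X.obj.deg n, f.hom.toLin m = 0 →
      ∃ p ∈ P.obj.deg n, h.hom.toLin p = m := by
  obtain ⟨D, hK⟩ := exists_isRecursive_ker f
  obtain ⟨s, l, h, -, h1, h2⟩ := hK.exists_cover le_rfl
  refine ⟨FpGrMod.free (grading k r) (coverDeg D l), ObjectProperty.homMk h, ?_, D + r + 1,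
    fun n hn m hm h0 => (h2 n hn).2 m ⟨hm, h0⟩⟩
  apply FpGrMod.hom_ext
  intro (m : (GrMod.free (grading k r) (coverDeg D l)).carrier)
  change f.hom.toLin (h.toLin m) = 0
  induction m using GrMod.induction_hom with
  | hom i m hm => exact (h1 i m hm).2
  | zero => rw [map_zero, map_zero]
  | add m m' h h' => rw [map_add, map_add, h, h', add_zero]

theorem eventually_injective (f : X ⟶ Y) [Mono ((quotientFunctor (grading k r)).map f)] :
    ∃ D : ℤ, ∀ n, D ≤ n → ∀ m ∈ X.obj.deg n, f.hom.toLin m = 0 → m = 0 := by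
  obtain ⟨P, h, hf, D₁, h1⟩ := exists_kernel_cover f
  obtain ⟨D₂, h2⟩ := eventually_eq_zero_of_quotientFunctor_map_eq_zero (f := h) (by
    rw [← cancel_mono ((quotientFunctor (grading k r)).map f), ← Functor.map_comp, hf,
      quotientFunctor_map_zero, zero_comp])
  refine ⟨max D₁ D₂, fun n hn m hm h0 => ?_⟩
  obtain ⟨p, hp, rfl⟩ := h1 n (by omega) m hm h0
  exact h2 n (by omega) p hp

/-- The kernel cover `h : P ⟶ Y` of `g` factors in `qgr` through the kernel `K` of the image of `g`,
and by exactness a morphism out of `K` that vanishes on `X` is zero. After `K` and `Y` are replaced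
by isomorphic objects, all maps come from modules and `X ⟶ K₂` is surjective in large degrees. An
element `h p` of the kernel of `g` then has the same image in `Y'` as some `f x`, and `s : Y ⟶ Y'`
is injective in large degrees. -/
theorem eventually_exact {f : X ⟶ Y} {g : Y ⟶ Z}
    {w : (quotientFunctor (grading k r)).map f ≫ (quotientFunctor (grading k r)).map g = 0}
    (hS : (ShortComplex.mk _ _ w).Exact) :
    ∃ D : ℤ, ∀ n, D ≤ n → ∀ m ∈ Y.obj.deg n, g.hom.toLin m = 0 →
      ∃ x ∈ X.obj.deg n, f.hom.toLin x = m := by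
  let Q := quotientFunctor (grading k r)
  obtain ⟨P, h, hg, D₁, hD₁⟩ := exists_kernel_cover g
  obtain ⟨hd, hH⟩ := hS.condition
  obtain ⟨K, i, f', ℓ, hf', hℓ, hz⟩ : ∃ (K : FpGrMod (grading k r)) (i : Q.obj K ⟶ Q.obj Y)
      (f' : Q.obj X ⟶ Q.obj K) (ℓ : Q.obj P ⟶ Q.obj K), f' ≫ i = Q.map f ∧ ℓ ≫ i = Q.map h ∧
      ∀ (T : FpGrMod (grading k r)) (z : Q.obj K ⟶ Q.obj T), f' ≫ z = 0 → z = 0 := by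
    obtain ⟨K, hK⟩ := exists_quotientFunctor_obj hd.left.K
    refine ⟨K, eqToHom hK ≫ hd.left.i, hd.left.f' ≫ eqToHom hK.symm,
      hd.left.liftK (Q.map h) ?_ ≫ eqToHom hK.symm, ?_, ?_, fun T z h0 => ?_⟩
    · change Q.map h ≫ Q.map g = 0
      rw [← Functor.map_comp, hg]
      exact quotientFunctor_map_zero _ _
    · simp only [Category.assoc, eqToHom_trans_assoc, eqToHom_refl, Category.id_comp]
      exact hd.left.f'_i
    · simp
    · rw [Category.assoc] at h0
      -- A morphism vanishing on `X` factors through the homology, which is zero.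
      have h1 := hd.left.π_descH (eqToHom hK.symm ≫ z) h0
      rw [hH.eq_zero_of_src (hd.left.descH _ _), comp_zero] at h1
      have h2 := congrArg (eqToHom hK ≫ ·) h1
      simpa using h2.symm
  -- Two successive replacements of `K`, so that the morphisms from `P` and from `X` both come from
  -- modules with the same target `K₂`.
  obtain ⟨K₁, ℓ₁, t, ht, e₁⟩ := exists_comp_eq_map ℓ
  obtain ⟨K₂, f₂, t', ht', e₂⟩ := exists_comp_eq_map (f' ≫ Q.map t)
  have := isIso_quotientFunctor_map t ht
  have := isIso_quotientFunctor_map t' ht'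
  obtain ⟨Y', i', s, hs, e₃⟩ := exists_comp_eq_map (inv (Q.map t') ≫ inv (Q.map t) ≫ i)
  have hf₂ : Q.map (f₂ ≫ i') = Q.map (f ≫ s) := by
    rw [Functor.map_comp, Functor.map_comp, ← e₂, ← e₃, ← hf']
    simp [Q]
  have hℓ₂ : Q.map ((ℓ₁ ≫ t') ≫ i') = Q.map (h ≫ s) := by
    rw [Functor.map_comp, Functor.map_comp, Functor.map_comp, ← e₁, ← e₃, ← hℓ]
    simp [Q]
  obtain ⟨D₂, hD₂⟩ := eventually_eq_of_quotientFunctor_map_eq hf₂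
  obtain ⟨D₃, hD₃⟩ := eventually_eq_of_quotientFunctor_map_eq hℓ₂
  obtain ⟨D₄, hD₄⟩ := eventually_surjective (f := f₂) fun T z h0 => by
    rw [← e₂, Category.assoc, Category.assoc] at h0
    have h1 := hz T _ h0
    have h2 := congrArg (fun a => inv (Q.map t') ≫ inv (Q.map t) ≫ a) h1
    simpa [Q] using h2
  obtain ⟨D₅, hD₅⟩ := exists_injective_of_finDimIso hs
  refine ⟨max (max (max D₁ D₂) (max D₃ D₄)) D₅, fun n hn m hm h0 => ?_⟩
  obtain ⟨p, hp, rfl⟩ := hD₁ n (by omega) m hm h0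
  obtain ⟨x, hx, hxp⟩ := hD₄ n (by omega) _ ((ℓ₁ ≫ t').hom.map_deg n p hp)
  refine ⟨x, hx, ?_⟩
  rw [← sub_eq_zero]
  refine hD₅ n (by omega) _ (sub_mem (f.hom.map_deg _ _ hx) hm) ?_
  rw [map_sub, sub_eq_zero]
  have h1 : i'.hom.toLin (f₂.hom.toLin x) = s.hom.toLin (f.hom.toLin x) := hD₂ n (by omega) x hx
  have h2 : i'.hom.toLin ((ℓ₁ ≫ t').hom.toLin p) = s.hom.toLin (h.hom.toLin p) :=
    hD₃ n (by omega) p hp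
  rw [← h1, ← h2, hxp]

end Eventual

/-! ### Additivity of dimensions in large degrees. -/

section Dimension

/-- The dimension of a homogeneous component of a finitely presented graded module. -/
noncomputable def dim (X : FpGrMod (grading k r)) (n : ℤ) : ℕ := Module.finrank k (X.obj.deg n)

variable {X Y Z : FpGrMod (grading k r)}

theorem finiteDimensional_deg (X : FpGrMod (grading k r)) (n : ℤ) :
    FiniteDimensional k (X.obj.deg n) := Module.Finite.of_fg (deg_fg n)

theorem dim_eq_of_finDimIso {f : X ⟶ Y} (hf : finDimIso (grading k r) f) :
    ∃ D : ℤ, ∀ n, D ≤ n → dim X n = dim Y n := by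
  obtain ⟨D₁, h1⟩ := exists_injective_of_finDimIso hf
  obtain ⟨D₂, h2⟩ := exists_surjective_of_finDimIso hf
  refine ⟨max D₁ D₂, fun n hn => LinearEquiv.finrank_eq (LinearEquiv.ofBijective
    ((GrMod.kLin f.hom).restrict (f.hom.map_deg n)) ⟨?_, ?_⟩)⟩
  · rw [injective_iff_map_eq_zero]
    exact fun m hm => Subtype.ext (h1 n (by omega) m m.2 (congrArg Subtype.val hm))
  · intro m
    obtain ⟨x, hx, h⟩ := h2 n (by omega) m m.2
    exact ⟨⟨x, hx⟩, Subtype.ext h⟩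

theorem dim_add_of_exact {f : X ⟶ Y} {g : Y ⟶ Z} {n : ℤ}
    (hf : ∀ m ∈ X.obj.deg n, f.hom.toLin m = 0 → m = 0)
    (hfg : ∀ m ∈ X.obj.deg n, g.hom.toLin (f.hom.toLin m) = 0)
    (hex : ∀ m ∈ Y.obj.deg n, g.hom.toLin m = 0 → ∃ x ∈ X.obj.deg n, f.hom.toLin x = m)
    (hg : ∀ m ∈ Z.obj.deg n, ∃ y ∈ Y.obj.deg n, g.hom.toLin y = m) :
    dim Y n = dim X n + dim Z n := by
  have := finiteDimensional_deg Y n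
  let F : X.obj.deg n →ₗ[k] Y.obj.deg n := (GrMod.kLin f.hom).restrict (f.hom.map_deg n)
  let G : Y.obj.deg n →ₗ[k] Z.obj.deg n := (GrMod.kLin g.hom).restrict (g.hom.map_deg n)
  have hF : Function.Injective F := by
    rw [injective_iff_map_eq_zero]
    exact fun m hm => Subtype.ext (hf m m.2 (congrArg Subtype.val hm))
  have hG : LinearMap.range G = ⊤ := by
    rw [LinearMap.range_eq_top]
    intro m
    obtain ⟨x, hx, h⟩ := hg m m.2
    exact ⟨⟨x, hx⟩, Subtype.ext h⟩
  have hFG : LinearMap.ker G = LinearMap.range F := by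
    ext m
    constructor
    · intro hm
      obtain ⟨x, hx, h⟩ := hex m m.2 (congrArg Subtype.val hm)
      exact ⟨⟨x, hx⟩, Subtype.ext h⟩
    · rintro ⟨x, rfl⟩
      exact Subtype.ext (hfg x x.2)
  have h := G.finrank_range_add_finrank_ker
  rw [hG, hFG, finrank_top, LinearMap.finrank_range_of_inj hF, add_comm] at h
  exact h.symm

theorem dim_add_of_shortExact_map {f : X ⟶ Y} {g : Y ⟶ Z}
    {w : (quotientFunctor (grading k r)).map f ≫ (quotientFunctor (grading k r)).map g = 0}
    (hS : (ShortComplex.mk _ _ w).ShortExact) :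
    ∃ D : ℤ, ∀ n, D ≤ n → dim Y n = dim X n + dim Z n := by
  have hm : Mono ((quotientFunctor (grading k r)).map f) := hS.mono_f
  have he : Epi ((quotientFunctor (grading k r)).map g) := hS.epi_g
  obtain ⟨D₁, h1⟩ := eventually_injective f
  obtain ⟨D₂, h2⟩ := eventually_eq_zero_of_quotientFunctor_map_eq_zero (f := f ≫ g)
    ((Functor.map_comp _ _ _).trans w)
  obtain ⟨D₃, h3⟩ := eventually_exact hS.exact
  obtain ⟨D₄, h4⟩ := eventually_surjective (f := g) fun T z hz => by
    rwa [← cancel_epi ((quotientFunctor (grading k r)).map g), comp_zero]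
  exact ⟨max (max D₁ D₂) (max D₃ D₄), fun n hn => dim_add_of_exact (h1 n (by omega))
    (h2 n (by omega)) (h3 n (by omega)) (h4 n (by omega))⟩

/-- Replacing `Y` and `Z` by objects isomorphic in `qgr` makes both morphisms images of module maps;
the dimensions in large degrees do not change. -/
theorem dim_add_of_shortExact {S : ShortComplex (Qgr (grading k r))} (hS : S.ShortExact)
    (h₁ : (quotientFunctor (grading k r)).obj X = S.X₁)
    (h₂ : (quotientFunctor (grading k r)).obj Y = S.X₂)
    (h₃ : (quotientFunctor (grading k r)).obj Z = S.X₃) :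
    ∃ D : ℤ, ∀ n, D ≤ n → dim Y n = dim X n + dim Z n := by
  obtain ⟨f, g, w⟩ := S
  dsimp only at h₁ h₂ h₃
  subst h₁ h₂ h₃
  obtain ⟨Y', f', s, hs, e₁⟩ := exists_comp_eq_map f
  have := isIso_quotientFunctor_map s hs
  obtain ⟨Z', g', t, ht, e₂⟩ :=
    exists_comp_eq_map (inv ((quotientFunctor (grading k r)).map s) ≫ g)
  have := isIso_quotientFunctor_map t ht
  have w' : (quotientFunctor (grading k r)).map f' ≫ (quotientFunctor (grading k r)).map g' = 0 := by
    rw [← e₁, ← e₂]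
    simp [reassoc_of% w]
  let e : ShortComplex.mk f g w ≅ ShortComplex.mk _ _ w' := by
    refine ShortComplex.isoMk (Iso.refl _) (asIso ((quotientFunctor (grading k r)).map s))
      (asIso ((quotientFunctor (grading k r)).map t)) ?_ ?_
    · simp [e₁]
    · simp [← e₂]
  have hS' := ShortComplex.shortExact_of_iso e hS
  obtain ⟨D₁, h1⟩ := dim_add_of_shortExact_map hS'
  obtain ⟨D₂, h2⟩ := dim_eq_of_finDimIso hs
  obtain ⟨D₃, h3⟩ := dim_eq_of_finDimIso ht
  exact ⟨max D₁ (max D₂ D₃), fun n hn => by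
    rw [h2 n (by omega), h3 n (by omega), h1 n (by omega)]⟩

end Dimension

end PenroseAlg

namespace PenroseAlg

variable {k : Type u} [Field k] {r : ℕ} {X Y Z : FpGrMod (grading k r)}

/-! ## The rank of an object -/

theorem dim_eq_sum_of_isRecursive {D : ℤ} (hX : IsRecursive X.obj X.obj.deg D) {n : ℤ}
    (hn : D ≤ n) : dim X n = ∑ i ∈ Finset.range (r + 1), dim X (n - 1 - i) := by
  have := finiteDimensional_deg X
  -- `theta` takes sequences indexed by `ℕ`, so tuples are extended by `0`; restricted to these, it
  -- becomes the linear isomorphism whose dimensions are compared.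
  let ext : (∀ i : Fin (r + 1), X.obj.deg (n - 1 - (i : ℕ))) → ℕ → X.obj.carrier :=
    fun v i => if h : i < r + 1 then v ⟨i, h⟩ else 0
  have ext_mem : ∀ v (i : ℕ), ext v i ∈ X.obj.deg (n - 1 - i) := by
    intro v i
    by_cases h : i < r + 1
    · simp only [ext, dif_pos h]
      exact (v ⟨i, h⟩).2
    · simp only [ext, dif_neg h]
      exact zero_mem _
  have ext_fin : ∀ v (i : Fin (r + 1)), ext v i = v i := fun v i => dif_pos i.2
  let L : (∀ i : Fin (r + 1), X.obj.deg (n - 1 - (i : ℕ))) →ₗ[k] X.obj.deg n :=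
    LinearMap.codRestrict (X.obj.deg n)
      (thetaLin k r X.obj.carrier ∘ₗ
        LinearMap.pi fun i => (X.obj.deg (n - 1 - (i : ℕ))).subtype ∘ₗ LinearMap.proj i)
      (fun v => by
        have h := theta_mem (ext_mem v)
        rw [← thetaLin_apply] at h
        simp only [ext_fin] at h
        exact h)
  have hL : ∀ v, (L v : X.obj.carrier) = theta k r (ext v) := fun v => by
    rw [← thetaLin_apply]
    simp only [ext_fin]
    rfl
  have e : (∀ i : Fin (r + 1), X.obj.deg (n - 1 - (i : ℕ))) ≃ₗ[k] X.obj.deg n := by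
    refine LinearEquiv.ofBijective L ⟨?_, fun m => ?_⟩
    · rw [injective_iff_map_eq_zero]
      intro v hv
      have h0 := hX.inj n hn (ext v) (ext_mem v) ((hL v).symm.trans (congrArg Subtype.val hv))
      funext i
      exact Subtype.ext ((ext_fin v i).symm.trans (h0 i (Nat.lt_succ_iff.1 i.2)))
    · obtain ⟨m', hm', h⟩ := hX.surj n hn m m.2
      refine ⟨fun i => ⟨m' i, hm' i⟩, Subtype.ext ?_⟩
      rw [hL, ← h]
      exact theta_congr fun i hi => dif_pos (Nat.lt_succ_iff.2 hi)
  rw [dim, ← e.finrank_eq, Module.finrank_pi_fintype, Finset.sum_range]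
  rfl

theorem exists_dim_recursion (X : FpGrMod (grading k r)) : ∃ D : ℤ, ∀ n, D ≤ n →
    dim X (n + (r + 1 : ℕ)) = ∑ i ∈ Finset.range (r + 1), dim X (n + i) := by
  obtain ⟨D, hX⟩ := exists_isRecursive X
  refine ⟨D, fun n hn => ?_⟩
  rw [dim_eq_sum_of_isRecursive hX (by omega), ← Finset.sum_range_reflect]
  refine Finset.sum_congr rfl fun i hi => ?_
  have := Finset.mem_range.1 hi
  congr 1
  omega

/-- A weighted sum of `r + 1` consecutive dimensions, normalized so as to be eventually
constant. -/
noncomputable def growth (α : ℝ) (X : FpGrMod (grading k r)) (n : ℤ) : ℝ :=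
  α ^ (-n) * ∑ j ∈ Finset.range (r + 1), invSum α (j + 1) * dim X (n + j)

/-- The eventual value of `growth`. -/
noncomputable def rank (α : ℝ) (X : FpGrMod (grading k r)) : ℝ :=
  Filter.limUnder Filter.atTop (growth α X)

variable {α : ℝ}

theorem rank_eq_of_eventually {D : ℤ} {c : ℝ} (h : ∀ n, D ≤ n → growth α X n = c) :
    rank α X = c := by
  refine Filter.Tendsto.limUnder_eq ((tendsto_const_nhds (x := c)).congr' ?_)
  filter_upwards [Filter.eventually_ge_atTop D] with n hn
  exact (h n hn).symm

theorem exists_growth_eq_rank (hα : IsBonacciRoot r α) (X : FpGrMod (grading k r)) :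
    ∃ D : ℤ, ∀ n, D ≤ n → growth α X n = rank α X := by
  obtain ⟨D, hD⟩ := exists_dim_recursion X
  have hα0 := hα.1.ne'
  have h : ∀ n, D ≤ n → growth α X n = growth α X D := by
    intro n hn
    induction n, hn using Int.leInduction with
    | base => rfl
    | succ n hn ih =>
      rw [← ih]
      have h1 := sum_invSum_shift hα (fun j => (dim X (n + j) : ℝ)) (by
        rw [hD n hn]
        push_cast
        rfl)
      have h2 : ∀ j : ℕ, n + 1 + (j : ℤ) = n + ((j + 1 : ℕ) : ℤ) := fun j => by push_cast; ring
      rw [growth, growth]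
      simp only [h2]
      rw [h1, ← mul_assoc, neg_add, zpow_add₀ hα0, zpow_neg_one, mul_assoc (α ^ (-n)),
        inv_mul_cancel₀ hα0, mul_one]
  exact ⟨D, fun n hn => (h n hn).trans (rank_eq_of_eventually h).symm⟩

theorem rank_add (hα : IsBonacciRoot r α) {D : ℤ}
    (h : ∀ n, D ≤ n → dim Y n = dim X n + dim Z n) : rank α Y = rank α X + rank α Z := by
  obtain ⟨D₁, h1⟩ := exists_growth_eq_rank hα X
  obtain ⟨D₂, h2⟩ := exists_growth_eq_rank hα Z
  refine rank_eq_of_eventually (D := max D (max D₁ D₂)) fun n hn => ?_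
  rw [← h1 n (by omega), ← h2 n (by omega), growth, growth, growth, ← mul_add,
    ← Finset.sum_add_distrib]
  congr 1
  refine Finset.sum_congr rfl fun j _ => ?_
  rw [h _ (by omega), Nat.cast_add, mul_add]

theorem rank_shiftSelf (hα : IsBonacciRoot r α) (n : ℤ) :
    rank α (FpGrMod.shiftSelf (grading k r) n) =
      α ^ n * rank α (FpGrMod.shiftSelf (grading k r) 0) := by
  obtain ⟨D, h⟩ := exists_growth_eq_rank hα (FpGrMod.shiftSelf (grading k r) 0)
  refine rank_eq_of_eventually (D := D - n) fun i hi => ?_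
  rw [← h (n + i) (by omega), growth, growth, ← mul_assoc, ← zpow_add₀ hα.1.ne',
    show n + -(n + i) = -i by ring]
  congr 1
  refine Finset.sum_congr rfl fun j _ => ?_
  have hd : dim (FpGrMod.shiftSelf (grading k r) n) (i + j) =
      dim (FpGrMod.shiftSelf (grading k r) 0) (n + i + j) := by
    change Module.finrank k (grading k r (n + (i + j))) =
      Module.finrank k (grading k r (0 + (n + i + j)))
    rw [zero_add, add_assoc]
  rw [hd]

theorem rank_shiftSelf_zero_pos (hα : IsBonacciRoot r α) :
    0 < rank α (FpGrMod.shiftSelf (grading k r) 0) := by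
  obtain ⟨D, h⟩ := exists_growth_eq_rank hα (FpGrMod.shiftSelf (grading k r) 0)
  rw [← h (max D 0) (le_max_left _ _)]
  obtain ⟨n, hn⟩ := Int.eq_ofNat_of_zero_le (le_max_right D 0)
  rw [hn]
  have hα0 := hα.1
  refine mul_pos (by positivity) (Finset.sum_pos' (fun j _ => ?_) ⟨0, by simp, ?_⟩)
  · exact mul_nonneg (invSum_pos hα0 j).le (Nat.cast_nonneg _)
  · refine mul_pos (invSum_pos hα0 0) (Nat.cast_pos.2 ?_)
    have := grading_finite k r (0 + ((n : ℤ) + ((0 : ℕ) : ℤ)))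
    change 0 < Module.finrank k (grading k r (0 + ((n : ℤ) + ((0 : ℕ) : ℤ))))
    have hmem := gen_pow_mem (k := k) (r := r) 0 n
    rw [show (n : ℤ) = 0 + ((n : ℤ) + ((0 : ℕ) : ℤ)) by simp] at hmem
    have : Nontrivial (grading k r (0 + ((n : ℤ) + ((0 : ℕ) : ℤ)))) :=
      ⟨⟨_, hmem⟩, 0, fun h => gen_zero_pow_ne_zero k r n (congrArg Subtype.val h)⟩
    exact Module.finrank_pos (M := grading k r (0 + ((n : ℤ) + ((0 : ℕ) : ℤ))))

/-- The normalized rank as a homomorphism on the Grothendieck group. -/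
noncomputable def rankHom (hα : IsBonacciRoot r α) : K0 (Qgr (grading k r)) →+ ℝ :=
  QuotientAddGroup.lift _ (FreeAbelianGroup.lift fun X : Qgr (grading k r) =>
    rank α ((Localization.Construction.objEquiv (finDimIso (grading k r))).symm X) /
      rank α (FpGrMod.shiftSelf (grading k r) 0)) (by
    refine (AddSubgroup.closure_le _).2 ?_
    rintro _ ⟨S, hS, rfl⟩
    obtain ⟨D, hD⟩ := dim_add_of_shortExact hS
      ((Localization.Construction.objEquiv (finDimIso (grading k r))).apply_symm_apply S.X₁)
      ((Localization.Construction.objEquiv (finDimIso (grading k r))).apply_symm_apply S.X₂)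
      ((Localization.Construction.objEquiv (finDimIso (grading k r))).apply_symm_apply S.X₃)
    change FreeAbelianGroup.lift _ _ = 0
    rw [map_sub, map_sub, FreeAbelianGroup.lift_apply_of, FreeAbelianGroup.lift_apply_of,
      FreeAbelianGroup.lift_apply_of, rank_add hα hD]
    ring)

theorem rankHom_of (hα : IsBonacciRoot r α) (X : FpGrMod (grading k r)) :
    rankHom hα (K0.of ((quotientFunctor (grading k r)).obj X)) =
      rank α X / rank α (FpGrMod.shiftSelf (grading k r) 0) :=
  FreeAbelianGroup.lift_apply_of _ _

theorem rankHom_twistedO (hα : IsBonacciRoot r α) (n : ℤ) :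
    rankHom hα (K0.of (twistedO k r n)) = α ^ n := by
  refine (rankHom_of hα (FpGrMod.shiftSelf (grading k r) n)).trans ?_
  rw [rank_shiftSelf hα, mul_div_assoc, div_self (rank_shiftSelf_zero_pos hα).ne', mul_one]

/-! ## The classes of the twists generate the Grothendieck group -/

theorem exists_of_eq_sum_twistedO (X : FpGrMod (grading k r)) : ∃ D : ℤ, ∀ N, D ≤ N →
    ∃ (s : ℕ) (l : Fin s → ℕ), (∀ j, l j ≤ r) ∧
      K0.of ((quotientFunctor (grading k r)).obj X) =
        ∑ j, K0.of (twistedO k r (-(N + 1 + l j))) := by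
  obtain ⟨D, hX⟩ := exists_isRecursive X
  refine ⟨D, fun N hN => ?_⟩
  obtain ⟨s, l, f, hl, -, hf⟩ := hX.exists_cover hN
  refine ⟨s, l, hl, ?_⟩
  let f' : FpGrMod.free (grading k r) (coverDeg N l) ⟶ X := ObjectProperty.homMk f
  have hf' : finDimIso (grading k r) f' :=
    finDimIso_of_eventually (fun n hn => (hf n hn).1) (fun n hn => (hf n hn).2)
  have := isIso_quotientFunctor_map f' hf'
  rw [← K0.of_eq_of_iso_fp (asIso ((quotientFunctor (grading k r)).map f')), K0.of_free]
  rfl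

theorem exists_of_eq_sum_range (X : Qgr (grading k r)) : ∃ D : ℤ, ∀ N, D ≤ N →
    ∃ a : ℕ → ℕ, K0.of X =
      ∑ l ∈ Finset.range (r + 1), a l • K0.of (twistedO k r (-(N + 1 + (l : ℕ)))) := by
  obtain ⟨X, rfl⟩ := exists_quotientFunctor_obj X
  obtain ⟨D, hD⟩ := exists_of_eq_sum_twistedO X
  refine ⟨D, fun N hN => ?_⟩
  obtain ⟨s, l, hl, h⟩ := hD N hN
  refine ⟨fun i => (Finset.univ.filter fun j => l j = i).card, ?_⟩
  rw [h, ← Finset.sum_fiberwise_of_maps_to (t := Finset.range (r + 1)) (g := l)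
    fun j _ => Finset.mem_range.2 (Nat.lt_succ_iff.2 (hl j))]
  refine Finset.sum_congr rfl fun i _ => ?_
  rw [← Finset.sum_const]
  refine Finset.sum_congr rfl fun j hj => ?_
  rw [(Finset.mem_filter.1 hj).2]

/-- The freedom to choose any `N ≥ D` is what lets two classes be written in terms of the same `r +
1` twists and added. -/
theorem exists_eq_sum_range (z : K0 (Qgr (grading k r))) : ∃ D : ℤ, ∀ N, D ≤ N →
    ∃ a : ℕ → ℤ, z =
      ∑ l ∈ Finset.range (r + 1), a l • K0.of (twistedO k r (-(N + 1 + (l : ℕ)))) := by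
  obtain ⟨z, rfl⟩ := QuotientAddGroup.mk_surjective z
  induction z using FreeAbelianGroup.induction_on with
  | zero => exact ⟨0, fun N _ => ⟨0, by simp⟩⟩
  | of X =>
    obtain ⟨D, hD⟩ := exists_of_eq_sum_range X
    refine ⟨D, fun N hN => ?_⟩
    obtain ⟨a, ha⟩ := hD N hN
    refine ⟨fun l => a l, ha.trans ?_⟩
    simp only [natCast_zsmul]
  | neg X ih =>
    obtain ⟨D, hD⟩ := ih
    refine ⟨D, fun N hN => ?_⟩
    obtain ⟨a, ha⟩ := hD N hN
    exact ⟨-a, by rw [QuotientAddGroup.mk_neg, ha]; simp⟩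
  | add z w hz hw =>
    obtain ⟨D₁, hD₁⟩ := hz
    obtain ⟨D₂, hD₂⟩ := hw
    refine ⟨max D₁ D₂, fun N hN => ?_⟩
    obtain ⟨a, ha⟩ := hD₁ N (by omega)
    obtain ⟨b, hb⟩ := hD₂ N (by omega)
    exact ⟨a + b, by rw [QuotientAddGroup.mk_add, ha, hb, ← Finset.sum_add_distrib]; simp [add_smul]⟩

theorem hom_eq_of_twistedO {G : Type*} [AddCommGroup G] {φ ψ : K0 (Qgr (grading k r)) →+ G}
    (h : ∀ n, φ (K0.of (twistedO k r n)) = ψ (K0.of (twistedO k r n))) : φ = ψ := by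
  refine AddMonoidHom.ext fun z => ?_
  obtain ⟨D, hD⟩ := exists_eq_sum_range z
  obtain ⟨a, rfl⟩ := hD D le_rfl
  simp only [map_sum, map_zsmul, h]

theorem rankHom_injective (hα : IsBonacciRoot r α) :
    Function.Injective (rankHom (k := k) hα) := by
  rw [injective_iff_map_eq_zero]
  intro z hz
  obtain ⟨D, hD⟩ := exists_eq_sum_range z
  obtain ⟨a, rfl⟩ := hD D le_rfl
  have hα0 := hα.1.ne'
  -- Removing the common factor `α ^ (-D)` reduces the vanishing to a relation among `α⁻¹, …,
  -- α⁻ʳ⁻¹`.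
  have h : ∑ l ∈ Finset.range (r + 1), (a l : ℝ) * α⁻¹ ^ (l + 1) = 0 := by
    refine (mul_eq_zero.1 (?_ : α ^ (-D) * _ = 0)).resolve_left (zpow_ne_zero _ hα0)
    rw [← hz, map_sum, Finset.mul_sum]
    refine Finset.sum_congr rfl fun l _ => ?_
    rw [map_zsmul, rankHom_twistedO, zsmul_eq_mul, mul_left_comm,
      show -(D + 1 + (l : ℤ)) = -D + -((l + 1 : ℕ) : ℤ) by push_cast; ring, zpow_add₀ hα0,
      zpow_neg α ((l + 1 : ℕ) : ℤ), zpow_natCast, inv_pow]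
  have h0 := eq_zero_of_sum_mul_pow_eq_zero hα a h
  exact Finset.sum_eq_zero fun l hl => by
    rw [h0 l (Nat.lt_succ_iff.1 (Finset.mem_range.1 hl)), zero_smul]

theorem range_rankHom (hα : IsBonacciRoot r α) :
    Set.range (rankHom (k := k) hα) = powGroup α := by
  apply Set.Subset.antisymm
  · rintro _ ⟨z, rfl⟩
    obtain ⟨D, hD⟩ := exists_eq_sum_range z
    obtain ⟨a, rfl⟩ := hD D le_rfl
    rw [map_sum]
    change _ ∈ powGroup α
    refine sum_mem fun l _ => ?_
    rw [map_zsmul, rankHom_twistedO]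
    refine zsmul_mem (AddSubgroup.subset_closure ?_) _
    exact Set.mem_range_self (-(D + 1 + (l : ℤ)))
  · have h : powGroup α ≤ (rankHom (k := k) hα).range := by
      refine (AddSubgroup.closure_le _).2 ?_
      rintro _ ⟨n, rfl⟩
      exact ⟨_, rankHom_twistedO hα n⟩
    exact h

/-- Classes of objects are sums of twists, whose images are positive. Conversely a nonnegative
element of the group is a sum of powers of `α`, realized by a direct sum of the corresponding
twists. -/
theorem rankHom_image_positiveCone (hα : IsBonacciRoot r α) :
    rankHom hα '' K0.positiveCone (Qgr (grading k r)) = (powGroup α : Set ℝ) ∩ Set.Ici 0 := by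
  apply Set.Subset.antisymm
  · rintro _ ⟨_, ⟨X, rfl⟩, rfl⟩
    refine Set.mem_inter ((range_rankHom (k := k) hα).subset (Set.mem_range_self _)) ?_
    obtain ⟨D, hD⟩ := exists_of_eq_sum_range X
    obtain ⟨a, ha⟩ := hD D le_rfl
    rw [ha, map_sum]
    refine Set.mem_Ici.2 (Finset.sum_nonneg fun l _ => ?_)
    rw [map_nsmul, rankHom_twistedO]
    exact nsmul_nonneg (zpow_nonneg hα.1.le _) _
  · rintro β ⟨hβ, hpos⟩
    suffices ∃ X : FpGrMod (grading k r),
        rankHom hα (K0.of ((quotientFunctor (grading k r)).obj X)) = β by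
      obtain ⟨X, hX⟩ := this
      exact ⟨_, ⟨_, rfl⟩, hX⟩
    have hmem := mem_closure_of_mem_powGroup hα hβ hpos
    clear hβ hpos
    induction hmem using AddSubmonoid.closure_induction with
    | mem β h =>
      obtain ⟨n, rfl⟩ := h
      exact ⟨FpGrMod.shiftSelf _ n, rankHom_twistedO hα n⟩
    | zero => exact ⟨FpGrMod.zero _, by rw [K0.of_zero_fp, map_zero]⟩
    | add β γ _ _ h₁ h₂ =>
      obtain ⟨X, rfl⟩ := h₁
      obtain ⟨Y, rfl⟩ := h₂
      exact ⟨FpGrMod.prod X Y, by rw [K0.of_prod, map_add]⟩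

end PenroseAlg

theorem theorem6 (k : Type*) [Field k] (r : ℕ) (hr : 1 ≤ r) :
    (∃! α : ℝ, 0 < α ∧ α ^ (r + 1) - ∑ i ∈ Finset.range (r + 1), α ^ i = 0) ∧
    ∀ α : ℝ, 0 < α → α ^ (r + 1) - ∑ i ∈ Finset.range (r + 1), α ^ i = 0 →
      ∃ φ : K0 (Qgr (PenroseAlg.grading k r)) →+ ℝ,
        (∀ n : ℤ, φ (K0.of (PenroseAlg.twistedO k r n)) = α ^ n) ∧
        (∀ ψ : K0 (Qgr (PenroseAlg.grading k r)) →+ ℝ,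
          (∀ n : ℤ, ψ (K0.of (PenroseAlg.twistedO k r n)) = α ^ n) → ψ = φ) ∧
        Function.Injective φ ∧
        Set.range φ = (Algebra.adjoin ℤ {α} : Set ℝ) ∧
        φ '' K0.positiveCone (Qgr (PenroseAlg.grading k r)) =
          (Algebra.adjoin ℤ {α} : Set ℝ) ∩ Set.Ici 0 ∧
        φ '' K0.positiveCone (Qgr (PenroseAlg.grading k r)) =
          (Algebra.adjoin ℤ {α⁻¹} : Set ℝ) ∩ Set.Ici 0 := by
  refine ⟨existsUnique_bonacciRoot r, fun α hα0 h => ?_⟩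
  have hα : IsBonacciRoot r α := (isBonacciRoot_iff hα0).2 h
  refine ⟨PenroseAlg.rankHom hα, PenroseAlg.rankHom_twistedO hα, fun ψ hψ => ?_,
    PenroseAlg.rankHom_injective hα, ?_, ?_, ?_⟩
  · exact PenroseAlg.hom_eq_of_twistedO fun n =>
      (hψ n).trans (PenroseAlg.rankHom_twistedO hα n).symm
  · rw [PenroseAlg.range_rankHom, adjoin_eq_powGroup hα]
  · rw [PenroseAlg.rankHom_image_positiveCone, adjoin_eq_powGroup hα]
  · rw [PenroseAlg.rankHom_image_positiveCone, adjoin_inv_eq_powGroup hα]
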